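/- **Notation.** Let $-\infty<a<b<\infty$, $m,d\in\mathbb N$, $\frac13<\beta<\frac12$. For a function $f$ on $[a,b]$ let $[[f]]_\beta$ be its $\beta$-Hölder seminorm, and for $F$ on $\Delta=\{(s,t):a\le s\le t\le b\}$ put $[[F]]_{2\beta}=\sup_{a\le s<t\le b}|F_{s,t}|/(t-s)^{2\beta}$. A *$\beta$-Hölder multiplicative functional* is a triple $(X,Y,X\otimes Y)$ of $\beta$-Hölder functions $X:[a,b]\to\mathbb R^m$, $Y:[a,b]\to\mathbb R^d$ and a continuous $X\otimes Y:\Delta\to\mathbb R^{m}\otimes\mathbb R^{d}$ with finite $[[(X\otimes Y)^{i,j}]]_{2\beta}$ for all $i,j$ and $(X\otimes Y)_{s,u}+(X\otimes Y)_{u,t}+(X(u)-X(s))\otimes(Y(t)-Y(u))=(X\otimes Y)_{s,t}$ for $a\le s\le u\le t\le b$. $BV_{loc}(\mathbb R^m)$ is the space of locally integrable $\psi$ whose distributional gradient $D\psi$ is an $\mathbb R^m$-valued Radon measure; $\|D\psi\|$ is its total variation measure. For a nonnegative Radon measure $\nu$ put $U^{1-s}\nu(x)=\int_{\mathbb R^m}|x-z|^{1-s-m}\,\nu(dz)\in[0,\infty]$.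 $X$ is *$(s,1)$-variable* w.r.t. $\psi$ if $t\mapsto U^{1-s}\|D\psi\|(X(t))$ is in $L^1([a,b])$. Write $\gamma^{\theta,r}(t)=tX(r)+(1-t)X(\theta)$ and $$S^{\varepsilon}(\psi)=\int_a^b\int_a^b|r-\theta|^{\varepsilon-1}\int_0^1U^{1-s}\|D\psi\|(\gamma^{\theta,r}(t))\,t^s\,dt\,d\theta\,dr .$$ With $(-1)^\gamma=e^{i\pi\gamma}$ let $$D^\gamma_{a+}f(r)=\tfrac{1}{\Gamma(1-\gamma)}\Big(\tfrac{f(r)}{(r-a)^\gamma}+\gamma\int_a^r\tfrac{f(r)-f(\theta)}{(r-\theta)^{\gamma+1}}d\theta\Big),\qquad D^\gamma_{b-}f(r)=\tfrac{(-1)^\gamma}{\Gamma(1-\gamma)}\Big(\tfrac{f(r)}{(b-r)^\gamma}+\gamma\int_r^b\tfrac{f(r)-f(\theta)}{(\theta-r)^{\gamma+1}}d\theta\Big),$$ $$\mathcal D^\gamma_{b-}F(r)=\tfrac{(-1)^\gamma}{\Gamma(1-\gamma)}\Big(\tfrac{F_{r,b}}{(b-r)^\gamma}+\gamma\int_r^b\tfrac{F_{r,\theta}}{(\theta-r)^{\gamma+1}}d\theta\Big),$$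 $$\hat D^\gamma_{a+}f(X)(r)=\tfrac{1}{\Gamma(1-\gamma)}\Big(\tfrac{f(X(r))}{(r-a)^\gamma}+\gamma\int_a^r\tfrac{f(X(r))-f(X(\theta))-\sum_{i}\partial_if(X(\theta))(X^i(r)-X^i(\theta))}{(r-\theta)^{\gamma+1}}d\theta\Big).$$ The fractional-calculus rough integral of Hu and Nualart is $$\int_a^b\varphi(X)\,dY=(-1)^\alpha\sum_{j}\int_a^b\hat D^\alpha_{a+}\varphi_j(X)(r)\,D^{1-\alpha}_{b-}(Y^j-Y^j(b))(r)\,dr-(-1)^{2\alpha-1}\sum_{i,j}\int_a^bD^{2\alpha-1}_{a+}(\partial_i\varphi_j(X))(r)\,D^{1-\alpha}_{b-}\mathcal D^{1-\alpha}_{b-}(X\otimes Y)^{i,j}(r)\,dr .\qquad(*)$$ It *exists* for a range of $\alpha$ if, for all $\alpha$ in that range, the partial derivatives $\partial_i\varphi_j(X(r))$ exist and all inner integrals in the integrands of $(*)$ converge absolutely for a.e. $r\in[a,b]$, the integrands are integrable over $[a,b]$, and the right-hand side of $(*)$ is a real number that does not depend on $\alpha$. **Theorem.** Let $\frac13<\beta<\frac12$,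 $\frac1\beta-2<s<1$ and $\frac12(\beta(1+s)-(1-\beta))<\varepsilon<\beta(1+s)-(1-\beta)$. Let $(X,Y,X\otimes Y)$ be a $\beta$-Hölder multiplicative functional and let $\varphi=(\varphi_1,\dots,\varphi_d):\mathbb R^m\to\mathbb R^d$ be Lipschitz with $\partial_i\varphi_j\in BV_{loc}(\mathbb R^m)$ for all $i,j$. Suppose that $X$ is $(s,1)$-variable w.r.t. every $\partial_i\varphi_j$ and that $S^\varepsilon(\partial_i\varphi_j)<\infty$ for all $i,j$. Then for a.e. $t\in[a,b]$ and all $i,j$ the point $X(t)$ is a Lebesgue point of $\partial_i\varphi_j$ with Lebesgue value $\partial_i\varphi_j(X(t))$; the integral $\int_a^b\varphi(X)\,dY$ in $(*)$ exists for the range $1-\beta<\alpha\le\beta(1+s)-\varepsilon$; and $$\Big|\int_a^b\varphi(X)dY\Big|\le c\sum_{j=1}^d\Big\{\|\varphi_j(X)\|_{L^1([a,b])}+\mathrm{Lip}(\varphi_j)[[X]]_\beta+\sum_{i=1}^mS^\varepsilon(\partial_i\varphi_j)\,[[X]]_\beta^{1+s}+\sum_{i=1}^m\big\|U^{1-s}\|D\partial_i\varphi_j\|(X)\big\|_{L^1([a,b])}[[X]]_\beta^{1+s}\Big\}[[Y^j]]_\beta$$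 $$\qquad+c\sum_{j=1}^d\sum_{i=1}^m\Big\{\|\partial_i\varphi_j(X)\|_{L^1([a,b])}+\big\|U^{1-s}\|D\partial_i\varphi_j\|(X)\big\|_{L^1([a,b])}[[X]]_\beta^{s}\Big\}[[(X\otimes Y)^{i,j}]]_{2\beta},$$ with a constant $c$ depending only on $a,b,m,\beta,s,\varepsilon$. -/

import Mathlib

open Set Filter Topology MeasureTheory
open scoped ENNReal NNReal

noncomputable section

/-- The Euclidean space `ℝⁿ`. -/
abbrev Euc (n : ℕ) : Type := EuclideanSpace ℝ (Fin n)

/-! ### Hölder seminorms and multiplicative functionals -/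

/-- The `β`-Hölder seminorm `[[f]]_β` of `f` on the interval `[a, b]`, with values in `[0, ∞]`. -/
def holderSeminorm {E : Type*} [PseudoEMetricSpace E] (a b β : ℝ) (f : ℝ → E) : ℝ≥0∞ :=
  eHolderNorm β.toNNReal (fun t : Icc a b => f t)

/-- The smallest Lipschitz constant of `f`, with values in `[0, ∞]`
(Hölder seminorm of exponent one on the whole space). -/
def lipConst {E : Type*} [PseudoEMetricSpace E] (f : E → ℝ) : ℝ≥0∞ :=
  eHolderNorm 1 f

/-- The Hölder seminorm `sup_{a ≤ s < t ≤ b} |F(s,t)| / (t - s) ^ κ` of a function `F` of two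
parameters. -/
def twoParamSeminorm (a b κ : ℝ) (F : ℝ → ℝ → ℝ) : ℝ≥0∞ :=
  ⨆ (s : ℝ) (t : ℝ) (_ : a ≤ s) (_ : s < t) (_ : t ≤ b), ENNReal.ofReal (|F s t| / (t - s) ^ κ)

/-- `(X, Y, Z)`, where `Z` stands for `X ⊗ Y`, is an `(m, d)`-dimensional `β`-Hölder continuous
multiplicative functional on `[a, b]`. Only the values of `X`, `Y` on `[a, b]` and of `Z` on
`{(s, t) | a ≤ s ≤ t ≤ b}` matter. -/
structure IsMultiplicativeFunctional {m d : ℕ} (a b β : ℝ) (X : ℝ → Euc m) (Y : ℝ → Euc d)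
    (Z : ℝ → ℝ → Matrix (Fin m) (Fin d) ℝ) : Prop where
  holder_left : ∃ C : ℝ≥0, HolderOnWith C β.toNNReal X (Icc a b)
  holder_right : ∃ C : ℝ≥0, HolderOnWith C β.toNNReal Y (Icc a b)
  continuousOn : ContinuousOn (fun p : ℝ × ℝ => Z p.1 p.2)
    {p : ℝ × ℝ | a ≤ p.1 ∧ p.1 ≤ p.2 ∧ p.2 ≤ b}
  chen : ∀ s u t : ℝ, a ≤ s → s ≤ u → u ≤ t → t ≤ b → ∀ (i : Fin m) (j : Fin d),
    Z s u i j + Z u t i j + (X u i - X s i) * (Y t j - Y u j) = Z s t i j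
  bound : ∃ C : ℝ, ∀ s t : ℝ, a ≤ s → s ≤ t → t ≤ b → ∀ (i : Fin m) (j : Fin d),
    |Z s t i j| ≤ C * (t - s) ^ (2 * β)

/-! ### Functions of locally bounded variation, Riesz potentials, variability -/

/-- The (classical) partial derivative `∂ᵢ f (x)`; its value is `0` where it does not exist. -/
def partialDeriv {m : ℕ} (i : Fin m) (f : Euc m → ℝ) (x : Euc m) : ℝ :=
  lineDeriv ℝ f x (EuclideanSpace.single i (1 : ℝ))

/-- `ν` is the total variation measure `‖Dψ‖` of the distributional gradient `Dψ` of `ψ`: it is a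
nonnegative Radon measure and `Dψ = σ ν` (polar decomposition) with a Borel field `σ` of unit
vectors, that is, `∫ ψ ∂ᵢη dx = -∫ η σᵢ dν` for all test functions `η` and all `i`. -/
def IsGradientVariation {m : ℕ} (ψ : Euc m → ℝ) (ν : Measure (Euc m)) : Prop :=
  IsLocallyFiniteMeasure ν ∧
    ∃ σ : Euc m → Euc m, Measurable σ ∧ (∀ᵐ x ∂ν, ‖σ x‖ = 1) ∧
      ∀ (i : Fin m) (η : Euc m → ℝ), ContDiff ℝ (⊤ : ℕ∞) η → HasCompactSupport η →
        ∫ x, ψ x * partialDeriv i η x = -∫ x, η x * σ x i ∂ν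

/-- `ψ ∈ BV_loc(ℝᵐ)`: `ψ` is locally integrable and its distributional partial derivatives are
signed Radon measures. -/
def IsBVLoc {m : ℕ} (ψ : Euc m → ℝ) : Prop :=
  LocallyIntegrable ψ ∧ ∃ ν : Measure (Euc m), IsGradientVariation ψ ν

open Classical in
/-- The total variation measure `‖Dψ‖` of the gradient measure of `ψ ∈ BV_loc(ℝᵐ)`. -/
def gradientVariation {m : ℕ} (ψ : Euc m → ℝ) : Measure (Euc m) :=
  if h : ∃ ν : Measure (Euc m), IsGradientVariation ψ ν then h.choose else 0

/-- The potential `U^γ ν (x) = ∫ |x - z| ^ (γ - m) ν(dz) ∈ [0, ∞]`. For `γ < m` the integrand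
is `∞` at `z = x`. -/
def rieszPotential {m : ℕ} (γ : ℝ) (ν : Measure (Euc m)) (x : Euc m) : ℝ≥0∞ :=
  ∫⁻ z, edist x z ^ (γ - (m : ℝ)) ∂ν

/-- `X` is `(s, p)`-variable with respect to `ψ` on `[a, b]`:
the function `t ↦ U^{1-s} ‖Dψ‖ (X(t))` belongs to `L^p([a, b])`, `1 ≤ p < ∞`. -/
def IsVariable {m : ℕ} (a b s p : ℝ) (ψ : Euc m → ℝ) (X : ℝ → Euc m) : Prop :=
  ∫⁻ t in Icc a b, rieszPotential (1 - s) (gradientVariation ψ) (X t) ^ p < ∞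

/-- The `L¹([a, b])`-norm of `t ↦ U^{1-s} ‖Dψ‖ (X(t))`. -/
def variabilityNorm {m : ℕ} (a b s : ℝ) (ψ : Euc m → ℝ) (X : ℝ → Euc m) : ℝ≥0∞ :=
  ∫⁻ t in Icc a b, rieszPotential (1 - s) (gradientVariation ψ) (X t)

/-- The weighted integral of `U^{1-s} ‖Dψ‖` along the segments
`γ^{θ,r}(t) = t X(r) + (1 - t) X(θ)`, namely
`∫_a^b ∫_a^b |r - θ|^{ε-1} ∫_0^1 U^{1-s} ‖Dψ‖ (γ^{θ,r}(t)) t^s dt dθ dr ∈ [0, ∞]`. -/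
def segmentVariability {m : ℕ} (a b s ε : ℝ) (ψ : Euc m → ℝ) (X : ℝ → Euc m) : ℝ≥0∞ :=
  ∫⁻ r in Icc a b, ∫⁻ θ in Icc a b, edist r θ ^ (ε - 1) *
    ∫⁻ t in Icc (0 : ℝ) 1,
      rieszPotential (1 - s) (gradientVariation ψ) (t • X r + (1 - t) • X θ) *
        ENNReal.ofReal (t ^ s)

/-- `x` is a Lebesgue point of `ψ` with Lebesgue value `z`:
`⨍_{B(x,ρ)} |ψ(y) - z| dy → 0` as `ρ → 0`. -/
def HasLebesgueValue {m : ℕ} (ψ : Euc m → ℝ) (x : Euc m) (z : ℝ) : Prop :=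
  Tendsto (fun ρ : ℝ => ⨍ y in Metric.ball x ρ, |ψ y - z|) (𝓝[>] 0) (𝓝 0)

/-! ### Fractional derivatives

The factor `(-1) ^ γ` is the complex number `e^{iπγ}` (principal branch), so right sided
derivatives are complex valued. Each operator comes with the statement that its inner integral
converges absolutely at the given point. -/

/-- The left sided Weyl-Marchaud derivative `D_{a+}^γ f (t)`. -/
def leftDeriv (a γ : ℝ) (f : ℝ → ℝ) (t : ℝ) : ℝ :=
  1 / Real.Gamma (1 - γ) *
    (f t / (t - a) ^ γ + γ * ∫ s in a..t, (f t - f s) / (t - s) ^ (γ + 1))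

/-- The integral in `D_{a+}^γ f (t)` converges absolutely. -/
def LeftDerivDefined (a γ : ℝ) (f : ℝ → ℝ) (t : ℝ) : Prop :=
  IntervalIntegrable (fun s => (f t - f s) / (t - s) ^ (γ + 1)) volume a t

/-- The right sided Weyl-Marchaud derivative `D_{b-}^γ f (t)`. -/
def rightDeriv (b γ : ℝ) (f : ℝ → ℂ) (t : ℝ) : ℂ :=
  (-1 : ℂ) ^ (γ : ℂ) / (Real.Gamma (1 - γ) : ℂ) *
    (f t / (((b - t) ^ γ : ℝ) : ℂ) +
      (γ : ℂ) * ∫ s in t..b, (f t - f s) / (((s - t) ^ (γ + 1) : ℝ) : ℂ))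

/-- The integral in `D_{b-}^γ f (t)` converges absolutely. -/
def RightDerivDefined (b γ : ℝ) (f : ℝ → ℂ) (t : ℝ) : Prop :=
  IntervalIntegrable (fun s => (f t - f s) / (((s - t) ^ (γ + 1) : ℝ) : ℂ)) volume t b

/-- The right sided derivative `𝒟_{b-}^γ F (r)` of a function `F` of two parameters. -/
def rightDerivTwo (b γ : ℝ) (F : ℝ → ℝ → ℝ) (r : ℝ) : ℂ :=
  (-1 : ℂ) ^ (γ : ℂ) / (Real.Gamma (1 - γ) : ℂ) *
    ((F r b / (b - r) ^ γ + γ * ∫ s in r..b, F r s / (s - r) ^ (γ + 1) : ℝ) : ℂ)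

/-- The integral in `𝒟_{b-}^γ F (r)` converges absolutely. -/
def RightDerivTwoDefined (b γ : ℝ) (F : ℝ → ℝ → ℝ) (r : ℝ) : Prop :=
  IntervalIntegrable (fun s => F r s / (s - r) ^ (γ + 1)) volume r b

/-- The first order remainder
`f(X(r)) - f(X(θ)) - ∑ᵢ ∂ᵢf(X(θ)) (Xⁱ(r) - Xⁱ(θ))`. -/
def taylorRemainder {m : ℕ} (f : Euc m → ℝ) (X : ℝ → Euc m) (θ r : ℝ) : ℝ :=
  f (X r) - f (X θ) - ∑ i, partialDeriv i f (X θ) * (X r i - X θ i)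

/-- The compensated fractional derivative `\hat D_{a+}^γ f(X) (r)`. -/
def compDeriv {m : ℕ} (a γ : ℝ) (f : Euc m → ℝ) (X : ℝ → Euc m) (r : ℝ) : ℝ :=
  1 / Real.Gamma (1 - γ) *
    (f (X r) / (r - a) ^ γ + γ * ∫ θ in a..r, taylorRemainder f X θ r / (r - θ) ^ (γ + 1))

/-- The integral in `\hat D_{a+}^γ f(X) (r)` converges absolutely. -/
def CompDerivDefined {m : ℕ} (a γ : ℝ) (f : Euc m → ℝ) (X : ℝ → Euc m) (r : ℝ) : Prop :=
  IntervalIntegrable (fun θ => taylorRemainder f X θ r / (r - θ) ^ (γ + 1)) volume a r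

/-! ### The rough integral -/

/-- The integrand `\hat D_{a+}^α f(X)(r) D_{b-}^{1-α}(y - y(b))(r)`. -/
def firstIntegrand {m : ℕ} (a b α : ℝ) (f : Euc m → ℝ) (X : ℝ → Euc m) (y : ℝ → ℝ)
    (r : ℝ) : ℂ :=
  (compDeriv a α f X r : ℂ) * rightDeriv b (1 - α) (fun t => ((y t - y b : ℝ) : ℂ)) r

/-- The integrand `D_{a+}^{2α-1}(∂ᵢf(X))(r) D_{b-}^{1-α} 𝒟_{b-}^{1-α} F (r)`. -/
def secondIntegrand {m : ℕ} (a b α : ℝ) (i : Fin m) (f : Euc m → ℝ) (X : ℝ → Euc m)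
    (F : ℝ → ℝ → ℝ) (r : ℝ) : ℂ :=
  (leftDeriv a (2 * α - 1) (fun t => partialDeriv i f (X t)) r : ℂ) *
    rightDeriv b (1 - α) (rightDerivTwo b (1 - α) F) r

/-- The right hand side of the definition of `∫_a^b φ(X) dY` for the parameter `α`. -/
def roughIntegralExpr {m d : ℕ} (a b α : ℝ) (φ : Euc m → Euc d) (X : ℝ → Euc m) (Y : ℝ → Euc d)
    (Z : ℝ → ℝ → Matrix (Fin m) (Fin d) ℝ) : ℂ :=
  (-1 : ℂ) ^ (α : ℂ) *
      (∑ j : Fin d, ∫ r in a..b, firstIntegrand a b α (fun x => φ x j) X (fun t => Y t j) r)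
    - (-1 : ℂ) ^ ((2 * α - 1 : ℝ) : ℂ) *
      (∑ i : Fin m, ∑ j : Fin d, ∫ r in a..b,
        secondIntegrand a b α i (fun x => φ x j) X (fun s t => Z s t i j) r)

/-- For the parameter `α`, all integrands in the definition of `∫_a^b φ(X) dY` are well-defined
at almost every `r ∈ [a, b]`, and all integrals exist. -/
structure RoughIntegralConverges {m d : ℕ} (a b α : ℝ) (φ : Euc m → Euc d) (X : ℝ → Euc m)
    (Y : ℝ → Euc d) (Z : ℝ → ℝ → Matrix (Fin m) (Fin d) ℝ) : Prop where
  partials : ∀ᵐ r ∂(volume.restrict (Icc a b)), ∀ (i : Fin m) (j : Fin d),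
    LineDifferentiableAt ℝ (fun x => φ x j) (X r) (EuclideanSpace.single i (1 : ℝ))
  comp : ∀ᵐ r ∂(volume.restrict (Icc a b)), ∀ j : Fin d,
    CompDerivDefined a α (fun x => φ x j) X r
  left : ∀ᵐ r ∂(volume.restrict (Icc a b)), ∀ (i : Fin m) (j : Fin d),
    LeftDerivDefined a (2 * α - 1) (fun t => partialDeriv i (fun x => φ x j) (X t)) r
  right : ∀ᵐ r ∂(volume.restrict (Icc a b)), ∀ j : Fin d,
    RightDerivDefined b (1 - α) (fun t => ((Y t j - Y b j : ℝ) : ℂ)) r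
  rightTwo : ∀ᵐ r ∂(volume.restrict (Icc a b)), ∀ (i : Fin m) (j : Fin d),
    RightDerivTwoDefined b (1 - α) (fun s t => Z s t i j) r
  rightComp : ∀ᵐ r ∂(volume.restrict (Icc a b)), ∀ (i : Fin m) (j : Fin d),
    RightDerivDefined b (1 - α) (rightDerivTwo b (1 - α) (fun s t => Z s t i j)) r
  first_integrable : ∀ j : Fin d, IntervalIntegrable
    (firstIntegrand a b α (fun x => φ x j) X (fun t => Y t j)) volume a b
  second_integrable : ∀ (i : Fin m) (j : Fin d), IntervalIntegrable
    (secondIntegrand a b α i (fun x => φ x j) X (fun s t => Z s t i j)) volume a b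

/-- The integral `∫_a^b φ(X) dY` exists with value `I`, the parameter range being `A`: for every
`α ∈ A` everything is well-defined and convergent, and the sum equals `I`. -/
def HasRoughIntegral {m d : ℕ} (a b : ℝ) (A : Set ℝ) (φ : Euc m → Euc d) (X : ℝ → Euc m)
    (Y : ℝ → Euc d) (Z : ℝ → ℝ → Matrix (Fin m) (Fin d) ℝ) (I : ℝ) : Prop :=
  ∀ α ∈ A, RoughIntegralConverges a b α φ X Y Z ∧ roughIntegralExpr a b α φ X Y Z = (I : ℂ)

end

/-!
Every fractional derivative in the rough integral is a Marchaud functional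
`κ / Γ(1 - κ) ∫₀^∞ φ(v) v^{-κ-1} dv` of an increment `φ`: if the functions are continued by zero to
the left of `a` and by constants to the right of `b`, the boundary terms are the parts of the
integral beyond the end points. All statements therefore reduce to bounds on weighted integrals of
increments.

*Pointwise behaviour of the integrand.* Let `ψ` be a partial derivative of the Lipschitz function
`f`. Where the Riesz potential `U^{1-s} ‖Dψ‖(x)` is finite, the mass of `‖Dψ‖` in a ball of radius
`ρ` around `x` is at most a multiple of `ρ^{m-1+s}`, so that averages of `ψ` at scales `ρ` and `2ρ`
differ by a multiple of `ρ^s`. Summing over dyadic scales, the averages converge with rate `ρ^s`;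
the limit is a Lebesgue value, `f` is differentiable there, and the limit is the classical partial
derivative (`LipschitzBV.exists_values`). Comparing two points at the scale of their distance shows
that `ψ` is Hölder continuous of order `s` with the sum of the two potentials as constant, and
integration along a segment gives a Taylor remainder of order `1 + s`, weighted by the potentials
along the segment (`LipschitzBV.enorm_remainder_le`).

*Convergence and bounds.* Inserting the Hölder continuous path, the double integrals of the
compensated increments of `f(X)` and of the increments of `∂ᵢf(X)` are bounded by the segment
variability and the variability norm (`exists_compEnergy_le`, `exists_derivEnergy_le`). The boundary
term of `∂ᵢf(X)` has no supremum bound in terms of the quantities allowed in the estimate; it is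
controlled by the Hardy inequality `lintegral_hardy_le`. The right sided derivatives of `Y` and of
the second order process are bounded, the latter by Chen's relation. Together this gives the
existence of all integrals and the estimate (`AdmissibleExponent.exists_component_bound`). Chen's
relation costs a product of the Hölder seminorms of `X` and `Y`; it is absorbed by the terms that
involve the seminorm of `Y`.

*Independence of the parameter.* Put `κ = 1 - α`, and let `x` be the path and `g = ∂f(X)`. If the
left sided increments are averaged over the past with a smooth kernel at scale `ε`, the left sided
derivatives become fractional integrals of smooth functions. The compensated increment then splits
into the increment of `f(X) - ∑ᵢ gᵢ xᵢ` and a sum of products of `xᵢ` with increments of `gᵢ`.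
Fractional integration by parts, together with the semigroup property for the derivative of order
`2κ`, and Chen's relation for the right sided derivatives make the products cancel; the remaining
expression does not contain `κ` (`mollified_rough_integral_eq`). Averaging replaces the Marchaud
kernel by a kernel that converges to it and is bounded by a multiple of it, uniformly in `ε`, so the
finiteness of the double integrals permits `ε → 0` by dominated convergence
(`tendsto_mollified_rough_integral`).
-/

/-! ### The Marchaud functional -/

/-- The Marchaud functional `κ / Γ(1 - κ) ∫₀^∞ φ(v) v^{-κ-1} dv`. Every fractional derivative in the
rough integral is of this form: `φ` is the increment of the function, continued by a constant
beyond the end point of the interval. -/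
noncomputable def marchaud (κ : ℝ) (φ : ℝ → ℝ) : ℝ :=
  κ / Real.Gamma (1 - κ) * ∫ v in Ioi (0 : ℝ), φ v / v ^ (κ + 1)

/-- The integral in `marchaud κ φ` converges absolutely. -/
def MarchaudIntegrable (κ : ℝ) (φ : ℝ → ℝ) : Prop :=
  IntegrableOn (fun v => φ v / v ^ (κ + 1)) (Ioi (0 : ℝ))

lemma integrableOn_Ioi_one_div_rpow {κ ℓ : ℝ} (hκ : 0 < κ) (hℓ : 0 < ℓ) :
    IntegrableOn (fun v : ℝ => 1 / v ^ (κ + 1)) (Ioi ℓ) := by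
  refine (integrableOn_Ioi_rpow_of_lt (a := -(κ + 1)) (by linarith) hℓ).congr_fun ?_
    measurableSet_Ioi
  intro v hv
  have : 0 < v := hℓ.trans hv
  change v ^ (-(κ + 1)) = 1 / v ^ (κ + 1)
  rw [Real.rpow_neg this.le, one_div]

lemma integral_Ioi_one_div_rpow {κ ℓ : ℝ} (hκ : 0 < κ) (hℓ : 0 < ℓ) :
    ∫ v in Ioi ℓ, 1 / v ^ (κ + 1) = 1 / (κ * ℓ ^ κ) := by
  have h := integral_Ioi_rpow_of_lt (a := -(κ + 1)) (by linarith) hℓ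
  rw [show -(κ + 1) + 1 = -κ by ring, Real.rpow_neg hℓ.le] at h
  rw [show 1 / (κ * ℓ ^ κ) = -(ℓ ^ κ)⁻¹ / -κ by field_simp, ← h]
  refine setIntegral_congr_fun measurableSet_Ioi ?_
  intro v hv
  have : 0 < v := hℓ.trans hv
  change 1 / v ^ (κ + 1) = v ^ (-(κ + 1))
  rw [Real.rpow_neg this.le, one_div]

/-- If the increment is constant beyond the distance `ℓ` to the end point of the interval, only the
integral up to `ℓ` matters for convergence. -/
lemma marchaudIntegrable_iff_of_eventually_const {κ ℓ c : ℝ} (hκ : 0 < κ) (hℓ : 0 < ℓ) {φ : ℝ → ℝ}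
    (hφ : ∀ v, ℓ < v → φ v = c) :
    MarchaudIntegrable κ φ ↔ IntervalIntegrable (fun v => φ v / v ^ (κ + 1)) volume 0 ℓ := by
  have h2 : IntegrableOn (fun v => φ v / v ^ (κ + 1)) (Ioi ℓ) := by
    refine IntegrableOn.congr_fun (Integrable.const_mul (integrableOn_Ioi_one_div_rpow hκ hℓ) c) ?_
      measurableSet_Ioi
    intro v hv
    simp [hφ v hv, div_eq_mul_inv]
  rw [MarchaudIntegrable, intervalIntegrable_iff_integrableOn_Ioc_of_le hℓ.le,
    ← Ioc_union_Ioi_eq_Ioi hℓ.le, integrableOn_union]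
  exact ⟨fun h => h.1, fun h => ⟨h, h2⟩⟩

/-- An increment that is constant beyond the distance `ℓ` to the end point contributes the boundary
term of the fractional derivative on an interval. -/
lemma marchaud_eq_of_eventually_const {κ ℓ c : ℝ} (hκ : 0 < κ) (hℓ : 0 < ℓ) {φ : ℝ → ℝ}
    (hφ : ∀ v, ℓ < v → φ v = c) (hi : MarchaudIntegrable κ φ) :
    marchaud κ φ = 1 / Real.Gamma (1 - κ) *
      (c / ℓ ^ κ + κ * ∫ v in (0 : ℝ)..ℓ, φ v / v ^ (κ + 1)) := by
  have h1 : ∫ v in Ioi ℓ, φ v / v ^ (κ + 1) = c * (1 / (κ * ℓ ^ κ)) := by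
    rw [← integral_Ioi_one_div_rpow hκ hℓ, ← integral_const_mul]
    refine setIntegral_congr_fun measurableSet_Ioi ?_
    intro v hv
    simp [hφ v hv, div_eq_mul_inv]
  unfold marchaud
  rw [← Ioc_union_Ioi_eq_Ioi hℓ.le, setIntegral_union (Ioc_disjoint_Ioi le_rfl) measurableSet_Ioi
    (hi.mono_set Ioc_subset_Ioi_self) (hi.mono_set (Ioi_subset_Ioi hℓ.le)), h1,
    intervalIntegral.integral_of_le hℓ.le]
  have := (Real.rpow_pos_of_pos hℓ κ).ne'
  field_simp
  ring

lemma intervalIntegrable_left_iff {κ a r : ℝ} (har : a < r) {φ h : ℝ → ℝ}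
    (h1 : ∀ v, 0 < v → v < r - a → φ v = h (r - v)) :
    IntervalIntegrable (fun v => φ v / v ^ (κ + 1)) volume 0 (r - a) ↔
      IntervalIntegrable (fun θ => h θ / (r - θ) ^ (κ + 1)) volume a r := by
  have e : IntervalIntegrable (fun v => φ v / v ^ (κ + 1)) volume 0 (r - a) ↔
      IntervalIntegrable (fun v => h (r - v) / (r - (r - v)) ^ (κ + 1)) volume 0 (r - a) := by
    refine intervalIntegrable_congr_uIoo ?_
    intro v hv
    rw [uIoo_of_le (by linarith)] at hv
    simp [h1 v hv.1 hv.2]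
  rw [e]
  constructor
  · intro H
    have := H.comp_sub_left r
    simpa using this.symm
  · intro H
    have := H.comp_sub_left r
    simpa using this.symm

lemma integral_left_eq {κ a r : ℝ} (har : a < r) {φ h : ℝ → ℝ}
    (h1 : ∀ v, 0 < v → v < r - a → φ v = h (r - v)) :
    ∫ v in (0 : ℝ)..(r - a), φ v / v ^ (κ + 1) = ∫ θ in a..r, h θ / (r - θ) ^ (κ + 1) := by
  have := intervalIntegral.integral_comp_sub_left (a := 0) (b := r - a)
    (fun θ => h θ / (r - θ) ^ (κ + 1)) r
  simp only [sub_sub_cancel, sub_zero] at this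
  rw [← this]
  refine intervalIntegral.integral_congr_uIoo ?_
  intro v hv
  rw [uIoo_of_le (by linarith)] at hv
  simp [h1 v hv.1 hv.2]

lemma intervalIntegrable_right_iff {κ b r : ℝ} (hrb : r < b) {φ h : ℝ → ℝ}
    (h1 : ∀ v, 0 < v → v < b - r → φ v = h (r + v)) :
    IntervalIntegrable (fun v => φ v / v ^ (κ + 1)) volume 0 (b - r) ↔
      IntervalIntegrable (fun θ => h θ / (θ - r) ^ (κ + 1)) volume r b := by
  have e : IntervalIntegrable (fun v => φ v / v ^ (κ + 1)) volume 0 (b - r) ↔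
      IntervalIntegrable (fun v => h (r + v) / (r + v - r) ^ (κ + 1)) volume 0 (b - r) := by
    refine intervalIntegrable_congr_uIoo ?_
    intro v hv
    rw [uIoo_of_le (by linarith)] at hv
    simp [h1 v hv.1 hv.2]
  rw [e]
  constructor
  · intro H
    have := H.comp_sub_right r
    simpa using this
  · intro H
    have := H.comp_add_left r
    simpa using this

lemma integral_right_eq {κ b r : ℝ} (hrb : r < b) {φ h : ℝ → ℝ}
    (h1 : ∀ v, 0 < v → v < b - r → φ v = h (r + v)) :
    ∫ v in (0 : ℝ)..(b - r), φ v / v ^ (κ + 1) = ∫ θ in r..b, h θ / (θ - r) ^ (κ + 1) := by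
  have := intervalIntegral.integral_comp_add_left (a := 0) (b := b - r)
    (fun θ => h θ / (θ - r) ^ (κ + 1)) r
  simp only [add_zero, add_sub_cancel, add_sub_cancel_left] at this
  rw [← this]
  refine intervalIntegral.integral_congr_uIoo ?_
  intro v hv
  rw [uIoo_of_le (by linarith)] at hv
  simp [h1 v hv.1 hv.2]

/-- The model integrand: `φ` is dominated by `min(v, h)^q` if it is Hölder continuous of order `q`
at short distances and bounded at long ones. -/
lemma min_rpow_div_integrable_and_integral {κ q h : ℝ} (hκ : 0 < κ) (hq : κ < q) (hh : 0 < h) :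
    IntegrableOn (fun v : ℝ => (min v h) ^ q / v ^ (κ + 1)) (Ioi 0) ∧
      ∫ v in Ioi (0 : ℝ), (min v h) ^ q / v ^ (κ + 1) = h ^ (q - κ) * (1 / (q - κ) + 1 / κ) := by
  have e1 : EqOn (fun v : ℝ => v ^ (q - κ - 1)) (fun v : ℝ => (min v h) ^ q / v ^ (κ + 1))
      (Ioc 0 h) := by
    intro v hv
    simp only [min_eq_left hv.2]
    rw [← Real.rpow_sub hv.1]
    congr 1; ring
  have e2 : EqOn (fun v : ℝ => h ^ q * (1 / v ^ (κ + 1)))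
      (fun v : ℝ => (min v h) ^ q / v ^ (κ + 1)) (Ioi h) := by
    intro v hv
    simp only [min_eq_right (le_of_lt (show h < v from hv))]
    rw [mul_one_div]
  have i1 : IntegrableOn (fun v : ℝ => (min v h) ^ q / v ^ (κ + 1)) (Ioc 0 h) := by
    refine IntegrableOn.congr_fun ?_ e1 measurableSet_Ioc
    rw [← intervalIntegrable_iff_integrableOn_Ioc_of_le hh.le]
    exact intervalIntegral.intervalIntegrable_rpow' (by linarith)
  have i2 : IntegrableOn (fun v : ℝ => (min v h) ^ q / v ^ (κ + 1)) (Ioi h) :=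
    IntegrableOn.congr_fun (Integrable.const_mul (integrableOn_Ioi_one_div_rpow hκ hh) _) e2
      measurableSet_Ioi
  refine ⟨by rw [← Ioc_union_Ioi_eq_Ioi hh.le]; exact i1.union i2, ?_⟩
  rw [← Ioc_union_Ioi_eq_Ioi hh.le, setIntegral_union (Ioc_disjoint_Ioi le_rfl) measurableSet_Ioi
    i1 i2, ← setIntegral_congr_fun measurableSet_Ioc e1, ← setIntegral_congr_fun measurableSet_Ioi
    e2, integral_const_mul, integral_Ioi_one_div_rpow hκ hh, ← intervalIntegral.integral_of_le hh.le,
    integral_rpow (Or.inl (by linarith)), show q - κ - 1 + 1 = q - κ by ring,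
    Real.zero_rpow (by linarith), Real.rpow_sub hh]
  have := (Real.rpow_pos_of_pos hh κ).ne'
  have : q - κ ≠ 0 := by linarith
  field_simp
  ring

/-- The constant in `abs_marchaud_le`. -/
noncomputable def marchaudConst (κ q : ℝ) : ℝ :=
  κ / Real.Gamma (1 - κ) * (1 / (q - κ) + 1 / κ)

lemma marchaudConst_nonneg {κ q : ℝ} (hκ : 0 < κ) (hκ1 : κ < 1) (hq : κ < q) :
    0 ≤ marchaudConst κ q := by
  have := Real.Gamma_pos_of_pos (show 0 < 1 - κ by linarith)
  have : 0 < q - κ := by linarith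
  unfold marchaudConst
  positivity

lemma marchaudIntegrable_of_le {κ q h C : ℝ} (hκ : 0 < κ) (hq : κ < q) (hh : 0 < h) {φ : ℝ → ℝ}
    (hm : Measurable φ) (hφ : ∀ v, 0 < v → |φ v| ≤ C * (min v h) ^ q) :
    MarchaudIntegrable κ φ := by
  refine Integrable.mono' ((min_rpow_div_integrable_and_integral hκ hq hh).1.const_mul C)
    (hm.div (by fun_prop)).aestronglyMeasurable ?_
  refine (ae_restrict_iff' measurableSet_Ioi).2 (Eventually.of_forall fun v hv => ?_)
  have hv' : 0 < v ^ (κ + 1) := Real.rpow_pos_of_pos hv _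
  rw [Real.norm_eq_abs, abs_div, abs_of_pos hv', ← mul_div_assoc]
  gcongr
  exact hφ v hv

lemma abs_marchaud_le {κ q h C : ℝ} (hκ : 0 < κ) (hκ1 : κ < 1) (hq : κ < q) (hh : 0 < h)
    {φ : ℝ → ℝ} (hφ : ∀ v, 0 < v → |φ v| ≤ C * (min v h) ^ q) :
    |marchaud κ φ| ≤ C * marchaudConst κ q * h ^ (q - κ) := by
  have hG := Real.Gamma_pos_of_pos (show 0 < 1 - κ by linarith)
  have h1 : |∫ v in Ioi (0 : ℝ), φ v / v ^ (κ + 1)| ≤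
      C * (h ^ (q - κ) * (1 / (q - κ) + 1 / κ)) := by
    rw [← (min_rpow_div_integrable_and_integral hκ hq hh).2, ← integral_const_mul,
      ← Real.norm_eq_abs]
    refine norm_integral_le_of_norm_le
      ((min_rpow_div_integrable_and_integral hκ hq hh).1.const_mul C) ?_
    refine (ae_restrict_iff' measurableSet_Ioi).2 (Eventually.of_forall fun v hv => ?_)
    have hv' : 0 < v ^ (κ + 1) := Real.rpow_pos_of_pos hv _
    rw [Real.norm_eq_abs, abs_div, abs_of_pos hv', ← mul_div_assoc]
    gcongr
    exact hφ v hv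
  unfold marchaud
  rw [abs_mul, abs_of_pos (by positivity)]
  calc κ / Real.Gamma (1 - κ) * |∫ v in Ioi (0 : ℝ), φ v / v ^ (κ + 1)|
      ≤ κ / Real.Gamma (1 - κ) * (C * (h ^ (q - κ) * (1 / (q - κ) + 1 / κ))) := by gcongr
    _ = _ := by unfold marchaudConst; ring

/-- Dominated convergence for the Marchaud functional under a uniform Hölder type bound. -/
lemma tendsto_marchaud {κ q h C : ℝ} (hκ : 0 < κ) (hq : κ < q) (hh : 0 < h)
    {φ : ℕ → ℝ → ℝ} {ψ : ℝ → ℝ} (hm : ∀ n, Measurable (φ n))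
    (hφ : ∀ n v, 0 < v → |φ n v| ≤ C * (min v h) ^ q)
    (hlim : ∀ v, 0 < v → Tendsto (fun n => φ n v) atTop (𝓝 (ψ v))) :
    Tendsto (fun n => marchaud κ (φ n)) atTop (𝓝 (marchaud κ ψ)) := by
  unfold marchaud
  refine Tendsto.const_mul _ ?_
  refine tendsto_integral_of_dominated_convergence (fun v => C * ((min v h) ^ q / v ^ (κ + 1)))
    (fun n => ((hm n).div (by fun_prop)).aestronglyMeasurable)
    ((min_rpow_div_integrable_and_integral hκ hq hh).1.const_mul C) (fun n => ?_) ?_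
  · refine (ae_restrict_iff' measurableSet_Ioi).2 (Eventually.of_forall fun v hv => ?_)
    have hv' : 0 < v ^ (κ + 1) := Real.rpow_pos_of_pos hv _
    rw [Real.norm_eq_abs, abs_div, abs_of_pos hv', ← mul_div_assoc]
    gcongr
    exact hφ n v hv
  · refine (ae_restrict_iff' measurableSet_Ioi).2 (Eventually.of_forall fun v hv => ?_)
    exact (hlim v hv).div_const _

lemma measurable_marchaud {κ : ℝ} {φ : ℝ → ℝ → ℝ} (h : Measurable (Function.uncurry φ)) :
    Measurable (fun r => marchaud κ (φ r)) := by
  unfold marchaud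
  refine Measurable.const_mul ?_ _
  have : StronglyMeasurable (Function.uncurry fun r v : ℝ => φ r v / v ^ (κ + 1)) := by
    refine Measurable.stronglyMeasurable ?_
    change Measurable fun p : ℝ × ℝ => φ p.1 p.2 / p.2 ^ (κ + 1)
    exact h.div (by fun_prop)
  exact (this.integral_prod_right (ν := volume.restrict (Ioi 0))).measurable

/-- The Marchaud functional of a primitive is a fractional integral of its derivative. -/
lemma marchaud_primitive {κ B ℓ : ℝ} (hκ : 0 < κ) (hκ1 : κ < 1) {k : ℝ → ℝ} (hk : Measurable k)
    (hB : ∀ u, 0 < u → |k u| ≤ B) (hℓ : ∀ u, ℓ < u → k u = 0) {φ : ℝ → ℝ}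
    (hφ : ∀ v, 0 < v → φ v = ∫ u in (0 : ℝ)..v, k u) :
    MarchaudIntegrable κ φ ∧
    marchaud κ φ = 1 / Real.Gamma (1 - κ) * ∫ u in Ioi (0 : ℝ), k u * u ^ (-κ) := by
  -- Fubini on the set `{u < v}`, with `∫_u^∞ v^{-κ-1} dv = u^{-κ} / κ`
  set G : ℝ × ℝ → ℝ := fun z => (Ioi z.2).indicator (fun v => k z.2 * (1 / v ^ (κ + 1))) z.1
  have hGm : Measurable G := by
    have : G = {z : ℝ × ℝ | z.2 < z.1}.indicator (fun z => k z.2 * (1 / z.1 ^ (κ + 1))) := by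
      ext z; simp [G, indicator]
    rw [this]
    exact Measurable.indicator (by fun_prop) (measurableSet_lt measurable_snd measurable_fst)
  have hin : ∀ u, 0 < u → IntegrableOn (fun v => G (v, u)) (Ioi 0) ∧
      ∫ v in Ioi (0 : ℝ), G (v, u) = k u * (1 / κ * u ^ (-κ)) := by
    intro u hu
    have h1 : IntegrableOn (fun v : ℝ => k u * (1 / v ^ (κ + 1))) (Ioi u) :=
      (integrableOn_Ioi_one_div_rpow hκ hu).const_mul _
    constructor
    · exact ((integrable_indicator_iff measurableSet_Ioi).2 h1).integrableOn
    · change ∫ v in Ioi (0 : ℝ), (Ioi u).indicator (fun v => k u * (1 / v ^ (κ + 1))) v = _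
      rw [setIntegral_indicator measurableSet_Ioi, inter_eq_right.2 (Ioi_subset_Ioi hu.le),
        integral_const_mul, integral_Ioi_one_div_rpow hκ hu, Real.rpow_neg hu.le]
      field_simp
  have hki : IntegrableOn (fun u : ℝ => |k u| * (1 / κ * u ^ (-κ))) (Ioi 0) := by
    have h2 : IntegrableOn (fun u : ℝ => B * (1 / κ * u ^ (-κ))) (Ioc 0 (max ℓ 1)) := by
      refine Integrable.const_mul (Integrable.const_mul ?_ _) _
      change IntegrableOn (fun u : ℝ => u ^ (-κ)) (Ioc 0 (max ℓ 1)) volume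
      rw [← intervalIntegrable_iff_integrableOn_Ioc_of_le (le_max_of_le_right zero_le_one)]
      exact intervalIntegral.intervalIntegrable_rpow' (by linarith)
    have h3 : IntegrableOn (fun u : ℝ => |k u| * (1 / κ * u ^ (-κ))) (Ioc 0 (max ℓ 1)) := by
      refine Integrable.mono' h2 (by fun_prop) ?_
      refine (ae_restrict_iff' measurableSet_Ioc).2 (Eventually.of_forall fun u hu => ?_)
      have : 0 < u ^ (-κ) := Real.rpow_pos_of_pos hu.1 _
      rw [Real.norm_eq_abs, abs_mul, abs_abs, abs_of_pos (a := 1 / κ * u ^ (-κ)) (by positivity)]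
      exact mul_le_mul_of_nonneg_right (hB u hu.1) (by positivity)
    have h4 : IntegrableOn (fun u : ℝ => |k u| * (1 / κ * u ^ (-κ))) (Ioi (max ℓ 1)) := by
      refine IntegrableOn.congr_fun (f := fun _ => (0 : ℝ)) integrableOn_zero ?_ measurableSet_Ioi
      intro u hu
      have : ℓ < u := (le_max_left _ _).trans_lt hu
      simp [hℓ u this]
    rw [← Ioc_union_Ioi_eq_Ioi (show (0 : ℝ) ≤ max ℓ 1 from le_max_of_le_right zero_le_one)]
    exact h3.union h4
  have hGi : Integrable G ((volume.restrict (Ioi 0)).prod (volume.restrict (Ioi 0))) := by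
    rw [integrable_prod_iff' hGm.aestronglyMeasurable]
    constructor
    · exact (ae_restrict_iff' measurableSet_Ioi).2 (Eventually.of_forall fun u hu => (hin u hu).1)
    · refine hki.congr_fun ?_ measurableSet_Ioi
      intro u hu
      simp only []
      have hu : 0 < u := hu
      have e : ∀ v ∈ Ioi (0 : ℝ), ‖G (v, u)‖ =
          (Ioi u).indicator (fun v => |k u| * (1 / v ^ (κ + 1))) v := by
        intro v hv
        simp only [G, indicator]
        split_ifs
        · have : 0 < v ^ (κ + 1) := Real.rpow_pos_of_pos hv _
          rw [Real.norm_eq_abs, abs_mul, abs_of_pos (a := 1 / v ^ (κ + 1)) (by positivity)]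
        · simp
      rw [setIntegral_congr_fun measurableSet_Ioi e, setIntegral_indicator measurableSet_Ioi,
        inter_eq_right.2 (Ioi_subset_Ioi hu.le), integral_const_mul,
        integral_Ioi_one_div_rpow hκ hu, Real.rpow_neg hu.le]
      field_simp
  have hout : EqOn (fun v => ∫ u in Ioi (0 : ℝ), G (v, u)) (fun v => φ v / v ^ (κ + 1)) (Ioi 0) := by
    intro v hv
    have hv : 0 < v := hv
    have e : ∀ u ∈ Ioi (0 : ℝ), G (v, u) = (Iio v).indicator (fun u => k u * (1 / v ^ (κ + 1))) u := by
      intro u _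
      simp [G, indicator]
    simp only []
    rw [setIntegral_congr_fun measurableSet_Ioi e, setIntegral_indicator measurableSet_Iio,
      Ioi_inter_Iio, integral_mul_const, hφ v hv, intervalIntegral.integral_of_le hv.le,
      integral_Ioc_eq_integral_Ioo, mul_one_div]
  refine ⟨IntegrableOn.congr_fun hGi.integral_prod_left hout measurableSet_Ioi, ?_⟩
  unfold marchaud
  rw [← setIntegral_congr_fun measurableSet_Ioi hout,
    integral_integral_swap (f := fun v u => G (v, u)) hGi,
    setIntegral_congr_fun measurableSet_Ioi (fun u hu => (hin u hu).2)]
  have : (fun u : ℝ => k u * (1 / κ * u ^ (-κ))) = fun u => 1 / κ * (k u * u ^ (-κ)) := by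
    ext u; ring
  rw [this, integral_const_mul]
  field_simp

/-! ### Fractional integrals on the half line -/

lemma integral_rpow_mul_sub_rpow {x y w : ℝ} (hx : 0 < x) (hy : 0 < y) (hw : 0 < w) :
    ∫ v in Ioo 0 w, v ^ (x - 1) * (w - v) ^ (y - 1) =
      w ^ (x + y - 1) * (Real.Gamma x * Real.Gamma y / Real.Gamma (x + y)) := by
  have h := Complex.betaIntegral_scaled x y hw
  have hG := Complex.Gamma_mul_Gamma_eq_betaIntegral (s := x) (t := y) (by simpa) (by simpa)
  rw [← Complex.ofReal_inj, ← integral_complex_ofReal, ← integral_Ioc_eq_integral_Ioo]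
  rw [intervalIntegral.integral_of_le hw.le] at h
  have e : EqOn (fun v : ℝ => ((v ^ (x - 1) * (w - v) ^ (y - 1) : ℝ) : ℂ))
      (fun v : ℝ => (v : ℂ) ^ ((x : ℂ) - 1) * ((w : ℂ) - v) ^ ((y : ℂ) - 1)) (Ioc 0 w) := by
    intro v hv
    simp only []
    rw [Complex.ofReal_mul, Complex.ofReal_cpow hv.1.le, Complex.ofReal_cpow (by linarith [hv.2])]
    push_cast
    rfl
  refine (setIntegral_congr_fun measurableSet_Ioc e).trans ?_
  rw [h, Complex.ofReal_mul, Complex.ofReal_cpow hw.le]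
  have hne : Complex.Gamma ((x : ℂ) + y) ≠ 0 := by
    rw [← Complex.ofReal_add, Complex.Gamma_ofReal]
    exact_mod_cast (Real.Gamma_pos_of_pos (add_pos hx hy)).ne'
  push_cast
  rw [← Complex.Gamma_ofReal, ← Complex.Gamma_ofReal, ← Complex.Gamma_ofReal, hG]
  push_cast
  field_simp

lemma integrableOn_rpow_mul_sub_rpow {x y w : ℝ} (hx : 0 < x) (hy : 0 < y) (hw : 0 < w) :
    IntegrableOn (fun v => v ^ (x - 1) * (w - v) ^ (y - 1)) (Ioo 0 w) := by
  by_contra h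
  have h1 := integral_rpow_mul_sub_rpow hx hy hw
  rw [integral_undef h] at h1
  have := Real.rpow_pos_of_pos hw (x + y - 1)
  have := Real.Gamma_pos_of_pos hx
  have := Real.Gamma_pos_of_pos hy
  have := Real.Gamma_pos_of_pos (add_pos hx hy)
  exact absurd h1 (by positivity)

lemma integrableOn_mul_rpow {x B ℓ : ℝ} (hx : 0 < x) {k : ℝ → ℝ} (hk : Measurable k)
    (hB : ∀ u, 0 < u → |k u| ≤ B) (hℓ : ∀ u, ℓ < u → k u = 0) :
    IntegrableOn (fun u : ℝ => k u * u ^ (x - 1)) (Ioi 0) := by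
  have h2 : IntegrableOn (fun u : ℝ => B * u ^ (x - 1)) (Ioc 0 (max ℓ 1)) := by
    refine Integrable.const_mul ?_ _
    change IntegrableOn (fun u : ℝ => u ^ (x - 1)) (Ioc 0 (max ℓ 1)) volume
    rw [← intervalIntegrable_iff_integrableOn_Ioc_of_le (le_max_of_le_right zero_le_one)]
    exact intervalIntegral.intervalIntegrable_rpow' (by linarith)
  rw [← Ioc_union_Ioi_eq_Ioi (show (0 : ℝ) ≤ max ℓ 1 from le_max_of_le_right zero_le_one)]
  refine IntegrableOn.union (Integrable.mono' h2
    (by have : Measurable (fun u : ℝ => k u * u ^ (x - 1)) := by fun_prop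
        exact this.aestronglyMeasurable) ?_)
    (IntegrableOn.congr_fun (f := fun _ => (0 : ℝ)) integrableOn_zero ?_ measurableSet_Ioi)
  · refine (ae_restrict_iff' measurableSet_Ioc).2 (Eventually.of_forall fun u hu => ?_)
    have : 0 < u ^ (x - 1) := Real.rpow_pos_of_pos hu.1 _
    rw [Real.norm_eq_abs, abs_mul, abs_of_pos this]
    exact mul_le_mul_of_nonneg_right (hB u hu.1) this.le
  · intro u hu
    have : ℓ < u := (le_max_left _ _).trans_lt hu
    simp [hℓ u this]

lemma setIntegral_Ioi_add (g : ℝ → ℝ) (v : ℝ) :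
    ∫ u in Ioi (0 : ℝ), g u = ∫ w in Ioi v, g (w - v) := by
  rw [← integral_indicator measurableSet_Ioi, ← integral_indicator measurableSet_Ioi,
    ← integral_sub_right_eq_self _ v]
  congr 1
  ext w
  simp [indicator]

/-- The semigroup property of fractional integrals. -/
lemma fractional_semigroup {x y B ℓ : ℝ} (hx : 0 < x) (hy : 0 < y) {k : ℝ → ℝ} (hk : Measurable k)
    (hB : ∀ u, 0 < u → |k u| ≤ B) (hℓ : ∀ u, ℓ < u → k u = 0) :
    ∫ v in Ioi (0 : ℝ), (∫ u in Ioi (0 : ℝ), k (v + u) * u ^ (y - 1)) * v ^ (x - 1) =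
      Real.Gamma x * Real.Gamma y / Real.Gamma (x + y) *
        ∫ w in Ioi (0 : ℝ), k w * w ^ (x + y - 1) := by
  -- With `w = v + u`, Fubini on `{v < w}`: the integral over `v` is a Beta integral.
  set c := Real.Gamma x * Real.Gamma y / Real.Gamma (x + y)
  set G : ℝ × ℝ → ℝ := fun z =>
    (Iio z.2).indicator (fun v => k z.2 * (v ^ (x - 1) * (z.2 - v) ^ (y - 1))) z.1
  have hGm : Measurable G := by
    have : G = {z : ℝ × ℝ | z.1 < z.2}.indicator
        (fun z => k z.2 * (z.1 ^ (x - 1) * (z.2 - z.1) ^ (y - 1))) := by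
      ext z; simp [G, indicator]
    rw [this]
    exact Measurable.indicator (by fun_prop) (measurableSet_lt measurable_fst measurable_snd)
  have hin : ∀ w, 0 < w → IntegrableOn (fun v => G (v, w)) (Ioi 0) ∧
      ∫ v in Ioi (0 : ℝ), G (v, w) = c * (k w * w ^ (x + y - 1)) := by
    intro w hw
    have h1 : IntegrableOn (fun v : ℝ => k w * (v ^ (x - 1) * (w - v) ^ (y - 1))) (Ioo 0 w) :=
      Integrable.const_mul (integrableOn_rpow_mul_sub_rpow hx hy hw) _
    constructor
    · change IntegrableOn ((Iio w).indicator
        (fun v : ℝ => k w * (v ^ (x - 1) * (w - v) ^ (y - 1)))) (Ioi 0) volume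
      rw [IntegrableOn, integrable_indicator_iff measurableSet_Iio, IntegrableOn,
        Measure.restrict_restrict measurableSet_Iio, Iio_inter_Ioi]
      exact h1
    · change ∫ v in Ioi (0 : ℝ), (Iio w).indicator
        (fun v : ℝ => k w * (v ^ (x - 1) * (w - v) ^ (y - 1))) v = _
      rw [setIntegral_indicator measurableSet_Iio, Ioi_inter_Iio, integral_const_mul,
        integral_rpow_mul_sub_rpow hx hy hw]
      ring
  have hGi : Integrable G ((volume.restrict (Ioi 0)).prod (volume.restrict (Ioi 0))) := by
    rw [integrable_prod_iff' hGm.aestronglyMeasurable]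
    constructor
    · exact (ae_restrict_iff' measurableSet_Ioi).2 (Eventually.of_forall fun u hu => (hin u hu).1)
    · have h5 : IntegrableOn (fun w => c * (|k w| * w ^ (x + y - 1))) (Ioi 0) :=
        Integrable.const_mul (integrableOn_mul_rpow (add_pos hx hy) (B := B) (ℓ := ℓ) (by fun_prop)
          (fun u hu => by simpa using hB u hu) (fun u hu => by simp [hℓ u hu])) _
      refine h5.congr_fun ?_ measurableSet_Ioi
      intro w hw
      have hw : 0 < w := hw
      simp only []
      have e : ∀ v ∈ Ioi (0 : ℝ), ‖G (v, w)‖ =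
          (Iio w).indicator (fun v => |k w| * (v ^ (x - 1) * (w - v) ^ (y - 1))) v := by
        intro v hv
        have hv : 0 < v := hv
        simp only [G, indicator]
        split_ifs with h
        · have h' : 0 < w - v := sub_pos.2 h
          have : 0 < v ^ (x - 1) * (w - v) ^ (y - 1) := by positivity
          rw [Real.norm_eq_abs, abs_mul, abs_of_pos this]
        · simp
      rw [setIntegral_congr_fun measurableSet_Ioi e, setIntegral_indicator measurableSet_Iio,
        Ioi_inter_Iio, integral_const_mul, integral_rpow_mul_sub_rpow hx hy hw]
      ring
  have hout : EqOn (fun v => ∫ w in Ioi (0 : ℝ), G (v, w))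
      (fun v => (∫ u in Ioi (0 : ℝ), k (v + u) * u ^ (y - 1)) * v ^ (x - 1)) (Ioi 0) := by
    intro v hv
    have hv : 0 < v := hv
    have e : ∀ w ∈ Ioi (0 : ℝ), G (v, w) =
        (Ioi v).indicator (fun w => k w * (w - v) ^ (y - 1) * v ^ (x - 1)) w := by
      intro w _
      simp only [G, indicator, mem_Iio, mem_Ioi]
      split_ifs
      · ring
      · rfl
    simp only []
    rw [setIntegral_congr_fun measurableSet_Ioi e, setIntegral_indicator measurableSet_Ioi,
      inter_eq_right.2 (Ioi_subset_Ioi hv.le), integral_mul_const,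
      setIntegral_Ioi_add (fun u => k (v + u) * u ^ (y - 1)) v]
    simp
  rw [← setIntegral_congr_fun measurableSet_Ioi hout,
    integral_integral_swap (f := fun v w => G (v, w)) hGi,
    setIntegral_congr_fun measurableSet_Ioi (fun u hu => (hin u hu).2), integral_const_mul]

/-- The left sided Riemann-Liouville integral `1 / Γ(x) ∫₀^∞ p(r - v) v^{x-1} dv` on the line. -/
noncomputable def fracInt (x : ℝ) (p : ℝ → ℝ) (r : ℝ) : ℝ :=
  1 / Real.Gamma x * ∫ v in Ioi (0 : ℝ), p (r - v) * v ^ (x - 1)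

lemma measurable_fracInt {x : ℝ} {p : ℝ → ℝ} (hp : Measurable p) : Measurable (fracInt x p) := by
  unfold fracInt
  refine Measurable.const_mul ?_ _
  have : StronglyMeasurable (Function.uncurry fun r v : ℝ => p (r - v) * v ^ (x - 1)) := by
    refine Measurable.stronglyMeasurable ?_
    change Measurable fun z : ℝ × ℝ => p (z.1 - z.2) * z.2 ^ (x - 1)
    fun_prop
  exact (this.integral_prod_right (ν := volume.restrict (Ioi 0))).measurable

lemma fracInt_of_le {x a : ℝ} {p : ℝ → ℝ} (hp : ∀ t, t < a → p t = 0) {r : ℝ} (hr : r ≤ a) :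
    fracInt x p r = 0 := by
  unfold fracInt
  rw [setIntegral_congr_fun (g := fun _ => (0 : ℝ)) measurableSet_Ioi]
  · simp
  · intro v hv
    have hv : 0 < v := hv
    simp [hp (r - v) (by linarith)]

lemma fracInt_fracInt {x y a B : ℝ} (hx : 0 < x) (hy : 0 < y) {p : ℝ → ℝ} (hpm : Measurable p)
    (hB : ∀ t, |p t| ≤ B) (hp : ∀ t, t < a → p t = 0) (r : ℝ) :
    fracInt x (fracInt y p) r = fracInt (x + y) p r := by
  have h := fractional_semigroup hx hy (k := fun w => p (r - w)) (by fun_prop) (B := B)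
    (ℓ := r - a) (fun u _ => hB _) (fun u hu => hp _ (by linarith))
  unfold fracInt
  have e : ∀ v : ℝ, (1 / Real.Gamma y * ∫ u in Ioi (0 : ℝ), p (r - v - u) * u ^ (y - 1)) *
      v ^ (x - 1) =
      1 / Real.Gamma y * ((∫ u in Ioi (0 : ℝ), p (r - (v + u)) * u ^ (y - 1)) * v ^ (x - 1)) := by
    intro v
    simp only [sub_sub]
    ring
  simp only [e]
  rw [integral_const_mul, h]
  have := (Real.Gamma_pos_of_pos hx).ne'
  have := (Real.Gamma_pos_of_pos hy).ne'
  field_simp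

lemma abs_fracInt_le {x a b B : ℝ} (hx : 0 < x) {p : ℝ → ℝ}
    (hB : ∀ t, |p t| ≤ B) (hp : ∀ t, t < a → p t = 0) {r : ℝ} (hr : r ≤ b) (hab : a < b) :
    |fracInt x p r| ≤ B * (1 / Real.Gamma x * ((b - a) ^ x / x)) := by
  have hG := Real.Gamma_pos_of_pos hx
  have hB0 : 0 ≤ B := (abs_nonneg _).trans (hB 0)
  unfold fracInt
  rw [abs_mul, abs_of_pos (by positivity), mul_left_comm]
  refine mul_le_mul_of_nonneg_left ?_ (by positivity)
  have hi : IntegrableOn (fun v : ℝ => v ^ (x - 1)) (Ioc 0 (b - a)) := by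
    rw [← intervalIntegrable_iff_integrableOn_Ioc_of_le (by linarith)]
    exact intervalIntegral.intervalIntegrable_rpow' (by linarith)
  have e : B * ((b - a) ^ x / x) = ∫ v in Ioi (0 : ℝ),
      (Ioc 0 (b - a)).indicator (fun v => B * v ^ (x - 1)) v := by
    rw [setIntegral_indicator measurableSet_Ioc, inter_eq_right.2 Ioc_subset_Ioi_self,
      integral_const_mul, ← intervalIntegral.integral_of_le (by linarith),
      integral_rpow (Or.inl (by linarith))]
    simp [Real.zero_rpow hx.ne']
  rw [e, ← Real.norm_eq_abs]
  refine norm_integral_le_of_norm_le ?_ ?_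
  · exact ((integrable_indicator_iff measurableSet_Ioc).2 (Integrable.const_mul hi B)).integrableOn
  · refine (ae_restrict_iff' measurableSet_Ioi).2 (Eventually.of_forall fun v hv => ?_)
    have hv : 0 < v := hv
    have hv' : 0 < v ^ (x - 1) := Real.rpow_pos_of_pos hv _
    by_cases h : v ≤ b - a
    · rw [indicator_of_mem (show v ∈ Ioc 0 (b - a) from ⟨hv, h⟩), Real.norm_eq_abs, abs_mul,
        abs_of_pos hv']
      exact mul_le_mul_of_nonneg_right (hB _) hv'.le
    · rw [hp (r - v) (by linarith), indicator_of_notMem (fun h' => h h'.2)]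
      simp

lemma integrable_prod_Ioi_of_bound {a b C σ : ℝ} (hσ : σ < 1) (hab : a < b) (hC : 0 ≤ C)
    {F : ℝ × ℝ → ℝ} (hF : Measurable F)
    (h0 : ∀ r u, 0 < u → ¬ (a ≤ r ∧ r ≤ b ∧ u ≤ b - a) → F (r, u) = 0)
    (h1 : ∀ r u, 0 < u → |F (r, u)| ≤ C * u ^ (-σ)) :
    Integrable F (volume.prod (volume.restrict (Ioi 0))) := by
  set D : ℝ × ℝ → ℝ := fun z => (Icc a b).indicator (fun _ => C) z.1 *
    (Ioc 0 (b - a)).indicator (fun u => u ^ (-σ)) z.2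
  have hD : Integrable D (volume.prod (volume.restrict (Ioi 0))) := by
    refine Integrable.mul_prod ?_ ?_
    · rw [integrable_indicator_iff measurableSet_Icc]
      exact integrableOn_const (by simp)
    · refine Integrable.integrableOn ?_
      rw [integrable_indicator_iff measurableSet_Ioc,
        ← intervalIntegrable_iff_integrableOn_Ioc_of_le (by linarith)]
      exact intervalIntegral.intervalIntegrable_rpow' (by linarith)
  refine Integrable.mono' hD hF.aestronglyMeasurable ?_
  have : (volume : Measure ℝ).prod (volume.restrict (Ioi (0 : ℝ))) =
      (volume.prod volume).restrict (univ ×ˢ Ioi 0) := by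
    rw [← Measure.prod_restrict, Measure.restrict_univ]
  rw [this, ae_restrict_iff' (MeasurableSet.univ.prod measurableSet_Ioi)]
  refine Eventually.of_forall ?_
  rintro ⟨r, u⟩ hz
  have hu : 0 < u := hz.2
  simp only [D]
  by_cases h : a ≤ r ∧ r ≤ b ∧ u ≤ b - a
  · rw [indicator_of_mem (show r ∈ Icc a b from ⟨h.1, h.2.1⟩),
      indicator_of_mem (show u ∈ Ioc 0 (b - a) from ⟨hu, h.2.2⟩)]
    exact h1 r u hu
  · rw [h0 r u hu h, norm_zero]
    exact mul_nonneg (indicator_nonneg (fun _ _ => hC) _)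
      (indicator_nonneg (fun v hv => (Real.rpow_pos_of_pos hv.1 _).le) _)

/-- Integration by parts for fractional integrals: the left sided integral of order `κ` of `p`
against the right sided integral of order `1 - κ` of `q` is the integral of `p` against the
primitive of `q`. -/
lemma fracInt_pairing_smooth {κ a b B : ℝ} (hκ : 0 < κ) (hκ1 : κ < 1) (hab : a < b) {p q : ℝ → ℝ}
    (hpm : Measurable p) (hB : ∀ t, |p t| ≤ B) (hp : ∀ t, t < a → p t = 0)
    (hqm : Measurable q) (hq : ∀ t, |q t| ≤ B) (hqb : ∀ t, b < t → q t = 0) :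
    ∫ r in Icc a b, fracInt κ p r *
        (1 / Real.Gamma (1 - κ) * ∫ u in Ioi (0 : ℝ), q (r + u) * u ^ (-κ)) =
      ∫ r in Icc a b, p r * ∫ u in Ioi (0 : ℝ), q (r + u) := by
  have hB0 : 0 ≤ B := (abs_nonneg _).trans (hB 0)
  set P : ℝ → ℝ := (Icc a b).indicator (fracInt κ p) with hP
  obtain ⟨B', hB'0, hB'⟩ : ∃ B', 0 ≤ B' ∧ ∀ t, |P t| ≤ B' := by
    refine ⟨max (B * (1 / Real.Gamma κ * ((b - a) ^ κ / κ))) 0, le_max_right _ _, fun t => ?_⟩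
    simp only [hP, indicator]
    split_ifs with h
    · exact (abs_fracInt_le hκ hB hp h.2 hab).trans (le_max_left _ _)
    · simp
  have hPm : Measurable P := (measurable_fracInt hpm).indicator measurableSet_Icc
  have hP0 : ∀ t, ¬ (a ≤ t ∧ t ≤ b) → P t = 0 := fun t ht => indicator_of_notMem (s := Icc a b) ht _
  -- The cut-off `P` makes the integrands supported in a bounded set without changing the values
  -- that enter: to the right of `b` the function `q` vanishes.
  have hF1 : Integrable (fun z : ℝ × ℝ => P z.1 * q (z.1 + z.2) * z.2 ^ (-κ))
      (volume.prod (volume.restrict (Ioi 0))) := by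
    refine integrable_prod_Ioi_of_bound hκ1 hab (mul_nonneg hB'0 hB0) (by fun_prop)
      (fun r u hu h => ?_) (fun r u hu => ?_)
    · by_cases hr : a ≤ r ∧ r ≤ b
      · simp [hqb (r + u) (by by_contra h'; exact h ⟨hr.1, hr.2, by linarith [hr.1]⟩)]
      · simp [hP0 r hr]
    · have hu' : 0 < u ^ (-κ) := Real.rpow_pos_of_pos hu _
      rw [abs_mul, abs_mul, abs_of_pos hu']
      gcongr
      · exact hB' r
      · exact hq _
  have hF2 : Integrable (fun z : ℝ × ℝ => P (z.1 - z.2) * q z.1 * z.2 ^ (-κ))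
      (volume.prod (volume.restrict (Ioi 0))) := by
    refine integrable_prod_Ioi_of_bound hκ1 hab (mul_nonneg hB'0 hB0) (by fun_prop)
      (fun e u hu h => ?_) (fun e u hu => ?_)
    · by_cases hr : a ≤ e - u ∧ e - u ≤ b
      · simp [hqb e (by by_contra h'; exact h ⟨by linarith [hr.1], by linarith, by linarith [hr.1]⟩)]
      · simp [hP0 _ hr]
    · have hu' : 0 < u ^ (-κ) := Real.rpow_pos_of_pos hu _
      rw [abs_mul, abs_mul, abs_of_pos hu']
      gcongr
      · exact hB' _
      · exact hq _
  -- both sides are equal to an integral over pairs of points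
  have L1 : ∫ r in Icc a b, fracInt κ p r *
        (1 / Real.Gamma (1 - κ) * ∫ u in Ioi (0 : ℝ), q (r + u) * u ^ (-κ)) =
      1 / Real.Gamma (1 - κ) * ∫ r, ∫ u in Ioi (0 : ℝ), P r * q (r + u) * u ^ (-κ) := by
    rw [← integral_const_mul, ← integral_indicator measurableSet_Icc]
    congr 1
    ext r
    simp only [indicator, hP]
    split_ifs
    · simp only [mul_assoc]
      rw [integral_const_mul]
      ring
    · simp
  have L2 : ∫ r, ∫ u in Ioi (0 : ℝ), P r * q (r + u) * u ^ (-κ) =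
      ∫ e, ∫ u in Ioi (0 : ℝ), P (e - u) * q e * u ^ (-κ) := by
    rw [integral_integral_swap (f := fun r u => P r * q (r + u) * u ^ (-κ)) hF1,
      integral_integral_swap (f := fun e u => P (e - u) * q e * u ^ (-κ)) hF2]
    congr 1
    ext u
    rw [← integral_add_right_eq_self (fun e => P (e - u) * q e * u ^ (-κ)) u]
    simp
  have L3 : ∀ e, ∫ u in Ioi (0 : ℝ), P (e - u) * q e * u ^ (-κ) =
      Real.Gamma (1 - κ) * (q e * ∫ v in Ioi (0 : ℝ), p (e - v)) := by
    intro e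
    by_cases heb : e ≤ b
    -- The orders `κ` and `1 - κ` add up to the ordinary primitive of `p`.
    · have e1 : ∫ u in Ioi (0 : ℝ), P (e - u) * q e * u ^ (-κ) =
          q e * (Real.Gamma (1 - κ) * fracInt (1 - κ) (fracInt κ p) e) := by
        unfold fracInt
        have := (Real.Gamma_pos_of_pos (show 0 < 1 - κ by linarith)).ne'
        rw [← mul_assoc (Real.Gamma (1 - κ)), mul_one_div_cancel this, one_mul,
          ← integral_const_mul]
        refine setIntegral_congr_fun measurableSet_Ioi ?_
        intro u hu
        have hu : 0 < u := hu
        have : P (e - u) = fracInt κ p (e - u) := by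
          simp only [hP, indicator]
          split_ifs with h
          · rfl
          · refine (fracInt_of_le hp ?_).symm
            by_contra h'
            exact h ⟨by linarith, by linarith⟩
        simp only []
        rw [this]
        unfold fracInt
        rw [show (1 - κ - 1) = -κ by ring]
        ring
      rw [e1, fracInt_fracInt (by linarith) hκ hpm hB hp]
      unfold fracInt
      simp
      ring
    · simp [hqb e (by linarith)]
  have hM : Integrable (fun z : ℝ × ℝ => q z.1 * p (z.1 - z.2))
      (volume.prod (volume.restrict (Ioi 0))) := by
    refine integrable_prod_Ioi_of_bound (σ := 0) one_pos hab (mul_nonneg hB0 hB0) (by fun_prop)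
      (fun e u hu h => ?_) (fun e u hu => ?_)
    · by_cases hr : a ≤ e - u
      · simp [hqb e (by by_contra h'; exact h ⟨by linarith, by linarith, by linarith⟩)]
      · simp [hp (e - u) (by linarith)]
    · rw [abs_mul, neg_zero, Real.rpow_zero, mul_one]
      gcongr
      · exact hq _
      · exact hB _
  have hM2 : Integrable (fun z : ℝ × ℝ => q (z.1 + z.2) * p z.1)
      (volume.prod (volume.restrict (Ioi 0))) := by
    refine integrable_prod_Ioi_of_bound (σ := 0) one_pos hab (mul_nonneg hB0 hB0) (by fun_prop)
      (fun e u hu h => ?_) (fun e u hu => ?_)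
    · by_cases hr : a ≤ e
      · simp [hqb (e + u) (by by_contra h'; exact h ⟨by linarith, by linarith, by linarith⟩)]
      · simp [hp e (by linarith)]
    · rw [abs_mul, neg_zero, Real.rpow_zero, mul_one]
      gcongr
      · exact hq _
      · exact hB _
  rw [L1, L2]
  simp only [L3]
  have := (Real.Gamma_pos_of_pos (show 0 < 1 - κ by linarith)).ne'
  rw [integral_const_mul, ← mul_assoc, one_div_mul_cancel this, one_mul]
  have e5 : ∫ r in Icc a b, p r * ∫ u in Ioi (0 : ℝ), q (r + u) =
      ∫ r, ∫ u in Ioi (0 : ℝ), q (r + u) * p r := by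
    rw [← integral_indicator measurableSet_Icc]
    congr 1
    ext r
    simp only [indicator]
    split_ifs with h
    · rw [integral_mul_const, mul_comm]
    · by_cases hra : r < a
      · simp [hp r hra]
      · have : ∀ u ∈ Ioi (0 : ℝ), q (r + u) * p r = 0 := by
          intro u hu
          have hu : 0 < u := hu
          rw [hqb (r + u), zero_mul]
          by_contra h'
          exact h ⟨by linarith, by linarith⟩
        rw [setIntegral_congr_fun measurableSet_Ioi this]
        simp
  rw [e5, integral_integral_swap (f := fun r u => q (r + u) * p r) hM2]
  have e6 : ∀ e, q e * ∫ v in Ioi (0 : ℝ), p (e - v) = ∫ v in Ioi (0 : ℝ), q e * p (e - v) :=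
    fun e => (integral_const_mul _ _).symm
  simp only [e6]
  rw [integral_integral_swap (f := fun e u => q e * p (e - u)) hM]
  congr 1
  ext u
  rw [← integral_add_right_eq_self (fun e => q e * p (e - u)) u]
  simp

/-! ### Mollification in time -/

/-- A smooth probability density supported in `[1, 3]`. -/
noncomputable def unitKernel (v : ℝ) : ℝ :=
  ContDiffBump.normed (⟨1 / 2, 1, by norm_num, by norm_num⟩ : ContDiffBump (2 : ℝ)) volume v

/-- The kernel `ε⁻¹ ρ(v / ε)` with `ρ = unitKernel`, supported in `[ε, 3ε]`. Its support lies in the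
half line, so that `f (r - v)` is averaged over the past only and functions that vanish to the left
of `a` keep this property. -/
noncomputable def mollKernel (ε v : ℝ) : ℝ := ε⁻¹ * unitKernel (v / ε)

lemma unitKernel_nonneg (v : ℝ) : 0 ≤ unitKernel v := ContDiffBump.nonneg_normed _ _

lemma contDiff_unitKernel : ContDiff ℝ 1 unitKernel := ContDiffBump.contDiff_normed _

lemma hasCompactSupport_unitKernel : HasCompactSupport unitKernel :=
  ContDiffBump.hasCompactSupport_normed _

lemma unitKernel_eq_zero {v : ℝ} (hv : v ≤ 1 ∨ 3 ≤ v) : unitKernel v = 0 := by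
  rw [← Function.notMem_support]
  unfold unitKernel
  intro h
  have h2 := (ContDiffBump.support_normed_eq (μ := volume)
    (⟨1 / 2, 1, by norm_num, by norm_num⟩ : ContDiffBump (2 : ℝ))).subset h
  rw [Metric.mem_ball, Real.dist_eq, abs_lt] at h2
  simp only at h2
  rcases hv with hv | hv <;> linarith [h2.1, h2.2]

lemma integral_unitKernel : ∫ v, unitKernel v = 1 := ContDiffBump.integral_normed _

lemma exists_lipschitz_unitKernel : ∃ L : ℝ, 0 ≤ L ∧
    ∀ v w, |unitKernel v - unitKernel w| ≤ L * min |v - w| 1 := by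
  obtain ⟨C, hC⟩ := contDiff_unitKernel.lipschitzWith_of_hasCompactSupport
    hasCompactSupport_unitKernel one_ne_zero
  obtain ⟨M, hM⟩ := hasCompactSupport_unitKernel.exists_bound_of_continuous
    contDiff_unitKernel.continuous
  refine ⟨max C (2 * M), le_max_of_le_left C.2, fun v w => ?_⟩
  have h1 := hC.dist_le_mul v w
  rw [Real.dist_eq, Real.dist_eq] at h1
  have h2 : |unitKernel v - unitKernel w| ≤ 2 * M := by
    have := hM v
    have := hM w
    rw [Real.norm_eq_abs] at *
    calc _ ≤ |unitKernel v| + |unitKernel w| := abs_sub _ _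
      _ ≤ _ := by linarith
  rcases le_total |v - w| 1 with h | h
  · rw [min_eq_left h]
    exact h1.trans (mul_le_mul_of_nonneg_right (le_max_left _ _) (abs_nonneg _))
  · rw [min_eq_right h, mul_one]
    exact h2.trans (le_max_right _ _)

section
variable {ε : ℝ}

lemma mollKernel_nonneg (hε : 0 < ε) (v : ℝ) : 0 ≤ mollKernel ε v :=
  mul_nonneg (inv_nonneg.2 hε.le) (unitKernel_nonneg _)

lemma contDiff_mollKernel (ε : ℝ) : ContDiff ℝ 1 (mollKernel ε) :=
  contDiff_const.mul (contDiff_unitKernel.comp (contDiff_id.div_const ε))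

lemma measurable_mollKernel (ε : ℝ) : Measurable (mollKernel ε) :=
  (contDiff_mollKernel ε).continuous.measurable

lemma mollKernel_eq_zero (hε : 0 < ε) {v : ℝ} (hv : v ≤ ε ∨ 3 * ε ≤ v) : mollKernel ε v = 0 := by
  unfold mollKernel
  rw [unitKernel_eq_zero, mul_zero]
  rcases hv with hv | hv
  · left; rwa [div_le_one hε]
  · right; rwa [le_div_iff₀ hε]

lemma hasCompactSupport_mollKernel (hε : 0 < ε) : HasCompactSupport (mollKernel ε) := by
  refine HasCompactSupport.intro (isCompact_Icc (a := ε) (b := 3 * ε)) fun v hv => ?_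
  refine mollKernel_eq_zero hε ?_
  by_contra h
  push Not at h
  exact hv ⟨h.1.le, h.2.le⟩

lemma integrable_mollKernel (hε : 0 < ε) : Integrable (mollKernel ε) :=
  (contDiff_mollKernel ε).continuous.integrable_of_hasCompactSupport
    (hasCompactSupport_mollKernel hε)

lemma integral_mollKernel (hε : 0 < ε) : ∫ v, mollKernel ε v = 1 := by
  unfold mollKernel
  rw [integral_const_mul, Measure.integral_comp_div, integral_unitKernel, abs_of_pos hε]
  simp [hε.ne']

lemma exists_lipschitz_mollKernel : ∃ L : ℝ, 0 ≤ L ∧ ∀ ε, 0 < ε → ∀ v w,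
    |mollKernel ε v - mollKernel ε w| ≤ L * ε⁻¹ ^ 2 * min |v - w| ε := by
  obtain ⟨L, hL0, hL⟩ := exists_lipschitz_unitKernel
  refine ⟨L, hL0, fun ε hε v w => ?_⟩
  unfold mollKernel
  rw [← mul_sub, abs_mul, abs_of_pos (inv_pos.2 hε)]
  have h1 := hL (v / ε) (w / ε)
  have h2 : min |v / ε - w / ε| 1 = ε⁻¹ * min |v - w| ε := by
    rw [mul_min_of_nonneg _ _ (inv_pos.2 hε).le, inv_mul_cancel₀ hε.ne', ← sub_div, abs_div,
      abs_of_pos hε, div_eq_inv_mul]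
  rw [h2] at h1
  calc _ ≤ ε⁻¹ * (L * (ε⁻¹ * min |v - w| ε)) := by gcongr
    _ = _ := by ring

/-- Only the values of `g` on `(ε, 3ε)` enter the average with respect to the mollifying kernel. -/
lemma abs_integral_mollKernel_mul_le (hε : 0 < ε) {g : ℝ → ℝ} {B : ℝ}
    (hB : ∀ v, ε < v → v < 3 * ε → |g v| ≤ B) : |∫ v, mollKernel ε v * g v| ≤ B := by
  have h : |∫ v, mollKernel ε v * g v| ≤ ∫ v, mollKernel ε v * B := by
    rw [← Real.norm_eq_abs]
    refine norm_integral_le_of_norm_le ((integrable_mollKernel hε).mul_const B)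
      (Eventually.of_forall fun v => ?_)
    rw [norm_mul, Real.norm_of_nonneg (mollKernel_nonneg hε v), Real.norm_eq_abs]
    by_cases hv : v ≤ ε ∨ 3 * ε ≤ v
    · simp [mollKernel_eq_zero hε hv]
    · push Not at hv
      exact mul_le_mul_of_nonneg_left (hB v hv.1 hv.2) (mollKernel_nonneg hε v)
  rwa [integral_mul_const, integral_mollKernel hε, one_mul] at h

lemma integrable_mollKernel_mul (hε : 0 < ε) {g : ℝ → ℝ} (hg : Measurable g) {B : ℝ}
    (hB : ∀ v, ε < v → v < 3 * ε → |g v| ≤ B) : Integrable fun v => mollKernel ε v * g v := by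
  refine Integrable.mono' ((integrable_mollKernel hε).mul_const B)
    (((measurable_mollKernel ε).mul hg).aestronglyMeasurable) (Eventually.of_forall fun v => ?_)
  rw [norm_mul, Real.norm_of_nonneg (mollKernel_nonneg hε v), Real.norm_eq_abs]
  by_cases hv : v ≤ ε ∨ 3 * ε ≤ v
  · simp [mollKernel_eq_zero hε hv]
  · push Not at hv
    exact mul_le_mul_of_nonneg_left (hB v hv.1 hv.2) (mollKernel_nonneg hε v)

/-- The average `∫ ρ_ε(v) f(r - v) dv` of `f` over the past of `r`. -/
noncomputable def leftMoll (ε : ℝ) (f : ℝ → ℝ) (r : ℝ) : ℝ := ∫ v, mollKernel ε v * f (r - v)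

lemma leftMoll_of_le (hε : 0 < ε) {a : ℝ} {f : ℝ → ℝ} (hf : ∀ t, t < a → f t = 0) {r : ℝ}
    (hr : r ≤ a) : leftMoll ε f r = 0 := by
  unfold leftMoll
  rw [← integral_zero ℝ ℝ]
  congr 1
  ext v
  by_cases hv : v ≤ ε
  · simp [mollKernel_eq_zero hε (Or.inl hv)]
  · simp [hf (r - v) (by linarith)]

/-- The mollification of a bounded function with compact support is the primitive of a bounded
function. -/
lemma derivative_leftMoll (hε : 0 < ε) {a b B : ℝ} {f : ℝ → ℝ} (hfm : Measurable f)
    (hB : ∀ t, |f t| ≤ B) (ha : ∀ t, t < a → f t = 0) (hb : ∀ t, b < t → f t = 0) :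
    ∃ B' : ℝ, Measurable (deriv (leftMoll ε f)) ∧ (∀ t, |deriv (leftMoll ε f) t| ≤ B') ∧
      (∀ t, t < a → deriv (leftMoll ε f) t = 0) ∧
      (∀ r v, leftMoll ε f r - leftMoll ε f (r - v) =
        ∫ u in (0 : ℝ)..v, deriv (leftMoll ε f) (r - u)) ∧
      (∀ r, leftMoll ε f r = ∫ u in Ioi (0 : ℝ), deriv (leftMoll ε f) (r - u)) := by
  have hfi : LocallyIntegrable f := by
    refine (Integrable.locallyIntegrable ?_)
    have h1 : IntegrableOn f (Icc a b) := by
      refine Measure.integrableOn_of_bounded (M := B) (by simp) hfm.aestronglyMeasurable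
        (Eventually.of_forall fun t => by simpa using hB t)
    have : f = (Icc a b).indicator f := by
      ext t
      simp only [indicator]
      split_ifs with h
      · rfl
      · by_cases h' : t < a
        · exact ha t h'
        · exact hb t (by by_contra h''; exact h ⟨by linarith, by linarith⟩)
    rw [this]
    exact (integrable_indicator_iff measurableSet_Icc).2 h1
  have hfc : HasCompactSupport f := by
    refine HasCompactSupport.intro (isCompact_Icc (a := a) (b := b)) fun t h => ?_
    by_cases h' : t < a
    · exact ha t h'
    · exact hb t (by by_contra h''; exact h ⟨by linarith, by linarith⟩)
  have hconv : leftMoll ε f =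
      convolution (mollKernel ε) f (ContinuousLinearMap.mul ℝ ℝ) volume := rfl
  have hC1 : ContDiff ℝ 1 (leftMoll ε f) := by
    rw [hconv]
    exact (hasCompactSupport_mollKernel hε).contDiff_convolution_left _ (n := 1)
      (contDiff_mollKernel ε) hfi
  have hcs : HasCompactSupport (leftMoll ε f) := by
    rw [hconv]
    exact (hasCompactSupport_mollKernel hε).convolution _ hfc
  have hpc : Continuous (deriv (leftMoll ε f)) := hC1.continuous_deriv le_rfl
  obtain ⟨B', hB'⟩ := hcs.deriv.exists_bound_of_continuous hpc
  have hd : ∀ t, HasDerivAt (leftMoll ε f) (deriv (leftMoll ε f) t) t := fun t =>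
    (hC1.differentiable one_ne_zero t).hasDerivAt
  have hz : ∀ t, t < a → deriv (leftMoll ε f) t = 0 := by
    intro t ht
    have : leftMoll ε f =ᶠ[𝓝 t] fun _ => 0 := by
      filter_upwards [Iio_mem_nhds ht] with t' ht'
      exact leftMoll_of_le hε ha (le_of_lt ht')
    rw [this.deriv_eq]
    simp
  have hprim : ∀ r v, leftMoll ε f r - leftMoll ε f (r - v) =
      ∫ u in (0 : ℝ)..v, deriv (leftMoll ε f) (r - u) := by
    intro r v
    rw [intervalIntegral.integral_comp_sub_left (fun u => deriv (leftMoll ε f) u) r, sub_zero,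
      intervalIntegral.integral_eq_sub_of_hasDerivAt (fun t _ => hd t) (hpc.intervalIntegrable _ _)]
  refine ⟨B', hpc.measurable, fun t => by simpa using hB' t, hz, hprim, fun r => ?_⟩
  have h0 : leftMoll ε f (r - (max (r - a) 0)) = 0 :=
    leftMoll_of_le hε ha (by linarith [le_max_left (r - a) 0])
  have h1 := hprim r (max (r - a) 0)
  rw [h0, sub_zero] at h1
  rw [h1, intervalIntegral.integral_of_le (le_max_right _ _)]
  refine (setIntegral_eq_of_subset_of_forall_sdiff_eq_zero measurableSet_Ioi Ioc_subset_Ioi_self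
    ?_).symm
  rintro u ⟨hu, hu'⟩
  refine hz _ ?_
  have hu : 0 < u := hu
  have : max (r - a) 0 < u := by
    by_contra h
    exact hu' ⟨hu, by linarith⟩
  linarith [le_max_left (r - a) 0]

/-! ### The right sided derivative -/

/-- The right sided Marchaud derivative of a function on the line. -/
noncomputable def rightMarchaud (κ : ℝ) (f : ℝ → ℝ) (r : ℝ) : ℝ :=
  marchaud κ (fun v => f r - f (r + v))

/-- `f` vanishes on `[b, ∞)` and is `β`-Hölder continuous with constant `C` on `[a, ∞)`. The
minimum records that increments over long distances are increments over a part of `[a, b]`. -/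
structure HolderVanishing (a b β C : ℝ) (f : ℝ → ℝ) : Prop where
  measurable : Measurable f
  vanish : ∀ t, b ≤ t → f t = 0
  holder : ∀ t v, a ≤ t → 0 < v → |f t - f (t + v)| ≤ C * (min v (b - a)) ^ β

/-- Integration by parts: a left sided integral of order `κ` and the right sided derivative of order
`κ` of a Hölder function cancel. -/
lemma fracInt_pairing {κ β a b B C : ℝ} (hκ : 0 < κ) (hκ1 : κ < 1) (hβ : κ < β) (hab : a < b)
    {p f : ℝ → ℝ} (hpm : Measurable p) (hB : ∀ t, |p t| ≤ B) (hp : ∀ t, t < a → p t = 0)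
    (hHf : HolderVanishing a b β C f) :
    ∫ r in Icc a b, fracInt κ p r * rightMarchaud κ f r = ∫ r in Icc a b, p r * f r := by
  obtain ⟨hfm, hfb, hf⟩ := hHf
  have hab' : 0 < b - a := sub_pos.2 hab
  have hC0 : 0 ≤ C := by
    have h1 := (abs_nonneg _).trans (hf a 1 le_rfl one_pos)
    have h2 : 0 < (min 1 (b - a)) ^ β := Real.rpow_pos_of_pos (lt_min one_pos hab') _
    exact nonneg_of_mul_nonneg_left h1 h2
  have hfB : ∀ t, a ≤ t → |f t| ≤ C * (b - a) ^ β := by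
    intro t ht
    have := hf t (|b - t| + (b - a)) ht (by positivity)
    rw [min_eq_right (by linarith [abs_nonneg (b - t)]), hfb (t + _) (by
      linarith [le_abs_self (b - t)]), sub_zero] at this
    exact this
  -- The identity holds for primitives, by `fracInt_pairing_smooth`. The averages `F n` of `f` over
  -- the future are primitives with the same Hölder bound as `f` and converge to `f`. Reflection and
  -- a cut-off turn them into averages over the past.
  set f' : ℝ → ℝ := fun t => (Icc (-b) (-a)).indicator (fun t => f (-t)) t
  have hf'm : Measurable f' := (hfm.comp measurable_neg).indicator measurableSet_Icc
  have hf'eq : ∀ t, a ≤ t → f' (-t) = f t := by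
    intro t ht
    simp only [f', indicator, mem_Icc, neg_neg]
    split_ifs with h
    · rfl
    · rw [hfb t]
      by_contra h'
      exact h ⟨by linarith, by linarith⟩
  have hf'B : ∀ t, |f' t| ≤ C * (b - a) ^ β := by
    intro t
    simp only [f', indicator, mem_Icc]
    split_ifs with h
    · exact hfB _ (by linarith [h.2])
    · simpa using mul_nonneg hC0 (Real.rpow_nonneg hab'.le _)
  set e : ℕ → ℝ := fun n => 1 / ((n : ℝ) + 1) with he_def
  have he : ∀ n, 0 < e n := fun n => by positivity
  have he0 : Tendsto e atTop (𝓝 0) := tendsto_one_div_add_atTop_nhds_zero_nat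
  obtain ⟨F, hFdef⟩ : ∃ F : ℕ → ℝ → ℝ, F = fun n t => leftMoll (e n) f' (-t) := ⟨_, rfl⟩
  have hFeq : ∀ n t, a ≤ t → F n t = ∫ v, mollKernel (e n) v * f (t + v) := by
    intro n t ht
    simp only [hFdef, leftMoll]
    congr 1
    ext v
    by_cases hv : v ≤ e n
    · simp [mollKernel_eq_zero (he n) (Or.inl hv)]
    · have := he n
      rw [show -t - v = -(t + v) by ring, hf'eq (t + v) (by linarith)]
  have hint : ∀ n t, a ≤ t → Integrable fun v => mollKernel (e n) v * f (t + v) := by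
    intro n t ht
    have := he n
    exact integrable_mollKernel_mul (he n) (by fun_prop) (B := C * (b - a) ^ β)
      (fun v hv _ => hfB _ (by linarith))
  have hFinc : ∀ n t v, a ≤ t → 0 < v → |F n t - F n (t + v)| ≤ C * (min v (b - a)) ^ β := by
    intro n t v ht hv
    rw [hFeq n t ht, hFeq n (t + v) (by linarith), ← integral_sub (hint n t ht)
      (hint n (t + v) (by linarith))]
    have := abs_integral_mollKernel_mul_le (he n) (g := fun w => f (t + w) - f (t + w + v))
      (B := C * (min v (b - a)) ^ β) (fun w hw _ => hf _ v (by linarith [he n]) hv)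
    refine le_trans (le_of_eq ?_) this
    congr 2
    ext w
    rw [show t + v + w = t + w + v by ring]
    ring
  have hFlim : ∀ t, a ≤ t → Tendsto (fun n => F n t) atTop (𝓝 (f t)) := by
    intro t ht
    rw [tendsto_iff_norm_sub_tendsto_zero]
    have hβ0 : 0 < β := hκ.trans hβ
    have h1 : ∀ n, ‖F n t - f t‖ ≤ C * (3 * e n) ^ β := by
      intro n
      have hen := he n
      have h2 : f t = ∫ v, mollKernel (e n) v * f t := by
        rw [integral_mul_const, integral_mollKernel hen, one_mul]
      have h3 : F n t - f t = ∫ v, mollKernel (e n) v * (f (t + v) - f t) := by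
        nth_rewrite 1 [h2]
        rw [hFeq n t ht, ← integral_sub (hint n t ht) ((integrable_mollKernel hen).mul_const _)]
        simp only [mul_sub]
      rw [h3, Real.norm_eq_abs]
      refine abs_integral_mollKernel_mul_le hen fun v hv hv' => ?_
      rw [abs_sub_comm]
      refine (hf t v ht (hen.trans hv)).trans ?_
      gcongr
      · exact le_min (hen.trans hv).le hab'.le
      · exact (min_le_left _ _).trans hv'.le
    refine squeeze_zero (fun n => norm_nonneg _) h1 ?_
    have h4 : Tendsto (fun n => 3 * e n) atTop (𝓝 (3 * 0)) := he0.const_mul 3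
    rw [mul_zero] at h4
    have h5 := (h4.rpow_const (p := β) (Or.inr hβ0.le)).const_mul C
    rwa [Real.zero_rpow hβ0.ne', mul_zero] at h5
  have hFm : ∀ n, Measurable (F n) := by
    intro n
    obtain ⟨B', hm, hb', h0, hprim, hall⟩ := derivative_leftMoll (he n)
      (a := -b) (b := -a) hf'm hf'B
      (fun t ht => indicator_of_notMem (s := Icc (-b) (-a)) (fun h => by linarith [h.1]) _)
      (fun t ht => indicator_of_notMem (s := Icc (-b) (-a)) (fun h => by linarith [h.2]) _)
    have : F n = fun t => fracInt 1 (deriv (leftMoll (e n) f')) (-t) := by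
      ext t
      simp only [hFdef, fracInt]
      rw [hall]
      simp
    rw [this]
    exact (measurable_fracInt hm).comp measurable_neg
  have hn : ∀ n, ∫ r in Icc a b, fracInt κ p r * rightMarchaud κ (F n) r =
      ∫ r in Icc a b, p r * F n r := by
    intro n
    obtain ⟨B', hm, hb', h0, hprim, hall⟩ := derivative_leftMoll (he n)
      (a := -b) (b := -a) hf'm hf'B
      (fun t ht => indicator_of_notMem (s := Icc (-b) (-a)) (fun h => by linarith [h.1]) _)
      (fun t ht => indicator_of_notMem (s := Icc (-b) (-a)) (fun h => by linarith [h.2]) _)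
    set q : ℝ → ℝ := fun t => deriv (leftMoll (e n) f') (-t)
    have hq1 : ∀ r, F n r = ∫ u in Ioi (0 : ℝ), q (r + u) := by
      intro r
      simp only [hFdef, q, hall, neg_add, sub_eq_add_neg]
    have hq2 : ∀ r, rightMarchaud κ (F n) r =
        1 / Real.Gamma (1 - κ) * ∫ u in Ioi (0 : ℝ), q (r + u) * u ^ (-κ) := by
      intro r
      refine (marchaud_primitive hκ hκ1 (k := fun u => q (r + u)) (B := B') (ℓ := b - r)
        (by fun_prop) (fun u _ => hb' _) (fun u hu => h0 _ (by linarith)) ?_).2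
      intro v hv
      have := hprim (-r) v
      simp only [hFdef, q, neg_add, sub_eq_add_neg] at this ⊢
      exact this
    simp only [hq2]
    simp only [hq1]
    exact fracInt_pairing_smooth hκ hκ1 hab (B := max B B') hpm
      (fun t => (hB t).trans (le_max_left _ _)) hp (by fun_prop)
      (fun t => (hb' _).trans (le_max_right _ _)) (fun t ht => h0 (-t) (by linarith))
  have hL : Tendsto (fun n => ∫ r in Icc a b, fracInt κ p r * rightMarchaud κ (F n) r) atTop
      (𝓝 (∫ r in Icc a b, fracInt κ p r * rightMarchaud κ f r)) := by
    refine tendsto_integral_of_dominated_convergence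
      (fun _ => B * (1 / Real.Gamma κ * ((b - a) ^ κ / κ)) *
        (C * marchaudConst κ β * (b - a) ^ (β - κ))) (fun n => ?_) (integrable_const _) (fun n => ?_) ?_
    · refine ((measurable_fracInt hpm).mul (measurable_marchaud ?_)).aestronglyMeasurable
      have := hFm n
      change Measurable fun z : ℝ × ℝ => F n z.1 - F n (z.1 + z.2)
      fun_prop
    · refine (ae_restrict_iff' measurableSet_Icc).2 (Eventually.of_forall fun r hr => ?_)
      rw [norm_mul, Real.norm_eq_abs, Real.norm_eq_abs]
      refine mul_le_mul (abs_fracInt_le hκ hB hp hr.2 hab)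
        (abs_marchaud_le hκ hκ1 hβ hab' fun v hv => hFinc n r v hr.1 hv) (abs_nonneg _)
        ((abs_nonneg _).trans (abs_fracInt_le hκ hB hp hr.2 hab))
    · refine (ae_restrict_iff' measurableSet_Icc).2 (Eventually.of_forall fun r hr => ?_)
      refine Tendsto.const_mul _ (tendsto_marchaud hκ hβ hab' (C := C) (fun n => ?_)
        (fun n v hv => hFinc n r v hr.1 hv) (fun v hv => ?_))
      · have := hFm n
        fun_prop
      · exact (hFlim r hr.1).sub (hFlim (r + v) (by linarith [hr.1]))
  have hR : Tendsto (fun n => ∫ r in Icc a b, p r * F n r) atTop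
      (𝓝 (∫ r in Icc a b, p r * f r)) := by
    refine tendsto_integral_of_dominated_convergence (fun _ => B * (C * (b - a) ^ β))
      (fun n => (hpm.mul (hFm n)).aestronglyMeasurable) (integrable_const _) (fun n => ?_) ?_
    · refine Eventually.of_forall fun r => ?_
      rw [norm_mul, Real.norm_eq_abs, Real.norm_eq_abs]
      rw [hFdef]
      refine mul_le_mul (hB r) (abs_integral_mollKernel_mul_le (he n) fun v _ _ => hf'B _)
        (abs_nonneg _) ((abs_nonneg _).trans (hB r))
    · refine (ae_restrict_iff' measurableSet_Icc).2 (Eventually.of_forall fun r hr => ?_)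
      exact (hFlim r hr.1).const_mul _
  simp only [hn] at hL
  exact tendsto_nhds_unique hL hR

end

/-! ### Mollified increments -/

/-- The integral in the left sided Marchaud derivative of the mollifying kernel, with the opposite
sign, so that it approximates `t^{-κ-1}`. It replaces the Marchaud kernel for mollified increments;
see `marchaud_mollInc`. -/
noncomputable def kernelDeriv (κ ε t : ℝ) : ℝ :=
  ∫ u in Ioi (0 : ℝ), (mollKernel ε (t - u) - mollKernel ε t) / u ^ (κ + 1)

/-- The mollification of an increment function `φ`: if `φ v` is the increment over `[r - v, r]`,
this is the increment over `[r - u, r]` of the mollified function. -/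
noncomputable def mollInc (ε : ℝ) (φ : ℝ → ℝ) (u : ℝ) : ℝ :=
  ∫ v, mollKernel ε v * (φ (u + v) - φ v)

lemma integrableOn_kernelDeriv {κ ε : ℝ} (hκ : 0 < κ) (hκ1 : κ < 1) (hε : 0 < ε) (t : ℝ) :
    IntegrableOn (fun u => |mollKernel ε (t - u) - mollKernel ε t| / u ^ (κ + 1)) (Ioi 0) := by
  obtain ⟨L, hL0, hL⟩ := exists_lipschitz_mollKernel
  have hm := measurable_mollKernel ε
  refine marchaudIntegrable_of_le (q := 1) (h := ε) (C := L * ε⁻¹ ^ 2) hκ hκ1 hε (by fun_prop)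
    fun u hu => ?_
  have := hL ε hε (t - u) t
  rw [sub_sub_cancel_left, abs_neg, abs_of_pos hu] at this
  rwa [abs_abs, Real.rpow_one]

/-- The Marchaud derivative of the mollifying kernel is bounded by the Marchaud kernel, uniformly
in the scale. -/
lemma exists_kernelDeriv_bound {κ : ℝ} (hκ : 0 < κ) (hκ1 : κ < 1) : ∃ C : ℝ, 0 ≤ C ∧
    ∀ ε, 0 < ε → ∀ t, 0 < t →
      ∫ u in Ioi (0 : ℝ), |mollKernel ε (t - u) - mollKernel ε t| / u ^ (κ + 1) ≤
        C * (1 / t ^ (κ + 1)) := by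
  obtain ⟨L, hL0, hL⟩ := exists_lipschitz_mollKernel
  set K := 1 / (1 - κ) + 1 / κ
  have hK : 0 ≤ K := by
    have : 0 < 1 - κ := by linarith
    positivity
  refine ⟨(L * K + 1) * 4 ^ (κ + 1), by positivity, fun ε hε t ht => ?_⟩
  have ht' : 0 < t ^ (κ + 1) := Real.rpow_pos_of_pos ht _
  have h4 : (0 : ℝ) < 4 ^ (κ + 1) := by positivity
  -- If `t ≤ 4ε`, the Lipschitz bound of the kernel suffices. Otherwise the kernel vanishes at `t`,
  -- and on the support of `mollKernel ε (t - u)` one has `u ≥ t / 4`.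
  rcases le_total t (4 * ε) with h | h
  · have h1 : ∫ u in Ioi (0 : ℝ), |mollKernel ε (t - u) - mollKernel ε t| / u ^ (κ + 1) ≤
        ∫ u in Ioi (0 : ℝ), L * ε⁻¹ ^ 2 * ((min u ε) ^ (1 : ℝ) / u ^ (κ + 1)) := by
      refine setIntegral_mono_on (integrableOn_kernelDeriv hκ hκ1 hε t)
        (Integrable.const_mul (min_rpow_div_integrable_and_integral hκ hκ1 hε).1 _)
        measurableSet_Ioi fun u hu => ?_
      have hu : 0 < u := hu
      have hu' : 0 < u ^ (κ + 1) := Real.rpow_pos_of_pos hu _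
      have := hL ε hε (t - u) t
      rw [sub_sub_cancel_left, abs_neg, abs_of_pos hu] at this
      rw [Real.rpow_one, ← mul_div_assoc]
      gcongr
    refine h1.trans ?_
    rw [integral_const_mul, (min_rpow_div_integrable_and_integral hκ hκ1 hε).2]
    have h2 : ε⁻¹ ^ 2 * ε ^ (1 - κ) = 1 / ε ^ (κ + 1) := by
      rw [Real.rpow_sub hε, Real.rpow_add hε, Real.rpow_one]
      have := (Real.rpow_pos_of_pos hε κ).ne'
      field_simp
    have h3 : 1 / ε ^ (κ + 1) ≤ 4 ^ (κ + 1) * (1 / t ^ (κ + 1)) := by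
      rw [mul_one_div, div_le_div_iff₀ (by positivity) ht', one_mul,
        ← Real.mul_rpow (by norm_num) hε.le]
      exact Real.rpow_le_rpow ht.le h (by linarith)
    calc L * ε⁻¹ ^ 2 * (ε ^ (1 - κ) * (1 / (1 - κ) + 1 / κ))
        = L * K * (ε⁻¹ ^ 2 * ε ^ (1 - κ)) := by simp only [K]; ring
      _ ≤ L * K * (4 ^ (κ + 1) * (1 / t ^ (κ + 1))) := by rw [h2]; gcongr
      _ ≤ (L * K + 1) * (4 ^ (κ + 1) * (1 / t ^ (κ + 1))) := by gcongr; linarith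
      _ = _ := by ring
  · have hmt : mollKernel ε t = 0 := mollKernel_eq_zero hε (Or.inr (by linarith))
    have h1 : ∫ u in Ioi (0 : ℝ), |mollKernel ε (t - u) - mollKernel ε t| / u ^ (κ + 1) ≤
        ∫ u in Ioi (0 : ℝ), mollKernel ε (t - u) * (4 ^ (κ + 1) * (1 / t ^ (κ + 1))) := by
      refine setIntegral_mono_on (integrableOn_kernelDeriv hκ hκ1 hε t)
        (Integrable.mul_const ((integrable_mollKernel hε).comp_sub_left t).integrableOn _)
        measurableSet_Ioi fun u hu => ?_
      have hu : 0 < u := hu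
      have hu' : 0 < u ^ (κ + 1) := Real.rpow_pos_of_pos hu _
      rw [hmt, sub_zero, abs_of_nonneg (mollKernel_nonneg hε _)]
      by_cases hv : 3 * ε ≤ t - u
      · simp [mollKernel_eq_zero hε (Or.inr hv)]
      · rw [div_eq_mul_one_div]
        refine mul_le_mul_of_nonneg_left ?_ (mollKernel_nonneg hε _)
        rw [mul_one_div, div_le_div_iff₀ hu' ht', one_mul,
          ← Real.mul_rpow (by norm_num) hu.le]
        refine Real.rpow_le_rpow ht.le ?_ (by linarith)
        linarith
    refine h1.trans ?_
    rw [integral_mul_const]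
    have h2 : ∫ u in Ioi (0 : ℝ), mollKernel ε (t - u) ≤ 1 := by
      calc ∫ u in Ioi (0 : ℝ), mollKernel ε (t - u) ≤ ∫ u, mollKernel ε (t - u) :=
            setIntegral_le_integral ((integrable_mollKernel hε).comp_sub_left t)
              (Eventually.of_forall fun u => mollKernel_nonneg hε _)
        _ = 1 := by rw [integral_sub_left_eq_self, integral_mollKernel hε]
    calc _ ≤ 1 * (4 ^ (κ + 1) * (1 / t ^ (κ + 1))) := by gcongr
      _ ≤ (L * K + 1) * (4 ^ (κ + 1) * (1 / t ^ (κ + 1))) := by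
        gcongr
        have : 0 ≤ L * K := by positivity
        linarith
      _ = _ := by ring

lemma measurable_kernelDeriv (κ ε : ℝ) : Measurable (kernelDeriv κ ε) := by
  unfold kernelDeriv
  have hm := measurable_mollKernel ε
  have : StronglyMeasurable (Function.uncurry fun t u : ℝ =>
      (mollKernel ε (t - u) - mollKernel ε t) / u ^ (κ + 1)) := by
    refine Measurable.stronglyMeasurable ?_
    change Measurable fun z : ℝ × ℝ =>
      (mollKernel ε (z.1 - z.2) - mollKernel ε z.1) / z.2 ^ (κ + 1)
    exact Measurable.div (by fun_prop) (by fun_prop)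
  exact (this.integral_prod_right (ν := volume.restrict (Ioi 0))).measurable

lemma abs_kernelDeriv_le (κ ε t : ℝ) : |kernelDeriv κ ε t| ≤
    ∫ u in Ioi (0 : ℝ), |mollKernel ε (t - u) - mollKernel ε t| / u ^ (κ + 1) := by
  unfold kernelDeriv
  rw [← Real.norm_eq_abs]
  refine (norm_integral_le_integral_norm _).trans (le_of_eq ?_)
  refine setIntegral_congr_fun measurableSet_Ioi fun u hu => ?_
  have hu : 0 < u := hu
  rw [Real.norm_eq_abs, abs_div, abs_of_pos (Real.rpow_pos_of_pos hu _)]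

/-- On the support of `mollKernel ε (t - u)` the variable `u` lies between `t - 3ε` and `t`, so for
small `ε` the value at `t` is an average of `u^{-κ-1}` over points close to `t`. -/
lemma tendsto_kernelDeriv {κ t : ℝ} (hκ : 0 < κ) (hκ1 : κ < 1) (ht : 0 < t) :
    Tendsto (fun n : ℕ => kernelDeriv κ (1 / ((n : ℝ) + 1)) t) atTop (𝓝 (1 / t ^ (κ + 1))) := by
  have he0 : Tendsto (fun n : ℕ => 1 / ((n : ℝ) + 1)) atTop (𝓝 0) :=
    tendsto_one_div_add_atTop_nhds_zero_nat
  have hup : Tendsto (fun n : ℕ => 1 / (t - 3 * (1 / ((n : ℝ) + 1))) ^ (κ + 1)) atTop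
      (𝓝 (1 / t ^ (κ + 1))) := by
    have h1 : Tendsto (fun n : ℕ => t - 3 * (1 / ((n : ℝ) + 1))) atTop (𝓝 (t - 3 * 0)) :=
      (he0.const_mul 3).const_sub t
    rw [mul_zero, sub_zero] at h1
    exact tendsto_const_nhds.div (h1.rpow_const (Or.inl ht.ne'))
      (Real.rpow_pos_of_pos ht _).ne'
  have hev : ∀ᶠ n : ℕ in atTop, 1 / ((n : ℝ) + 1) < t / 4 := he0.eventually_lt_const (by linarith)
  have key : ∀ᶠ n : ℕ in atTop, 1 / t ^ (κ + 1) ≤ kernelDeriv κ (1 / ((n : ℝ) + 1)) t ∧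
      kernelDeriv κ (1 / ((n : ℝ) + 1)) t ≤ 1 / (t - 3 * (1 / ((n : ℝ) + 1))) ^ (κ + 1) := by
    filter_upwards [hev] with n hn
    have hε : (0 : ℝ) < 1 / ((n : ℝ) + 1) := by positivity
    set ε := 1 / ((n : ℝ) + 1)
    have hmt : mollKernel ε t = 0 := mollKernel_eq_zero hε (Or.inr (by linarith))
    have hI1 : ∀ u, 0 < u → |mollKernel ε (t - u) - mollKernel ε t| = mollKernel ε (t - u) := by
      intro u _
      rw [hmt, sub_zero, abs_of_nonneg (mollKernel_nonneg hε _)]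
    have hi : IntegrableOn (fun u => mollKernel ε (t - u) / u ^ (κ + 1)) (Ioi 0) := by
      refine (integrableOn_kernelDeriv hκ hκ1 hε t).congr_fun (fun u hu => ?_) measurableSet_Ioi
      simp only [hI1 u hu]
    have hki : kernelDeriv κ ε t = ∫ u in Ioi (0 : ℝ), mollKernel ε (t - u) / u ^ (κ + 1) := by
      unfold kernelDeriv
      simp only [hmt, sub_zero]
    have hone : ∫ u in Ioi (0 : ℝ), mollKernel ε (t - u) = 1 := by
      rw [setIntegral_eq_integral_of_forall_compl_eq_zero, integral_sub_left_eq_self,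
        integral_mollKernel hε]
      intro u hu
      have : u ≤ 0 := not_lt.1 hu
      exact mollKernel_eq_zero hε (Or.inr (by linarith))
    have hmi : ∀ c, IntegrableOn (fun u => mollKernel ε (t - u) * c) (Ioi 0) := fun c =>
      Integrable.mul_const ((integrable_mollKernel hε).comp_sub_left t).integrableOn _
    rw [hki]
    constructor
    · calc 1 / t ^ (κ + 1) = ∫ u in Ioi (0 : ℝ), mollKernel ε (t - u) * (1 / t ^ (κ + 1)) := by
            rw [integral_mul_const, hone, one_mul]
        _ ≤ _ := by
            refine setIntegral_mono_on (hmi _) hi measurableSet_Ioi fun u hu => ?_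
            have hu : 0 < u := hu
            have hu' : 0 < u ^ (κ + 1) := Real.rpow_pos_of_pos hu _
            by_cases hv : t - u ≤ ε
            · simp [mollKernel_eq_zero hε (Or.inl hv)]
            · rw [div_eq_mul_one_div (mollKernel _ _)]
              refine mul_le_mul_of_nonneg_left ?_ (mollKernel_nonneg hε _)
              refine one_div_le_one_div_of_le hu' (Real.rpow_le_rpow hu.le ?_ (by linarith))
              linarith
    · calc _ ≤ ∫ u in Ioi (0 : ℝ), mollKernel ε (t - u) * (1 / (t - 3 * ε) ^ (κ + 1)) := by
            refine setIntegral_mono_on hi (hmi _) measurableSet_Ioi fun u hu => ?_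
            have h3 : 0 < t - 3 * ε := by linarith
            by_cases hv : 3 * ε ≤ t - u
            · simp [mollKernel_eq_zero hε (Or.inr hv)]
            · rw [div_eq_mul_one_div (mollKernel _ _)]
              refine mul_le_mul_of_nonneg_left ?_ (mollKernel_nonneg hε _)
              refine one_div_le_one_div_of_le (Real.rpow_pos_of_pos h3 _)
                (Real.rpow_le_rpow h3.le ?_ (by linarith))
              linarith
        _ = _ := by rw [integral_mul_const, hone, one_mul]
  exact tendsto_of_tendsto_of_tendsto_of_le_of_le' tendsto_const_nhds hup
    (key.mono fun n h => h.1) (key.mono fun n h => h.2)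

/-- Mollifying the increments amounts to replacing the Marchaud kernel by the Marchaud derivative
of the mollifying kernel. -/
lemma marchaud_mollInc {κ ε B : ℝ} (hκ : 0 < κ) (hκ1 : κ < 1) (hε : 0 < ε) {φ : ℝ → ℝ}
    (hφm : Measurable φ) (hB : ∀ t, 0 < t → |φ t| ≤ B) (hφ : MarchaudIntegrable κ φ) :
    marchaud κ (mollInc ε φ) =
      κ / Real.Gamma (1 - κ) * ∫ t in Ioi (0 : ℝ), φ t * kernelDeriv κ ε t := by
  have hm := measurable_mollKernel ε
  obtain ⟨C, hC0, hC⟩ := exists_kernelDeriv_bound hκ hκ1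
  unfold marchaud
  congr 1
  have hrep : ∀ u, 0 < u → mollInc ε φ u =
      ∫ t in Ioi (0 : ℝ), φ t * (mollKernel ε (t - u) - mollKernel ε t) := by
    intro u hu
    have i1 : Integrable fun v => mollKernel ε v * φ (u + v) :=
      integrable_mollKernel_mul hε (by fun_prop) (B := B) fun v hv _ => hB _ (by linarith)
    have i2 : Integrable fun v => mollKernel ε v * φ v :=
      integrable_mollKernel_mul hε hφm (B := B) fun v hv _ => hB _ (by linarith)
    have i3 : Integrable fun t => mollKernel ε (t - u) * φ t := by
      simpa using i1.comp_sub_right u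
    have e1 : ∫ v, mollKernel ε v * φ (u + v) = ∫ t, mollKernel ε (t - u) * φ t := by
      rw [← integral_sub_right_eq_self (fun v => mollKernel ε v * φ (u + v)) u]
      simp
    unfold mollInc
    simp only [mul_sub]
    rw [integral_sub i1 i2, e1, ← integral_sub i3 i2,
      setIntegral_eq_integral_of_forall_compl_eq_zero]
    · congr 1
      ext t
      ring
    · intro t ht
      have : t ≤ 0 := not_lt.1 ht
      rw [mollKernel_eq_zero hε (Or.inl (by linarith)),
        mollKernel_eq_zero hε (Or.inl (by linarith))]
      simp
  have hrep2 : EqOn (fun u => mollInc ε φ u / u ^ (κ + 1)) (fun u => ∫ t in Ioi (0 : ℝ),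
      φ t * ((mollKernel ε (t - u) - mollKernel ε t) / u ^ (κ + 1))) (Ioi 0) := by
    intro u hu
    simp only []
    rw [hrep u hu, ← integral_div]
    simp only [mul_div_assoc]
  have hFi : Integrable (fun z : ℝ × ℝ =>
      φ z.2 * ((mollKernel ε (z.2 - z.1) - mollKernel ε z.2) / z.1 ^ (κ + 1)))
      ((volume.restrict (Ioi 0)).prod (volume.restrict (Ioi 0))) := by
    have hmeas : Measurable (fun z : ℝ × ℝ =>
        φ z.2 * ((mollKernel ε (z.2 - z.1) - mollKernel ε z.2) / z.1 ^ (κ + 1))) :=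
      Measurable.mul (by fun_prop) (Measurable.div (by fun_prop) (by fun_prop))
    have hnorm : ∀ t, ∀ u, 0 < u →
        ‖φ t * ((mollKernel ε (t - u) - mollKernel ε t) / u ^ (κ + 1))‖ =
        |φ t| * (|mollKernel ε (t - u) - mollKernel ε t| / u ^ (κ + 1)) := by
      intro t u hu
      rw [Real.norm_eq_abs, abs_mul, abs_div, abs_of_pos (Real.rpow_pos_of_pos hu _)]
    rw [integrable_prod_iff' hmeas.aestronglyMeasurable]
    constructor
    · refine (ae_restrict_iff' measurableSet_Ioi).2 (Eventually.of_forall fun t ht => ?_)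
      refine Integrable.mono' (Integrable.const_mul (integrableOn_kernelDeriv hκ hκ1 hε t) |φ t|)
        (hmeas.comp measurable_prodMk_right).aestronglyMeasurable ?_
      refine (ae_restrict_iff' measurableSet_Ioi).2 (Eventually.of_forall fun u hu => ?_)
      exact (hnorm t u hu).le
    · refine Integrable.mono' (g := fun t => C * ‖φ t / t ^ (κ + 1)‖) (hφ.norm.const_mul C) ?_ ?_
      · have := (hmeas.norm.stronglyMeasurable.comp_measurable measurable_swap).integral_prod_right'
          (ν := volume.restrict (Ioi (0 : ℝ)))
        exact this.aestronglyMeasurable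
      · refine (ae_restrict_iff' measurableSet_Ioi).2 (Eventually.of_forall fun t ht => ?_)
        have ht : 0 < t := ht
        have ht' : 0 < t ^ (κ + 1) := Real.rpow_pos_of_pos ht _
        rw [Real.norm_of_nonneg (integral_nonneg fun _ => norm_nonneg _),
          setIntegral_congr_fun measurableSet_Ioi (fun u hu => hnorm t u hu), integral_const_mul,
          norm_div, Real.norm_eq_abs, Real.norm_eq_abs, abs_of_pos ht']
        calc _ ≤ |φ t| * (C * (1 / t ^ (κ + 1))) := by
              gcongr
              exact hC ε hε t ht
          _ = _ := by ring
  rw [setIntegral_congr_fun measurableSet_Ioi hrep2, integral_integral_swap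
    (f := fun u t => φ t * ((mollKernel ε (t - u) - mollKernel ε t) / u ^ (κ + 1))) hFi]
  simp only [integral_const_mul]
  rfl

/-- Mollifying the increments changes the Marchaud functional continuously, with a bound that is
uniform in the scale. -/
lemma exists_marchaud_mollInc_bound {κ : ℝ} (hκ : 0 < κ) (hκ1 : κ < 1) : ∃ C : ℝ, 0 ≤ C ∧
    ∀ (φ : ℝ → ℝ) (B : ℝ), Measurable φ → (∀ t, 0 < t → |φ t| ≤ B) → MarchaudIntegrable κ φ →
      (∀ ε, 0 < ε → |marchaud κ (mollInc ε φ)| ≤ C * ∫ t in Ioi (0 : ℝ), |φ t| / t ^ (κ + 1)) ∧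
      Tendsto (fun n : ℕ => marchaud κ (mollInc (1 / ((n : ℝ) + 1)) φ)) atTop
        (𝓝 (marchaud κ φ)) := by
  obtain ⟨C, hC0, hC⟩ := exists_kernelDeriv_bound hκ hκ1
  have hG := Real.Gamma_pos_of_pos (show 0 < 1 - κ by linarith)
  have hc : 0 < κ / Real.Gamma (1 - κ) := by positivity
  refine ⟨κ / Real.Gamma (1 - κ) * C, by positivity, fun φ B hφm hB hφ => ?_⟩
  have hb : ∀ ε, 0 < ε → ∀ t, 0 < t → ‖φ t * kernelDeriv κ ε t‖ ≤ C * (|φ t| / t ^ (κ + 1)) := by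
    intro ε hε t ht
    rw [norm_mul, Real.norm_eq_abs, Real.norm_eq_abs]
    calc _ ≤ |φ t| * (C * (1 / t ^ (κ + 1))) := by
          gcongr
          exact (abs_kernelDeriv_le κ ε t).trans (hC ε hε t ht)
      _ = _ := by ring
  have hi : IntegrableOn (fun t => |φ t| / t ^ (κ + 1)) (Ioi 0) := by
    refine hφ.norm.congr ?_
    refine (ae_restrict_iff' measurableSet_Ioi).2 (Eventually.of_forall fun t ht => ?_)
    have ht : 0 < t := ht
    simp only []
    rw [norm_div, Real.norm_eq_abs, Real.norm_eq_abs, abs_of_pos (Real.rpow_pos_of_pos ht _)]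
  constructor
  · intro ε hε
    rw [marchaud_mollInc hκ hκ1 hε hφm hB hφ, abs_mul, abs_of_pos hc, mul_assoc]
    refine mul_le_mul_of_nonneg_left ?_ hc.le
    rw [← integral_const_mul, ← Real.norm_eq_abs]
    refine norm_integral_le_of_norm_le (hi.const_mul C) ?_
    exact (ae_restrict_iff' measurableSet_Ioi).2 (Eventually.of_forall fun t ht => hb ε hε t ht)
  · have : ∀ n : ℕ, marchaud κ (mollInc (1 / ((n : ℝ) + 1)) φ) = κ / Real.Gamma (1 - κ) *
        ∫ t in Ioi (0 : ℝ), φ t * kernelDeriv κ (1 / ((n : ℝ) + 1)) t := fun n =>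
      marchaud_mollInc hκ hκ1 (by positivity) hφm hB hφ
    simp only [this]
    refine Tendsto.const_mul _ ?_
    refine tendsto_integral_of_dominated_convergence (fun t => C * (|φ t| / t ^ (κ + 1)))
      (fun n => (hφm.mul (measurable_kernelDeriv _ _)).aestronglyMeasurable) (hi.const_mul C)
      (fun n => ?_) ?_
    · exact (ae_restrict_iff' measurableSet_Ioi).2 (Eventually.of_forall fun t ht =>
        hb _ (by positivity) t ht)
    · refine (ae_restrict_iff' measurableSet_Ioi).2 (Eventually.of_forall fun t ht => ?_)
      have := (tendsto_kernelDeriv hκ hκ1 ht).const_mul (φ t)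
      rwa [mul_one_div] at this

/-! ### The rough integral of mollified functions -/

lemma marchaud_add {κ : ℝ} {φ ψ : ℝ → ℝ} (hφ : MarchaudIntegrable κ φ)
    (hψ : MarchaudIntegrable κ ψ) :
    MarchaudIntegrable κ (fun v => φ v + ψ v) ∧
      marchaud κ (fun v => φ v + ψ v) = marchaud κ φ + marchaud κ ψ := by
  unfold MarchaudIntegrable marchaud at *
  simp only [add_div]
  exact ⟨hφ.add hψ, by rw [integral_add hφ hψ, mul_add]⟩

lemma marchaud_const_mul {κ : ℝ} {φ : ℝ → ℝ} (c : ℝ) (hφ : MarchaudIntegrable κ φ) :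
    MarchaudIntegrable κ (fun v => c * φ v) ∧
      marchaud κ (fun v => c * φ v) = c * marchaud κ φ := by
  unfold MarchaudIntegrable marchaud at *
  simp only [mul_div_assoc]
  exact ⟨Integrable.const_mul hφ c, by rw [integral_const_mul, mul_left_comm]⟩

lemma marchaud_sum {κ : ℝ} {ι : Type*} (s : Finset ι) {φ : ι → ℝ → ℝ}
    (hφ : ∀ i ∈ s, MarchaudIntegrable κ (φ i)) :
    MarchaudIntegrable κ (fun v => ∑ i ∈ s, φ i v) ∧
      marchaud κ (fun v => ∑ i ∈ s, φ i v) = ∑ i ∈ s, marchaud κ (φ i) := by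
  unfold MarchaudIntegrable marchaud at *
  simp only [Finset.sum_div]
  exact ⟨integrable_finsetSum _ hφ, by rw [integral_finsetSum _ hφ, Finset.mul_sum]⟩

/-- A bounded measurable function that vanishes outside `[a, b]`. -/
structure BoundedOn (a b B : ℝ) (f : ℝ → ℝ) : Prop where
  measurable : Measurable f
  bound : ∀ t, |f t| ≤ B
  left : ∀ t, t < a → f t = 0
  right : ∀ t, b < t → f t = 0

lemma BoundedOn.integrable_moll {a b B ε : ℝ} {f : ℝ → ℝ} (hf : BoundedOn a b B f) (hε : 0 < ε)
    (r : ℝ) : Integrable fun v => mollKernel ε v * f (r - v) := by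
  have := hf.measurable
  exact integrable_mollKernel_mul hε (by fun_prop) (B := B) fun v _ _ => hf.bound _

lemma mollInc_leftInc {a b B ε : ℝ} {f : ℝ → ℝ} (hf : BoundedOn a b B f) (hε : 0 < ε) (r u : ℝ) :
    mollInc ε (fun v => f r - f (r - v)) u = leftMoll ε f r - leftMoll ε f (r - u) := by
  unfold mollInc leftMoll
  rw [← integral_sub (hf.integrable_moll hε r) (hf.integrable_moll hε (r - u))]
  congr 1
  ext v
  simp only [show r - (u + v) = r - u - v by ring]
  ring

/-- The Marchaud derivative of the mollification of `f` is a fractional integral. -/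
lemma marchaud_leftMoll {κ a b B ε : ℝ} (hκ : 0 < κ) (hκ1 : κ < 1) {f : ℝ → ℝ}
    (hf : BoundedOn a b B f) (hε : 0 < ε) (r : ℝ) :
    MarchaudIntegrable κ (fun u => leftMoll ε f r - leftMoll ε f (r - u)) ∧
      marchaud κ (fun u => leftMoll ε f r - leftMoll ε f (r - u)) =
        fracInt (1 - κ) (deriv (leftMoll ε f)) r := by
  obtain ⟨B', hm, hb', h0, hprim, hall⟩ :=
    derivative_leftMoll hε hf.measurable hf.bound hf.left hf.right
  have := marchaud_primitive hκ hκ1 (k := fun u => deriv (leftMoll ε f) (r - u)) (B := B')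
    (ℓ := r - a) (by fun_prop) (fun u _ => hb' _) (fun u hu => h0 _ (by linarith))
    (φ := fun u => leftMoll ε f r - leftMoll ε f (r - u)) (fun v _ => hprim r v)
  refine ⟨this.1, this.2.trans ?_⟩
  unfold fracInt
  rw [show 1 - κ - 1 = -κ by ring]

section
variable {ι : Type*} [Fintype ι]

/-- The compensated increment `F(r) - F(r-v) - ∑ᵢ gᵢ(r-v) (xᵢ(r) - xᵢ(r-v))` of `F` over
`[r - v, r]`. -/
noncomputable def compInc (F : ℝ → ℝ) (g x : ι → ℝ → ℝ) (r v : ℝ) : ℝ :=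
  F r - F (r - v) - ∑ i, g i (r - v) * (x i r - x i (r - v))

/-- The function `F - ∑ᵢ gᵢ xᵢ`. -/
noncomputable def uncontrolled (F : ℝ → ℝ) (g x : ι → ℝ → ℝ) (t : ℝ) : ℝ :=
  F t - ∑ i, g i t * x i t

/-- Mollified compensated increments are increments of functions of one variable: of the
mollification of `F - ∑ᵢ gᵢ xᵢ`, and of those of `gᵢ` multiplied by the unmollified `xᵢ(r)`. -/
lemma mollInc_compInc {a b B B₀ ε : ℝ} {F : ℝ → ℝ} {g x : ι → ℝ → ℝ}
    (hF : BoundedOn a b B₀ (uncontrolled F g x)) (hg : ∀ i, BoundedOn a b B (g i)) (hε : 0 < ε)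
    (r u : ℝ) :
    mollInc ε (compInc F g x r) u =
      (leftMoll ε (uncontrolled F g x) r - leftMoll ε (uncontrolled F g x) (r - u)) +
        ∑ i, x i r * (leftMoll ε (g i) r - leftMoll ε (g i) (r - u)) := by
  have i1 := fun i => (hg i).integrable_moll hε r
  have i2 := fun i => (hg i).integrable_moll hε (r - u)
  have i3 : ∀ i, Integrable fun v =>
      x i r * (mollKernel ε v * g i (r - v) - mollKernel ε v * g i (r - u - v)) :=
    fun i => ((i1 i).sub (i2 i)).const_mul _
  have i4 : Integrable fun v => mollKernel ε v * uncontrolled F g x (r - v) -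
      mollKernel ε v * uncontrolled F g x (r - u - v) :=
    (hF.integrable_moll hε r).sub (hF.integrable_moll hε (r - u))
  have e : ∀ i, x i r * (leftMoll ε (g i) r - leftMoll ε (g i) (r - u)) =
      ∫ v, x i r * (mollKernel ε v * g i (r - v) - mollKernel ε v * g i (r - u - v)) := by
    intro i
    rw [integral_const_mul, integral_sub (i1 i) (i2 i)]
    rfl
  unfold mollInc leftMoll at *
  rw [Finset.sum_congr rfl (fun i _ => e i),
    ← integral_finsetSum _ (fun i _ => i3 i),
    ← integral_sub (hF.integrable_moll hε r) (hF.integrable_moll hε (r - u)), ← integral_add i4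
    (integrable_finsetSum _ (fun i _ => i3 i))]
  congr 1
  ext v
  rw [Finset.sum_congr rfl (fun i _ => show x i r * (mollKernel ε v * g i (r - v) -
    mollKernel ε v * g i (r - u - v)) = mollKernel ε v * (x i r * g i (r - v) -
      x i r * g i (r - u - v)) by ring), ← Finset.mul_sum]
  unfold compInc uncontrolled
  rw [show r - (u + v) = r - u - v by ring]
  simp only [mul_sub, Finset.sum_sub_distrib, mul_comm (x _ r)]
  ring

lemma marchaud_mollInc_compInc {κ a b B B₀ ε : ℝ} (hκ : 0 < κ) (hκ1 : κ < 1) {F : ℝ → ℝ}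
    {g x : ι → ℝ → ℝ} (hF : BoundedOn a b B₀ (uncontrolled F g x))
    (hg : ∀ i, BoundedOn a b B (g i)) (hε : 0 < ε) (r : ℝ) :
    marchaud κ (mollInc ε (compInc F g x r)) =
      fracInt (1 - κ) (deriv (leftMoll ε (uncontrolled F g x))) r +
        ∑ i, x i r * fracInt (1 - κ) (deriv (leftMoll ε (g i))) r := by
  have h1 := marchaud_leftMoll hκ hκ1 hF hε r
  have h2 := fun i => marchaud_leftMoll hκ hκ1 (hg i) hε r
  have h3 := fun i => marchaud_const_mul (x i r) (h2 i).1
  have h4 := marchaud_sum Finset.univ (fun i _ => (h3 i).1)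
  have h5 := marchaud_add h1.1 h4.1
  rw [show mollInc ε (compInc F g x r) = _ from funext (mollInc_compInc hF hg hε r), h5.2, h1.2,
    h4.2]
  congr 1
  exact Finset.sum_congr rfl fun i _ => by rw [(h3 i).2, (h2 i).2]

lemma HolderVanishing.measurable_rightMarchaud {κ a b β C : ℝ} {f : ℝ → ℝ}
    (hf : HolderVanishing a b β C f) : Measurable (rightMarchaud κ f) := by
  have := hf.measurable
  refine measurable_marchaud (φ := fun r v => f r - f (r + v)) ?_
  change Measurable fun z : ℝ × ℝ => f z.1 - f (z.1 + z.2)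
  fun_prop

lemma HolderVanishing.abs_rightMarchaud_le {κ a b β C : ℝ} {f : ℝ → ℝ}
    (hf : HolderVanishing a b β C f) (hκ : 0 < κ) (hκ1 : κ < 1) (hβ : κ < β) (hab : a < b) {r : ℝ}
    (hr : a ≤ r) : |rightMarchaud κ f r| ≤ C * marchaudConst κ β * (b - a) ^ (β - κ) :=
  abs_marchaud_le hκ hκ1 hβ (sub_pos.2 hab) fun v hv => hf.holder r v hr hv

lemma integrableOn_Icc_of_bound {a b C : ℝ} {f : ℝ → ℝ} (hf : Measurable f)
    (hC : ∀ t, a ≤ t → t ≤ b → |f t| ≤ C) : IntegrableOn f (Icc a b) := by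
  refine Measure.integrableOn_of_bounded (M := C) (by simp) hf.aestronglyMeasurable ?_
  exact (ae_restrict_iff' measurableSet_Icc).2 (Eventually.of_forall fun t ht => hC t ht.1 ht.2)

/-- By the semigroup property, the right sided derivative of order `κ` cancels one half of a left
sided integral of order `2κ`. -/
lemma fracInt_two_pairing {κ β a b B C : ℝ} (hκ : 0 < κ) (hκ1 : κ < 1) (hβ : κ < β) (hab : a < b)
    {p f : ℝ → ℝ} (hpm : Measurable p) (hB : ∀ t, |p t| ≤ B) (hp : ∀ t, t < a → p t = 0)
    (hf : HolderVanishing a b β C f) :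
    ∫ r in Icc a b, fracInt (κ + κ) p r * rightMarchaud κ f r =
      ∫ r in Icc a b, fracInt κ p r * f r := by
  set P : ℝ → ℝ := (Icc a b).indicator (fracInt κ p)
  have hP : ∀ t, t ≤ b → P t = fracInt κ p t := by
    intro t ht
    simp only [P, indicator, mem_Icc]
    split_ifs with h
    · rfl
    · refine (fracInt_of_le hp ?_).symm
      by_contra h'
      exact h ⟨by linarith, ht⟩
  have hPB : ∀ t, |P t| ≤ B * (1 / Real.Gamma κ * ((b - a) ^ κ / κ)) := by
    intro t
    simp only [P, indicator, mem_Icc]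
    split_ifs with h
    · exact abs_fracInt_le hκ hB hp h.2 hab
    · simpa using (abs_nonneg _).trans (abs_fracInt_le hκ hB hp le_rfl hab)
  have h := fracInt_pairing hκ hκ1 hβ hab ((measurable_fracInt hpm).indicator measurableSet_Icc)
    hPB (fun t ht => indicator_of_notMem (s := Icc a b) (fun h => by linarith [h.1]) _) hf
  have e1 : ∫ r in Icc a b, P r * f r = ∫ r in Icc a b, fracInt κ p r * f r :=
    setIntegral_congr_fun measurableSet_Icc fun r hr => by simp only [hP r hr.2]
  rw [← e1, ← h]
  refine setIntegral_congr_fun measurableSet_Icc fun r hr => ?_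
  congr 1
  rw [← fracInt_fracInt hκ hκ hpm hB hp]
  change 1 / Real.Gamma κ * ∫ v in Ioi (0 : ℝ), fracInt κ p (r - v) * v ^ (κ - 1) =
    1 / Real.Gamma κ * ∫ v in Ioi (0 : ℝ), P (r - v) * v ^ (κ - 1)
  congr 1
  refine setIntegral_congr_fun measurableSet_Ioi fun v hv => ?_
  have hv : 0 < v := hv
  rw [hP (r - v) (by linarith [hr.2])]

/-- For mollified functions the two parts of the rough integral combine, by Chen's relation
`hH`, to an expression that does not depend on the order of the derivatives. -/
lemma mollified_rough_integral_eq {κ β a b B B₀ C M ε : ℝ} (hκ : 0 < κ) (hκ2 : κ < 1 / 2)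
    (hβ : κ < β) (hab : a < b) (hε : 0 < ε) {F y : ℝ → ℝ} {g x ζ H : ι → ℝ → ℝ}
    (hF : BoundedOn a b B₀ (uncontrolled F g x)) (hg : ∀ i, BoundedOn a b B (g i))
    (hxm : ∀ i, Measurable (x i)) (hxb : ∀ i t, |x i t| ≤ M)
    (hy : HolderVanishing a b β C y) (hζ : ∀ i, HolderVanishing a b β C (ζ i))
    (hHv : ∀ i, HolderVanishing a b β C (H i))
    (hH : ∀ i r, a ≤ r → r ≤ b →
      H i r = rightMarchaud κ (ζ i) r + x i r * rightMarchaud κ y r) :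
    (∫ r in Icc a b, marchaud (1 - κ) (mollInc ε (compInc F g x r)) * rightMarchaud κ y r)
      - ∑ i, ∫ r in Icc a b, marchaud (1 - (κ + κ)) (mollInc ε (fun v => g i r - g i (r - v))) *
          rightMarchaud κ (H i) r =
    (∫ r in Icc a b, deriv (leftMoll ε (uncontrolled F g x)) r * y r)
      - ∑ i, ∫ r in Icc a b, deriv (leftMoll ε (g i)) r * ζ i r := by
  have hκ1 : κ < 1 := by linarith
  obtain ⟨B0, hm0, hb0, h00, -, -⟩ :=
    derivative_leftMoll hε hF.measurable hF.bound hF.left hF.right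
  have hd := fun i => derivative_leftMoll hε (hg i).measurable (hg i).bound (hg i).left (hg i).right
  choose Bi hmi hbi h0i _ _ using hd
  have hDy := fun r (hr : a ≤ r) => hy.abs_rightMarchaud_le hκ hκ1 hβ hab hr
  have hDζ := fun i r (hr : a ≤ r) => (hζ i).abs_rightMarchaud_le hκ hκ1 hβ hab hr
  set K := C * marchaudConst κ β * (b - a) ^ (β - κ)
  have hK : 0 ≤ K := (abs_nonneg _).trans (hDy a le_rfl)
  set p0 := deriv (leftMoll ε (uncontrolled F g x))
  set p : ι → ℝ → ℝ := fun i => deriv (leftMoll ε (g i))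
  have hmy : Measurable (rightMarchaud κ y) := hy.measurable_rightMarchaud
  have hmζ := fun i => (hζ i).measurable_rightMarchaud (κ := κ)
  have hmp0 : Measurable (fracInt κ p0) := measurable_fracInt hm0
  have hmp := fun i => measurable_fracInt (x := κ) (hmi i)
  have hbp := fun i r (hr : r ≤ b) => abs_fracInt_le hκ (hbi i) (h0i i) hr hab
  have hbp0 := fun r (hr : r ≤ b) => abs_fracInt_le hκ hb0 h00 hr hab
  have int0 : IntegrableOn (fun r => fracInt κ p0 r * rightMarchaud κ y r) (Icc a b) := by
    refine integrableOn_Icc_of_bound (C := B0 * (1 / Real.Gamma κ * ((b - a) ^ κ / κ)) * K)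
      (by fun_prop) fun r hr hr' => ?_
    rw [abs_mul]
    exact mul_le_mul (hbp0 r hr') (hDy r hr) (abs_nonneg _) ((abs_nonneg _).trans (hbp0 r hr'))
  have inti : ∀ i, IntegrableOn (fun r => x i r * fracInt κ (p i) r * rightMarchaud κ y r)
      (Icc a b) := by
    intro i
    have := hxm i
    have := hmp i
    refine integrableOn_Icc_of_bound (C := M * (Bi i * (1 / Real.Gamma κ * ((b - a) ^ κ / κ))) * K)
      (by fun_prop) fun r hr hr' => ?_
    rw [abs_mul, abs_mul]
    have h1 := hbp i r hr'
    have h2 := hxb i r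
    exact mul_le_mul (mul_le_mul h2 h1 (abs_nonneg _) ((abs_nonneg _).trans h2)) (hDy r hr)
      (abs_nonneg _) (mul_nonneg ((abs_nonneg _).trans h2) ((abs_nonneg _).trans h1))
  have intζ : ∀ i, IntegrableOn (fun r => fracInt κ (p i) r * rightMarchaud κ (ζ i) r)
      (Icc a b) := by
    intro i
    have := hmζ i
    have := hmp i
    refine integrableOn_Icc_of_bound (C := Bi i * (1 / Real.Gamma κ * ((b - a) ^ κ / κ)) * K)
      (by fun_prop) fun r hr hr' => ?_
    rw [abs_mul]
    exact mul_le_mul (hbp i r hr') (hDζ i r hr) (abs_nonneg _) ((abs_nonneg _).trans (hbp i r hr'))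
  -- In both parts the terms with `x i r * fracInt κ (p i) r * rightMarchaud κ y r` appear: in the
  -- first from the compensator, in the second from Chen's relation. They cancel in the difference.
  have e1 : ∫ r in Icc a b, marchaud (1 - κ) (mollInc ε (compInc F g x r)) * rightMarchaud κ y r =
      (∫ r in Icc a b, fracInt κ p0 r * rightMarchaud κ y r) +
        ∑ i, ∫ r in Icc a b, x i r * fracInt κ (p i) r * rightMarchaud κ y r := by
    rw [← integral_finsetSum _ (fun i _ => inti i),
      ← integral_add int0 (integrable_finsetSum _ (fun i _ => inti i))]
    congr 1
    ext r
    rw [marchaud_mollInc_compInc (by linarith) (by linarith) hF hg hε r, add_mul, Finset.sum_mul,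
      sub_sub_cancel]
  have e2 : ∀ i, ∫ r in Icc a b, marchaud (1 - (κ + κ)) (mollInc ε (fun v => g i r - g i (r - v))) *
      rightMarchaud κ (H i) r =
      (∫ r in Icc a b, fracInt κ (p i) r * rightMarchaud κ (ζ i) r) +
        ∫ r in Icc a b, x i r * fracInt κ (p i) r * rightMarchaud κ y r := by
    intro i
    have h1 : ∀ r, marchaud (1 - (κ + κ)) (mollInc ε (fun v => g i r - g i (r - v))) =
        fracInt (κ + κ) (p i) r := by
      intro r
      rw [show mollInc ε (fun v => g i r - g i (r - v)) = _ from
        funext (mollInc_leftInc (hg i) hε r),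
        (marchaud_leftMoll (by linarith) (by linarith) (hg i) hε r).2, sub_sub_cancel]
    simp only [h1]
    rw [fracInt_two_pairing hκ hκ1 hβ hab (hmi i) (hbi i) (h0i i) (hHv i),
      ← integral_add (intζ i) (inti i)]
    refine setIntegral_congr_fun measurableSet_Icc fun r hr => ?_
    rw [hH i r hr.1 hr.2]
    ring
  rw [e1, Finset.sum_congr rfl (fun i _ => e2 i), Finset.sum_add_distrib,
    fracInt_pairing hκ hκ1 hβ hab hm0 hb0 h00 hy,
    Finset.sum_congr rfl (fun i _ => fracInt_pairing hκ hκ1 hβ hab (hmi i) (hbi i) (h0i i) (hζ i))]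
  ring

lemma measurable_compInc {F : ℝ → ℝ} {g x : ι → ℝ → ℝ} (hF : Measurable F)
    (hg : ∀ i, Measurable (g i)) (hx : ∀ i, Measurable (x i)) :
    Measurable (fun z : ℝ × ℝ => compInc F g x z.1 z.2) := by
  unfold compInc
  fun_prop

/-- Convergence of the mollified integrals against a bounded weight. -/
lemma tendsto_integral_marchaud_mollInc {κ a b B K : ℝ} (hκ : 0 < κ) (hκ1 : κ < 1)
    {φ : ℝ → ℝ → ℝ} {w : ℝ → ℝ} (hφ : Measurable (Function.uncurry φ))
    (hB : ∀ r t, |φ r t| ≤ B) (hw : Measurable w) (hK : ∀ r, a ≤ r → r ≤ b → |w r| ≤ K)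
    (hi : ∀ᵐ r ∂(volume.restrict (Icc a b)), MarchaudIntegrable κ (φ r))
    (hI : IntegrableOn (fun r => ∫ t in Ioi (0 : ℝ), |φ r t| / t ^ (κ + 1)) (Icc a b)) :
    IntegrableOn (fun r => marchaud κ (φ r) * w r) (Icc a b) ∧
    Tendsto (fun n : ℕ => ∫ r in Icc a b, marchaud κ (mollInc (1 / ((n : ℝ) + 1)) (φ r)) * w r)
      atTop (𝓝 (∫ r in Icc a b, marchaud κ (φ r) * w r)) := by
  obtain ⟨C, hC0, hC⟩ := exists_marchaud_mollInc_bound hκ hκ1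
  have hm : ∀ r, Measurable (φ r) := fun r => hφ.comp measurable_prodMk_left
  have hw' : ∀ᵐ r ∂(volume.restrict (Icc a b)), |w r| ≤ K :=
    (ae_restrict_iff' measurableSet_Icc).2 (Eventually.of_forall fun r hr => hK r hr.1 hr.2)
  have hmoll : ∀ ε, 0 < ε → Measurable (Function.uncurry fun r => mollInc ε (φ r)) := by
    intro ε hε
    have hmk := measurable_mollKernel ε
    have : StronglyMeasurable (fun z : (ℝ × ℝ) × ℝ =>
        mollKernel ε z.2 * (φ z.1.1 (z.1.2 + z.2) - φ z.1.1 z.2)) := by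
      refine Measurable.stronglyMeasurable ?_
      have h1 : Measurable fun z : (ℝ × ℝ) × ℝ => φ z.1.1 (z.1.2 + z.2) :=
        hφ.comp (f := fun z : (ℝ × ℝ) × ℝ => (z.1.1, z.1.2 + z.2)) (by fun_prop)
      have h2 : Measurable fun z : (ℝ × ℝ) × ℝ => φ z.1.1 z.2 :=
        hφ.comp (f := fun z : (ℝ × ℝ) × ℝ => (z.1.1, z.2)) (by fun_prop)
      fun_prop
    exact (this.integral_prod_right' (ν := volume)).measurable
  have hmm : ∀ n : ℕ, AEStronglyMeasurable
      (fun r => marchaud κ (mollInc (1 / ((n : ℝ) + 1)) (φ r)) * w r)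
      (volume.restrict (Icc a b)) := fun n =>
    ((measurable_marchaud (hmoll _ (by positivity))).mul hw).aestronglyMeasurable
  constructor
  · have hG := Real.Gamma_pos_of_pos (show 0 < 1 - κ by linarith)
    refine Integrable.mono' ((hI.const_mul (κ / Real.Gamma (1 - κ))).mul_const K)
      ((measurable_marchaud hφ).mul hw).aestronglyMeasurable ?_
    filter_upwards [hw'] with r hr
    rw [norm_mul, Real.norm_eq_abs, Real.norm_eq_abs]
    have h1 : |marchaud κ (φ r)| ≤
        κ / Real.Gamma (1 - κ) * ∫ t in Ioi (0 : ℝ), |φ r t| / t ^ (κ + 1) := by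
      unfold marchaud
      rw [abs_mul, abs_of_pos (show 0 < κ / Real.Gamma (1 - κ) by positivity), ← Real.norm_eq_abs]
      refine mul_le_mul_of_nonneg_left ?_ (by positivity)
      refine (norm_integral_le_integral_norm _).trans (le_of_eq ?_)
      refine setIntegral_congr_fun measurableSet_Ioi fun t ht => ?_
      have ht : 0 < t := ht
      rw [norm_div, Real.norm_eq_abs, Real.norm_eq_abs, abs_of_pos (Real.rpow_pos_of_pos ht _)]
    exact mul_le_mul h1 hr (abs_nonneg _) ((abs_nonneg _).trans h1)
  · refine tendsto_integral_of_dominated_convergence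
      (fun r => C * (∫ t in Ioi (0 : ℝ), |φ r t| / t ^ (κ + 1)) * K) hmm
      ((hI.const_mul C).mul_const K) (fun n => ?_) ?_
    · filter_upwards [hw', hi] with r hr hir
      rw [norm_mul, Real.norm_eq_abs, Real.norm_eq_abs]
      have h1 := (hC (φ r) B (hm r) (fun t _ => hB r t) hir).1 (1 / ((n : ℝ) + 1)) (by positivity)
      exact mul_le_mul h1 hr (abs_nonneg _) ((abs_nonneg _).trans h1)
    · filter_upwards [hi] with r hir
      exact ((hC (φ r) B (hm r) (fun t _ => hB r t) hir).2).mul_const _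

end

/-! ### Averages over balls -/

/-- `μ` controls the distributional partial derivatives of `ψ`. Both the variation of a function in
`BV_loc` and, for Lipschitz functions, the measure with the classical derivative as density have this
property, so that averages are estimated for both in the same way. -/
def DerivBound {m : ℕ} (ψ : Euc m → ℝ) (μ : Measure (Euc m)) : Prop :=
  ∀ (i : Fin m) (η : Euc m → ℝ), ContDiff ℝ (⊤ : ℕ∞) η → HasCompactSupport η →
    ‖∫ x, ψ x * partialDeriv i η x‖ₑ ≤ ∫⁻ x, ‖η x‖ₑ ∂μ

lemma IsGradientVariation.derivBound {m : ℕ} {ψ : Euc m → ℝ} {ν : Measure (Euc m)}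
    (h : IsGradientVariation ψ ν) : DerivBound ψ ν := by
  obtain ⟨-, σ, -, hσ, hd⟩ := h
  intro i η hη hηc
  rw [hd i η hη hηc, enorm_neg]
  refine (enorm_integral_le_lintegral_enorm _).trans (lintegral_mono_ae ?_)
  filter_upwards [hσ] with x hx
  rw [enorm_mul]
  have : ‖σ x i‖ₑ ≤ 1 := by
    rw [← ofReal_norm]
    exact ENNReal.ofReal_le_one.2 ((PiLp.norm_apply_le (σ x) i).trans hx.le)
  calc _ ≤ ‖η x‖ₑ * 1 := by gcongr
    _ = _ := mul_one _

lemma LipschitzWith.derivBound {m : ℕ} {f : Euc m → ℝ} {K : ℝ≥0} (hf : LipschitzWith K f) :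
    DerivBound f (volume.withDensity fun x => ∑ i, ‖partialDeriv i f x‖ₑ) := by
  intro i η hη hηc
  obtain ⟨D, hD⟩ := (hη.of_le (m := 1) (by exact_mod_cast le_top)).lipschitzWith_of_hasCompactSupport hηc one_ne_zero
  have h := hf.integral_lineDeriv_mul_eq (μ := volume) hD hηc (EuclideanSpace.single i (1 : ℝ))
  simp only [lineDeriv_neg, neg_mul] at h
  rw [integral_neg] at h
  have e : ∫ x, f x * partialDeriv i η x = -∫ x, partialDeriv i f x * η x := by
    unfold partialDeriv
    rw [h, neg_neg]
    simp only [mul_comm]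
  have hm : ∀ i, Measurable (partialDeriv i f) := fun i => measurable_lineDeriv hf.continuous
  rw [e, enorm_neg, lintegral_withDensity_eq_lintegral_mul _ (by fun_prop)
    hη.continuous.measurable.enorm]
  refine (enorm_integral_le_lintegral_enorm _).trans (lintegral_mono fun x => ?_)
  rw [enorm_mul]
  simp only [Pi.mul_apply]
  gcongr
  exact Finset.single_le_sum (f := fun i => ‖partialDeriv i f x‖ₑ) (fun _ _ => zero_le)
    (Finset.mem_univ i)

section
variable {m : ℕ}

/-- A smooth bump around the origin, of radius `ρ`. For `ρ ≤ 0` the radius has the junk value `1`. -/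
noncomputable def ballBump (m : ℕ) (ρ : ℝ) : ContDiffBump (0 : Euc m) :=
  if h : 0 < ρ then ⟨ρ / 2, ρ, by linarith, by linarith⟩ else ⟨1 / 2, 1, by norm_num, by norm_num⟩

lemma ballBump_rIn {ρ : ℝ} (hρ : 0 < ρ) : (ballBump m ρ).rIn = ρ / 2 := by
  rw [ballBump, dif_pos hρ]

lemma ballBump_rOut {ρ : ℝ} (hρ : 0 < ρ) : (ballBump m ρ).rOut = ρ := by
  rw [ballBump, dif_pos hρ]

/-- A smooth probability density, supported in the ball of radius `ρ` around the origin if `ρ > 0`. -/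
noncomputable def ballKernel (ρ : ℝ) (x : Euc m) : ℝ := (ballBump m ρ).normed volume x

/-- The average of `ψ` around `x` at scale `ρ`. -/
noncomputable def ballAvg (ρ : ℝ) (ψ : Euc m → ℝ) (x : Euc m) : ℝ := ∫ t, ballKernel ρ t * ψ (x - t)

lemma ballKernel_nonneg (ρ : ℝ) (x : Euc m) : 0 ≤ ballKernel ρ x := ContDiffBump.nonneg_normed _ _

lemma contDiff_ballKernel (ρ : ℝ) : ContDiff ℝ (⊤ : ℕ∞) (ballKernel ρ : Euc m → ℝ) :=
  ContDiffBump.contDiff_normed _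

lemma hasCompactSupport_ballKernel (ρ : ℝ) : HasCompactSupport (ballKernel ρ : Euc m → ℝ) :=
  ContDiffBump.hasCompactSupport_normed _

lemma integral_ballKernel (ρ : ℝ) : ∫ x : Euc m, ballKernel ρ x = 1 :=
  ContDiffBump.integral_normed _

lemma integrable_ballKernel (ρ : ℝ) : Integrable (ballKernel ρ : Euc m → ℝ) :=
  (contDiff_ballKernel ρ).continuous.integrable_of_hasCompactSupport
    (hasCompactSupport_ballKernel ρ)

lemma ballKernel_eq_zero {ρ : ℝ} (hρ : 0 < ρ) {x : Euc m} (hx : ρ ≤ ‖x‖) : ballKernel ρ x = 0 := by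
  rw [← Function.notMem_support]
  unfold ballKernel
  rw [ContDiffBump.support_normed_eq, ballBump_rOut hρ, mem_ball_zero_iff]
  exact not_lt.2 hx

/-- The constant in the bound of `ballKernel ρ` by a multiple of `ρ ^ (-m)`. -/
noncomputable def kernelConst (m : ℕ) : ℝ := 2 ^ m / volume.real (Metric.closedBall (0 : Euc m) 1)

lemma volume_real_unit_pos (m : ℕ) : 0 < volume.real (Metric.closedBall (0 : Euc m) 1) :=
  ENNReal.toReal_pos (Metric.measure_closedBall_pos _ _ one_pos).ne' measure_closedBall_lt_top.ne

lemma kernelConst_pos (m : ℕ) : 0 < kernelConst m :=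
  div_pos (by positivity) (volume_real_unit_pos m)

lemma ballKernel_le {ρ : ℝ} (hρ : 0 < ρ) (x : Euc m) :
    ballKernel ρ x ≤ kernelConst m / ρ ^ m := by
  refine ((ballBump m ρ).normed_le_div_measure_closedBall_rIn volume x).trans (le_of_eq ?_)
  rw [ballBump_rIn hρ, Measure.addHaar_real_closedBall' _ _ (by positivity),
    finrank_euclideanSpace_fin, kernelConst]
  have := (volume_real_unit_pos m).ne'
  rw [div_pow]
  field_simp

lemma ballAvg_eq_convolution (ρ : ℝ) (ψ : Euc m → ℝ) :
    ballAvg ρ ψ = convolution (ballKernel ρ) ψ (ContinuousLinearMap.mul ℝ ℝ) volume := rfl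

lemma integrable_ballKernel_mul {ψ : Euc m → ℝ} (hψ : LocallyIntegrable ψ) (ρ : ℝ) (x : Euc m) :
    Integrable fun t => ballKernel ρ t * ψ (x - t) :=
  (hasCompactSupport_ballKernel ρ).convolutionExists_left (ContinuousLinearMap.mul ℝ ℝ)
    (contDiff_ballKernel ρ).continuous hψ x

lemma abs_ballAvg_sub_le {ψ : Euc m → ℝ} (hψ : LocallyIntegrable ψ) {ρ : ℝ} (hρ : 0 < ρ)
    {x : Euc m} {c D : ℝ} (hD : ∀ t, ‖t‖ ≤ ρ → |ψ (x - t) - c| ≤ D) :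
    |ballAvg ρ ψ x - c| ≤ D := by
  have e : ballAvg ρ ψ x - c = ∫ t : Euc m, ballKernel ρ t * (ψ (x - t) - c) := by
    simp only [mul_sub]
    rw [integral_sub (integrable_ballKernel_mul hψ ρ x) ((integrable_ballKernel ρ).mul_const c),
      integral_mul_const, integral_ballKernel, one_mul]
    rfl
  have h : |∫ t : Euc m, ballKernel ρ t * (ψ (x - t) - c)| ≤ ∫ t : Euc m, ballKernel ρ t * D := by
    rw [← Real.norm_eq_abs]
    refine norm_integral_le_of_norm_le ((integrable_ballKernel ρ).mul_const D)
      (Eventually.of_forall fun t => ?_)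
    rw [norm_mul, Real.norm_of_nonneg (ballKernel_nonneg ρ t), Real.norm_eq_abs]
    by_cases ht : ρ ≤ ‖t‖
    · simp [ballKernel_eq_zero hρ ht]
    · exact mul_le_mul_of_nonneg_left (hD t (le_of_not_ge ht)) (ballKernel_nonneg ρ t)
  rw [e]
  rwa [integral_mul_const, integral_ballKernel, one_mul] at h

lemma hasFDerivAt_ballAvg {ψ : Euc m → ℝ} (hψ : LocallyIntegrable ψ) (ρ : ℝ) (x : Euc m) :
    HasFDerivAt (ballAvg ρ ψ) (convolution (fderiv ℝ (ballKernel ρ)) ψ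
      ((ContinuousLinearMap.mul ℝ ℝ).precompL (Euc m)) volume x) x := by
  rw [ballAvg_eq_convolution]
  exact (hasCompactSupport_ballKernel ρ).hasFDerivAt_convolution_left _
    ((contDiff_ballKernel ρ).of_le (by exact_mod_cast le_top)) hψ x

/-- The partial derivatives of the averages of `ψ` are integrals of `ψ` against derivatives of a
test function. -/
lemma fderiv_ballAvg_single {ψ : Euc m → ℝ} (hψ : LocallyIntegrable ψ) (ρ : ℝ) (x : Euc m)
    (i : Fin m) : fderiv ℝ (ballAvg ρ ψ) x (EuclideanSpace.single i (1 : ℝ)) =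
      -∫ z, ψ z * partialDeriv i (fun z => ballKernel ρ (x - z)) z := by
  rw [(hasFDerivAt_ballAvg hψ ρ x).fderiv]
  have hC1 : ContDiff ℝ 1 (ballKernel ρ : Euc m → ℝ) :=
    (contDiff_ballKernel ρ).of_le (by exact_mod_cast le_top)
  have hex : ConvolutionExistsAt (fderiv ℝ (ballKernel ρ : Euc m → ℝ)) ψ x
      ((ContinuousLinearMap.mul ℝ ℝ).precompL (Euc m)) volume :=
    ((hasCompactSupport_ballKernel ρ).fderiv ℝ).convolutionExists_left _
      (hC1.continuous_fderiv one_ne_zero) hψ x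
  rw [convolution_def, ContinuousLinearMap.integral_apply hex, ← integral_neg,
    ← integral_sub_left_eq_self _ volume x]
  congr 1
  ext z
  have hd : ∀ y, DifferentiableAt ℝ (ballKernel ρ : Euc m → ℝ) y := fun y =>
    (hC1.differentiable one_ne_zero) y
  have h1 : partialDeriv i (fun z => ballKernel ρ (x - z)) z =
      -(fderiv ℝ (ballKernel ρ) (x - z) (EuclideanSpace.single i (1 : ℝ))) := by
    unfold partialDeriv
    have h2 : HasFDerivAt (fun z => ballKernel ρ (x - z))
        ((fderiv ℝ (ballKernel ρ) (x - z)).comp (-ContinuousLinearMap.id ℝ (Euc m))) z :=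
      (hd (x - z)).hasFDerivAt.comp z ((hasFDerivAt_id z).const_sub x)
    rw [(h2.hasLineDerivAt _).lineDeriv]
    simp
  rw [h1]
  simp only [sub_sub_cancel]
  change fderiv ℝ (ballKernel ρ) (x - z) (EuclideanSpace.single i (1 : ℝ)) * ψ z = _
  ring

/-- The gradient of an average of `ψ` is the average of the measure `Dψ`, with a kernel of size
`ρ^{-m}`. -/
lemma norm_fderiv_ballAvg_le {ψ : Euc m → ℝ} {μ : Measure (Euc m)} [IsLocallyFiniteMeasure μ]
    (hψ : LocallyIntegrable ψ) (hb : DerivBound ψ μ) {ρ : ℝ} (hρ : 0 < ρ) (x : Euc m) :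
    ‖fderiv ℝ (ballAvg ρ ψ) x‖ ≤
      m * (kernelConst m / ρ ^ m * μ.real (Metric.closedBall x ρ)) := by
  have hK := kernelConst_pos m
  have h1 : ∀ i : Fin m, |fderiv ℝ (ballAvg ρ ψ) x (EuclideanSpace.single i (1 : ℝ))| ≤
      kernelConst m / ρ ^ m * μ.real (Metric.closedBall x ρ) := by
    intro i
    rw [fderiv_ballAvg_single hψ, abs_neg, ← Real.norm_eq_abs]
    have hη : ContDiff ℝ (⊤ : ℕ∞) (fun z => ballKernel ρ (x - z)) :=
      (contDiff_ballKernel ρ).comp (contDiff_const.sub contDiff_id)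
    have hηc : HasCompactSupport (fun z => ballKernel ρ (x - z)) :=
      (hasCompactSupport_ballKernel ρ).comp_homeomorph (Homeomorph.subLeft x)
    have h2 := hb i _ hη hηc
    have h3 : ∫⁻ z, ‖ballKernel ρ (x - z)‖ₑ ∂μ ≤
        ENNReal.ofReal (kernelConst m / ρ ^ m) * μ (Metric.closedBall x ρ) := by
      rw [← lintegral_indicator_const Metric.isClosed_closedBall.measurableSet]
      refine lintegral_mono fun z => ?_
      by_cases hz : z ∈ Metric.closedBall x ρ
      · rw [indicator_of_mem hz, ← ofReal_norm, Real.norm_of_nonneg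
          (ballKernel_nonneg _ _)]
        exact ENNReal.ofReal_le_ofReal (ballKernel_le hρ _)
      · rw [ballKernel_eq_zero hρ]
        · simp
        · rw [Metric.mem_closedBall, dist_comm, dist_eq_norm, not_le] at hz
          exact hz.le
    have hfin : μ (Metric.closedBall x ρ) ≠ ∞ := (isCompact_closedBall x ρ).measure_lt_top.ne
    have h4 := ENNReal.toReal_mono (ENNReal.mul_ne_top ENNReal.ofReal_ne_top hfin) (h2.trans h3)
    rwa [toReal_enorm, ENNReal.toReal_mul, ENNReal.toReal_ofReal (by positivity)] at h4
  refine ContinuousLinearMap.opNorm_le_bound _ (by positivity) fun v => ?_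
  have hv : v = ∑ i, v i • EuclideanSpace.single i (1 : ℝ) := by
    have := (EuclideanSpace.basisFun (Fin m) ℝ).sum_repr v
    simpa using this.symm
  conv_lhs => rw [hv]
  rw [map_sum]
  refine (norm_sum_le _ _).trans ?_
  calc ∑ i, ‖fderiv ℝ (ballAvg ρ ψ) x (v i • EuclideanSpace.single i (1 : ℝ))‖
      ≤ ∑ i : Fin m, ‖v‖ * (kernelConst m / ρ ^ m * μ.real (Metric.closedBall x ρ)) := by
        refine Finset.sum_le_sum fun i _ => ?_
        rw [map_smul, norm_smul, Real.norm_eq_abs (fderiv ℝ _ _ _)]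
        gcongr
        · exact PiLp.norm_apply_le v i
        · exact h1 i
    _ = _ := by
        rw [Finset.sum_const, Finset.card_univ, Fintype.card_fin, nsmul_eq_mul]
        ring

/-- Averages at neighbouring points are close if the derivative has little mass nearby. -/
lemma abs_ballAvg_sub_ballAvg_le {ψ : Euc m → ℝ} {μ : Measure (Euc m)} [IsLocallyFiniteMeasure μ]
    (hψ : LocallyIntegrable ψ) (hb : DerivBound ψ μ) {ρ R : ℝ} (hρ : 0 < ρ) {c x y : Euc m}
    (hx : x ∈ Metric.closedBall c R) (hy : y ∈ Metric.closedBall c R) :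
    |ballAvg ρ ψ y - ballAvg ρ ψ x| ≤
      m * (kernelConst m / ρ ^ m * μ.real (Metric.closedBall c (R + ρ))) * ‖y - x‖ := by
  have hK := kernelConst_pos m
  rw [← Real.norm_eq_abs]
  refine (convex_closedBall c R).norm_image_sub_le_of_norm_fderiv_le (𝕜 := ℝ)
    (fun z _ => (hasFDerivAt_ballAvg hψ ρ z).differentiableAt) (fun z hz => ?_) hx hy
  refine (norm_fderiv_ballAvg_le hψ hb hρ z).trans ?_
  gcongr
  · exact (isCompact_closedBall _ _).measure_lt_top.ne
  · rw [Metric.mem_closedBall] at hz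
    exact Metric.closedBall_subset_closedBall' (by linarith)

lemma continuous_ballAvg {ψ : Euc m → ℝ} (hψ : LocallyIntegrable ψ) (ρ : ℝ) :
    Continuous (ballAvg ρ ψ) :=
  continuous_iff_continuousAt.2 fun x => (hasFDerivAt_ballAvg hψ ρ x).continuousAt

lemma ballAvg_comm {ψ : Euc m → ℝ} (hψ : LocallyIntegrable ψ) (ρ ρ' : ℝ) (x : Euc m) :
    ballAvg ρ (ballAvg ρ' ψ) x = ballAvg ρ' (ballAvg ρ ψ) x := by
  have hψn : LocallyIntegrable fun x => ‖ψ x‖ := fun y => by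
    obtain ⟨s, hs, hi⟩ := hψ y
    exact ⟨s, hs, hi.norm⟩
  have key : ∀ ρ ρ' : ℝ, ballAvg ρ (ballAvg ρ' ψ) x =
      convolution (convolution (ballKernel ρ) (ballKernel ρ') (ContinuousLinearMap.mul ℝ ℝ) volume)
        ψ (ContinuousLinearMap.mul ℝ ℝ) volume x := by
    intro ρ ρ'
    have hc := fun ρ => (contDiff_ballKernel (m := m) ρ).continuous
    have hk := fun ρ => hasCompactSupport_ballKernel (m := m) ρ
    have hn : ∀ ρ, (fun x : Euc m => ‖ballKernel ρ x‖) = ballKernel ρ := fun ρ =>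
      funext fun x => Real.norm_of_nonneg (ballKernel_nonneg ρ x)
    rw [ballAvg_eq_convolution, ballAvg_eq_convolution]
    refine (convolution_assoc _ _ _ _ (fun a b c => by simp [mul_assoc])
      (hc ρ).aestronglyMeasurable (hc ρ').aestronglyMeasurable hψ.aestronglyMeasurable
      (Eventually.of_forall fun y => (hk ρ).convolutionExists_left _ (hc ρ)
        (hc ρ').locallyIntegrable y) (Eventually.of_forall fun y => ?_) ?_).symm
    · rw [hn]
      exact (hk ρ').convolutionExists_left _ (hc ρ') hψn y
    · rw [hn, hn]
      exact (hk ρ).convolutionExists_left _ (hc ρ)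
        (continuous_ballAvg hψn ρ').locallyIntegrable x
  rw [key, key]
  congr 1
  rw [← convolution_flip]
  congr 1
  ext
  simp

/-- Averages at comparable scales are close: both are close to the iterated average. -/
lemma abs_ballAvg_scale_le {ψ : Euc m → ℝ} {μ : Measure (Euc m)} [IsLocallyFiniteMeasure μ]
    (hψ : LocallyIntegrable ψ) (hb : DerivBound ψ μ) {ρ ρ' : ℝ} (hρ' : 0 < ρ') (h1 : ρ' ≤ ρ)
    (h2 : ρ ≤ 2 * ρ') (x : Euc m) :
    |ballAvg ρ' ψ x - ballAvg ρ ψ x| ≤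
      2 ^ (m + 1) * m * kernelConst m * (ρ / ρ ^ m * μ.real (Metric.closedBall x (2 * ρ))) := by
  have hK := kernelConst_pos m
  have hρ : 0 < ρ := hρ'.trans_le h1
  have hbd : ∀ r r', 0 < r → 0 < r' → r ≤ ρ → r' ≤ ρ → ρ ≤ 2 * r →
      |ballAvg r' (ballAvg r ψ) x - ballAvg r ψ x| ≤
      2 ^ m * m * kernelConst m * (ρ / ρ ^ m * μ.real (Metric.closedBall x (2 * ρ))) := by
    intro r r' hr hr' hrρ hr'ρ hρr
    refine abs_ballAvg_sub_le (continuous_ballAvg hψ r).locallyIntegrable hr' fun t ht => ?_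
    have hxx : x ∈ Metric.closedBall x ρ := Metric.mem_closedBall_self hρ.le
    have hxt : x - t ∈ Metric.closedBall x ρ := by
      simpa [Metric.mem_closedBall, dist_eq_norm] using ht.trans hr'ρ
    refine (abs_ballAvg_sub_ballAvg_le hψ hb hr hxx hxt).trans ?_
    have h3 : 1 / r ^ m ≤ 2 ^ m / ρ ^ m := by
      rw [div_le_div_iff₀ (by positivity) (by positivity), one_mul, ← mul_pow]
      gcongr
    have h4 : μ.real (Metric.closedBall x (ρ + r)) ≤ μ.real (Metric.closedBall x (2 * ρ)) :=
      measureReal_mono (Metric.closedBall_subset_closedBall (by linarith))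
        (isCompact_closedBall _ _).measure_lt_top.ne
    have h5 : ‖x - t - x‖ ≤ ρ := by
      simpa using ht.trans hr'ρ
    calc m * (kernelConst m / r ^ m * μ.real (Metric.closedBall x (ρ + r))) * ‖x - t - x‖
        = m * (kernelConst m * (1 / r ^ m) * μ.real (Metric.closedBall x (ρ + r))) *
          ‖x - t - x‖ := by rw [mul_one_div]
      _ ≤ m * (kernelConst m * (2 ^ m / ρ ^ m) * μ.real (Metric.closedBall x (2 * ρ))) * ρ := by
          gcongr
      _ = _ := by ring
  have a1 := hbd ρ ρ' hρ hρ' le_rfl h1 (by linarith)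
  have a2 := hbd ρ' ρ hρ' hρ h1 le_rfl h2
  rw [ballAvg_comm hψ] at a2
  rw [abs_sub_comm] at a2
  calc _ ≤ |ballAvg ρ' ψ x - ballAvg ρ' (ballAvg ρ ψ) x| +
      |ballAvg ρ' (ballAvg ρ ψ) x - ballAvg ρ ψ x| := abs_sub_le _ _ _
    _ ≤ _ := add_le_add a2 a1
    _ = _ := by ring

end

/-! ### Riesz potentials and Lebesgue values -/

section
variable {m : ℕ}

lemma ENNReal.rpow_le_rpow_of_nonpos {x y : ℝ≥0∞} {p : ℝ} (h : x ≤ y) (hp : p ≤ 0) :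
    y ^ p ≤ x ^ p := by
  have e : ∀ z : ℝ≥0∞, z ^ p = (z ^ (-p))⁻¹ := fun z => by rw [← ENNReal.rpow_neg, neg_neg]
  rw [e, e]
  exact ENNReal.inv_le_inv.2 (ENNReal.rpow_le_rpow h (neg_nonneg.2 hp))

/-- A finite Riesz potential at the centre bounds the mass of balls. -/
lemma measure_closedBall_le_rieszPotential {s : ℝ} (hm : 1 ≤ m) (hs : 0 < s)
    (ν : Measure (Euc m)) {x : Euc m} (hU : rieszPotential (1 - s) ν x ≠ ∞) {r : ℝ} (hr : 0 < r) :
    ν.real (Metric.closedBall x r) ≤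
      r ^ ((m : ℝ) - 1 + s) * (rieszPotential (1 - s) ν x).toReal := by
  have hm' : (1 : ℝ) ≤ m := by exact_mod_cast hm
  have h1 : ENNReal.ofReal (r ^ (1 - s - (m : ℝ))) * ν (Metric.closedBall x r) ≤
      rieszPotential (1 - s) ν x := by
    rw [← setLIntegral_const]
    refine (setLIntegral_mono' Metric.isClosed_closedBall.measurableSet fun z hz => ?_).trans
      (setLIntegral_le_lintegral _ _)
    rw [← ENNReal.ofReal_rpow_of_pos hr]
    refine ENNReal.rpow_le_rpow_of_nonpos ?_ (by linarith)
    rw [edist_comm, edist_dist]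
    exact ENNReal.ofReal_le_ofReal hz
  have h2 := ENNReal.toReal_mono hU h1
  rw [ENNReal.toReal_mul, ENNReal.toReal_ofReal (by positivity)] at h2
  have h3 : r ^ ((m : ℝ) - 1 + s) * r ^ (1 - s - (m : ℝ)) = 1 := by
    rw [← Real.rpow_add hr, show (m : ℝ) - 1 + s + (1 - s - m) = 0 by ring, Real.rpow_zero]
  calc ν.real (Metric.closedBall x r)
      = r ^ ((m : ℝ) - 1 + s) * (r ^ (1 - s - (m : ℝ)) * ν.real (Metric.closedBall x r)) := by
        rw [← mul_assoc, h3, one_mul]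
    _ ≤ _ := by gcongr; exact h2

/-- The scale-invariant form of `measure_closedBall_le_rieszPotential`. -/
lemma scaled_measure_closedBall_le {s : ℝ} (hm : 1 ≤ m) (hs : 0 < s)
    (ν : Measure (Euc m)) {x : Euc m} (hU : rieszPotential (1 - s) ν x ≠ ∞) {r A : ℝ} (hr : 0 < r)
    (hA : 0 < A) :
    r / r ^ m * ν.real (Metric.closedBall x (A * r)) ≤
      A ^ ((m : ℝ) - 1 + s) * (r ^ s * (rieszPotential (1 - s) ν x).toReal) := by
  have h1 := measure_closedBall_le_rieszPotential hm hs ν hU (mul_pos hA hr)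
  have h2 : r / r ^ m * (A * r) ^ ((m : ℝ) - 1 + s) = A ^ ((m : ℝ) - 1 + s) * r ^ s := by
    rw [Real.mul_rpow hA.le hr.le, ← Real.rpow_natCast]
    have : r ^ ((m : ℝ) - 1 + s) = r ^ (m : ℝ) * r ^ s / r := by
      rw [← Real.rpow_add hr, eq_div_iff hr.ne', ← Real.rpow_add_one hr.ne']
      ring_nf
    rw [this]
    have := (Real.rpow_pos_of_pos hr m).ne'
    field_simp
  calc _ ≤ r / r ^ m * ((A * r) ^ ((m : ℝ) - 1 + s) * (rieszPotential (1 - s) ν x).toReal) := by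
        gcongr
    _ = _ := by rw [← mul_assoc, h2, mul_assoc]

/-- The constant in the comparison of averages at different scales. -/
noncomputable def scaleConst (m : ℕ) (s : ℝ) : ℝ :=
  2 ^ (m + 1) * m * kernelConst m * 2 ^ ((m : ℝ) - 1 + s) / (1 - 2⁻¹ ^ s)

lemma half_rpow_lt_one {s : ℝ} (hs : 0 < s) : (2⁻¹ : ℝ) ^ s < 1 :=
  Real.rpow_lt_one (by norm_num) (by norm_num) hs

lemma scaleConst_nonneg (m : ℕ) {s : ℝ} (hs : 0 < s) : 0 ≤ scaleConst m s := by
  have := kernelConst_pos m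
  have := half_rpow_lt_one hs
  exact div_nonneg (by positivity) (by linarith)

/-- A geometric sum over dyadic scales, dominated by the largest scale. -/
lemma abs_ballAvg_sub_ballAvg_scale_le {ψ : Euc m → ℝ} {ν : Measure (Euc m)}
    [IsLocallyFiniteMeasure ν] (hm : 1 ≤ m) {s : ℝ} (hs : 0 < s) (hψ : LocallyIntegrable ψ)
    (hb : DerivBound ψ ν) {x : Euc m} (hU : rieszPotential (1 - s) ν x ≠ ∞) {ρ' ρ : ℝ}
    (hρ' : 0 < ρ') (h : ρ' ≤ ρ) :
    |ballAvg ρ' ψ x - ballAvg ρ ψ x| ≤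
      scaleConst m s * (ρ ^ s * (rieszPotential (1 - s) ν x).toReal) := by
  obtain ⟨n, hn⟩ : ∃ n : ℕ, ρ ≤ 2 ^ n * ρ' := by
    obtain ⟨n, hn⟩ := pow_unbounded_of_one_lt (ρ / ρ') one_lt_two
    exact ⟨n, ((div_lt_iff₀ hρ').1 hn).le⟩
  have hK := kernelConst_pos m
  have hs2 := half_rpow_lt_one hs
  have hU0 : 0 ≤ (rieszPotential (1 - s) ν x).toReal := ENNReal.toReal_nonneg
  have hD := scaleConst_nonneg m hs
  -- the mass bound for two scales with ratio at most two
  have hstep : ∀ ρ ρ' : ℝ, 0 < ρ' → ρ' ≤ ρ → ρ ≤ 2 * ρ' → |ballAvg ρ' ψ x - ballAvg ρ ψ x| ≤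
      scaleConst m s * (1 - 2⁻¹ ^ s) * (ρ ^ s * (rieszPotential (1 - s) ν x).toReal) := by
    intro ρ ρ' hρ' h1 h2
    refine (abs_ballAvg_scale_le hψ hb hρ' h1 h2 x).trans ?_
    have h3 := scaled_measure_closedBall_le hm hs ν hU (hρ'.trans_le h1) two_pos
    rw [scaleConst, div_mul_cancel₀ _ (by linarith)]
    calc _ ≤ 2 ^ (m + 1) * m * kernelConst m *
        (2 ^ ((m : ℝ) - 1 + s) * (ρ ^ s * (rieszPotential (1 - s) ν x).toReal)) := by gcongr
      _ = _ := by ring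
  -- The factor `1 - 2⁻¹ ^ s` of the bound for one step is what the induction step needs:
  -- `2⁻¹ ^ s + (1 - 2⁻¹ ^ s) = 1`.
  induction n generalizing ρ with
  | zero =>
    have : ρ = ρ' := le_antisymm (by simpa using hn) h
    subst this
    rw [sub_self, abs_zero]
    positivity
  | succ n ih =>
    have hρ : 0 < ρ := hρ'.trans_le h
    rcases le_or_gt ρ (2 * ρ') with h2 | h2
    · refine (hstep ρ ρ' hρ' h h2).trans ?_
      have : 0 ≤ ρ ^ s * (rieszPotential (1 - s) ν x).toReal := by positivity
      have h4 : (0 : ℝ) ≤ 2⁻¹ ^ s := by positivity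
      nlinarith [mul_nonneg (mul_nonneg hD h4) this]
    · have h3 := ih (ρ := ρ * 2⁻¹) (by linarith) (by rw [pow_succ] at hn; linarith)
      have h4 := hstep ρ (ρ * 2⁻¹) (by positivity) (by linarith) (by linarith)
      rw [Real.mul_rpow hρ.le (by norm_num)] at h3
      calc _ ≤ |ballAvg ρ' ψ x - ballAvg (ρ * 2⁻¹) ψ x| +
          |ballAvg (ρ * 2⁻¹) ψ x - ballAvg ρ ψ x| := abs_sub_le _ _ _
        _ ≤ _ := add_le_add h3 h4
        _ = _ := by ring

/-- Where the Riesz potential of the derivative is finite, the averages converge, with a rate. -/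
lemma exists_limit_ballAvg {ψ : Euc m → ℝ} {ν : Measure (Euc m)}
    [IsLocallyFiniteMeasure ν] (hm : 1 ≤ m) {s : ℝ} (hs : 0 < s) (hψ : LocallyIntegrable ψ)
    (hb : DerivBound ψ ν) {x : Euc m} (hU : rieszPotential (1 - s) ν x ≠ ∞) :
    ∃ l : ℝ, ∀ ρ, 0 < ρ → |ballAvg ρ ψ x - l| ≤
      scaleConst m s * (ρ ^ s * (rieszPotential (1 - s) ν x).toReal) := by
  have hpos : ∀ n : ℕ, (0 : ℝ) < 1 / ((n : ℝ) + 1) := fun n => Nat.one_div_pos_of_nat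
  have ht0 : Tendsto (fun n : ℕ => 1 / ((n : ℝ) + 1)) atTop (𝓝 0) :=
    tendsto_one_div_add_atTop_nhds_zero_nat
  have ht : Tendsto (fun n : ℕ => scaleConst m s * ((1 / ((n : ℝ) + 1)) ^ s *
      (rieszPotential (1 - s) ν x).toReal)) atTop (𝓝 0) := by
    have := ((ht0.rpow_const (p := s) (Or.inr hs.le)).mul_const
      (rieszPotential (1 - s) ν x).toReal).const_mul (scaleConst m s)
    simpa [Real.zero_rpow hs.ne'] using this
  have hc : CauchySeq fun n : ℕ => ballAvg (1 / ((n : ℝ) + 1)) ψ x := by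
    refine cauchySeq_of_le_tendsto_0' _ (fun N n hNn => ?_) ht
    rw [dist_comm, Real.dist_eq]
    exact abs_ballAvg_sub_ballAvg_scale_le hm hs hψ hb hU (hpos n)
      (one_div_le_one_div_of_le (by positivity) (by gcongr))
  obtain ⟨l, hl⟩ := cauchySeq_tendsto_of_complete hc
  refine ⟨l, fun ρ hρ => ?_⟩
  refine le_of_tendsto ((hl.const_sub (ballAvg ρ ψ x)).abs) ?_
  filter_upwards [ht0.eventually (gt_mem_nhds hρ)] with n hn
  rw [abs_sub_comm]
  exact abs_ballAvg_sub_ballAvg_scale_le hm hs hψ hb hU (hpos n) hn.le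

/-- Limits of averages are Hölder continuous of order `s` up to the Riesz potentials. -/
lemma abs_limit_sub_limit_le {ψ : Euc m → ℝ} {ν : Measure (Euc m)}
    [IsLocallyFiniteMeasure ν] (hm : 1 ≤ m) {s : ℝ} (hs : 0 < s) (hψ : LocallyIntegrable ψ)
    (hb : DerivBound ψ ν) {x y : Euc m} (hUx : rieszPotential (1 - s) ν x ≠ ∞) {l l' : ℝ}
    (hx : ∀ ρ, 0 < ρ → |ballAvg ρ ψ x - l| ≤
      scaleConst m s * (ρ ^ s * (rieszPotential (1 - s) ν x).toReal))
    (hy : ∀ ρ, 0 < ρ → |ballAvg ρ ψ y - l'| ≤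
      scaleConst m s * (ρ ^ s * (rieszPotential (1 - s) ν y).toReal)) (hxy : x ≠ y) :
    |l - l'| ≤ 2 * scaleConst m s * (‖y - x‖ ^ s *
      ((rieszPotential (1 - s) ν x).toReal + (rieszPotential (1 - s) ν y).toReal)) := by
  have hK := kernelConst_pos m
  have hD := scaleConst_nonneg m hs
  obtain ⟨ρ, hρ⟩ : ∃ ρ, ρ = ‖y - x‖ := ⟨_, rfl⟩
  have hρ0 : 0 < ρ := hρ ▸ norm_pos_iff.2 (sub_ne_zero.2 hxy.symm)
  have hUx0 : 0 ≤ (rieszPotential (1 - s) ν x).toReal := ENNReal.toReal_nonneg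
  have hUy0 : 0 ≤ (rieszPotential (1 - s) ν y).toReal := ENNReal.toReal_nonneg
  have h1 : |ballAvg ρ ψ y - ballAvg ρ ψ x| ≤
      scaleConst m s * (ρ ^ s * (rieszPotential (1 - s) ν x).toReal) := by
    refine (abs_ballAvg_sub_ballAvg_le hψ hb hρ0 (Metric.mem_closedBall_self hρ0.le)
      (by rw [mem_closedBall_iff_norm, hρ])).trans ?_
    rw [← hρ, ← two_mul]
    have h3 := scaled_measure_closedBall_le hm hs ν hUx hρ0 two_pos
    have h4 : (m : ℝ) * kernelConst m * 2 ^ ((m : ℝ) - 1 + s) ≤ scaleConst m s := by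
      have hs2 := half_rpow_lt_one hs
      have hs3 : (0 : ℝ) ≤ 2⁻¹ ^ s := by positivity
      rw [scaleConst, le_div_iff₀ (by linarith)]
      have h5 : 0 ≤ (m : ℝ) * kernelConst m * 2 ^ ((m : ℝ) - 1 + s) := by positivity
      have h6 : (1 : ℝ) ≤ 2 ^ (m + 1) := one_le_pow₀ one_le_two
      calc _ ≤ (m : ℝ) * kernelConst m * 2 ^ ((m : ℝ) - 1 + s) * 1 := by gcongr; linarith
        _ ≤ (m : ℝ) * kernelConst m * 2 ^ ((m : ℝ) - 1 + s) * 2 ^ (m + 1) := by gcongr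
        _ = _ := by ring
    calc m * (kernelConst m / ρ ^ m * ν.real (Metric.closedBall x (2 * ρ))) * ρ
        = m * kernelConst m * (ρ / ρ ^ m * ν.real (Metric.closedBall x (2 * ρ))) := by ring
      _ ≤ m * kernelConst m * (2 ^ ((m : ℝ) - 1 + s) *
          (ρ ^ s * (rieszPotential (1 - s) ν x).toReal)) := by gcongr
      _ = m * kernelConst m * 2 ^ ((m : ℝ) - 1 + s) *
          (ρ ^ s * (rieszPotential (1 - s) ν x).toReal) := by ring
      _ ≤ _ := by gcongr
  rw [← hρ]
  have hA : 0 ≤ scaleConst m s * (ρ ^ s * (rieszPotential (1 - s) ν y).toReal) := by positivity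
  have h2 := hx ρ hρ0
  have h3 := hy ρ hρ0
  rw [abs_le] at h1 h2 h3 ⊢
  constructor <;> nlinarith

/-- By Fubini's theorem, the mass of balls around moving centres is on average the volume of the ball
times the total mass. -/
lemma lintegral_measure_closedBall_le (ν : Measure (Euc m)) [IsLocallyFiniteMeasure ν]
    (x : Euc m) (ρ r : ℝ) :
    ∫⁻ y in Metric.ball x ρ, ν (Metric.closedBall y r) ≤
      volume (Metric.closedBall (0 : Euc m) r) * ν (Metric.closedBall x (ρ + r)) := by
  have hS : MeasurableSet {p : Euc m × Euc m | dist p.2 p.1 ≤ r} :=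
    (isClosed_le (by fun_prop) continuous_const).measurableSet
  have e : ∀ y, ν (Metric.closedBall y r) =
      ∫⁻ z, {p : Euc m × Euc m | dist p.2 p.1 ≤ r}.indicator 1 (y, z) ∂ν := by
    intro y
    rw [← lintegral_indicator_one Metric.isClosed_closedBall.measurableSet]
    rfl
  simp_rw [e]
  rw [lintegral_lintegral_swap
    (f := fun y z => {p : Euc m × Euc m | dist p.2 p.1 ≤ r}.indicator 1 (y, z))
    (measurable_one.indicator hS).aemeasurable,
    ← setLIntegral_const, ← lintegral_indicator Metric.isClosed_closedBall.measurableSet]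
  refine lintegral_mono fun z => ?_
  by_cases hz : z ∈ Metric.closedBall x (ρ + r)
  · rw [indicator_of_mem hz, ← Measure.addHaar_closedBall_center volume z r,
      ← lintegral_indicator_one Metric.isClosed_closedBall.measurableSet]
    refine (setLIntegral_le_lintegral _ _).trans (lintegral_mono fun y => le_of_eq ?_)
    simp only [indicator, mem_ofPred_eq, Metric.mem_closedBall, dist_comm, Pi.one_apply]
  · rw [indicator_of_notMem hz, ← lintegral_zero (μ := volume.restrict (Metric.ball x ρ))]
    refine setLIntegral_mono' Metric.isOpen_ball.measurableSet fun y hy =>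
      (indicator_of_notMem (fun h => hz ?_) _).le
    rw [Metric.mem_closedBall]
    have h1 : dist z y ≤ r := h
    have h2 : dist y x < ρ := hy
    linarith [dist_triangle z y x]

lemma ae_tendsto_ballAvg {ψ : Euc m → ℝ} (hψ : LocallyIntegrable ψ) {ρ : ℝ} (hρ : 0 < ρ) :
    ∀ᵐ y, Tendsto (fun k : ℕ => ballAvg (ρ * 2⁻¹ ^ k) ψ y) atTop (𝓝 (ψ y)) := by
  have hp : ∀ k : ℕ, 0 < ρ * 2⁻¹ ^ k := fun k => by positivity
  refine ContDiffBump.ae_convolution_tendsto_right_of_locallyIntegrable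
    (φ := fun k : ℕ => ballBump m (ρ * 2⁻¹ ^ k)) (K := 2) ?_ ?_ hψ
  · simp only [ballBump_rOut (hp _)]
    simpa using (tendsto_pow_atTop_nhds_zero_of_lt_one (r := (2⁻¹ : ℝ)) (by norm_num)
      (by norm_num)).const_mul ρ
  · refine Eventually.of_forall fun k => le_of_eq ?_
    rw [ballBump_rOut (hp k), ballBump_rIn (hp k)]
    ring

/-- On a ball, the distance in `L¹` of `ψ` to its averages is controlled by the mass of the
derivative. -/
lemma lintegral_edist_ballAvg_le {ψ : Euc m → ℝ} {ν : Measure (Euc m)}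
    [IsLocallyFiniteMeasure ν] (hψ : LocallyIntegrable ψ) (hb : DerivBound ψ ν) {ρ : ℝ}
    (hρ : 0 < ρ) (x : Euc m) :
    ∫⁻ y in Metric.ball x ρ, edist (ballAvg ρ ψ y) (ψ y) ≤
      ENNReal.ofReal (2 ^ (m + 2) * m * kernelConst m * 2 ^ m *
        volume.real (Metric.closedBall (0 : Euc m) 1) * ρ) * ν (Metric.closedBall x (3 * ρ)) := by
  have hK := kernelConst_pos m
  have hV := volume_real_unit_pos m
  have hc := fun k : ℕ => continuous_ballAvg hψ (ρ * 2⁻¹ ^ k)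
  -- One step at scale `r = ρ / 2^k` costs `r / r^m` times the mass of a ball of radius `2r` around `y`;
  -- integrating over `y` gives the volume `r^m` back, and the factor `r` makes the sum converge.
  have hk : ∀ k : ℕ, ∫⁻ y in Metric.ball x ρ,
      edist (ballAvg (ρ * 2⁻¹ ^ k) ψ y) (ballAvg (ρ * 2⁻¹ ^ (k + 1)) ψ y) ≤
      ENNReal.ofReal (2 ^ (m + 1) * m * kernelConst m * 2 ^ m *
        volume.real (Metric.closedBall (0 : Euc m) 1) * ρ * 2⁻¹ ^ k) *
        ν (Metric.closedBall x (3 * ρ)) := by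
    intro k
    obtain ⟨r, hr⟩ : ∃ r, r = ρ * 2⁻¹ ^ k := ⟨_, rfl⟩
    have hr0 : 0 < r := by rw [hr]; positivity
    have hrρ : r ≤ ρ := by
      rw [hr]
      exact mul_le_of_le_one_right hρ.le (pow_le_one₀ (by norm_num) (by norm_num))
    have e1 : ρ * 2⁻¹ ^ (k + 1) = r * 2⁻¹ := by rw [hr, pow_succ]; ring
    have e2 : 2 ^ (m + 1) * m * kernelConst m * 2 ^ m *
        volume.real (Metric.closedBall (0 : Euc m) 1) * ρ * 2⁻¹ ^ k =
        2 ^ (m + 1) * m * kernelConst m * (r / r ^ m) *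
        volume.real (Metric.closedBall (0 : Euc m) (2 * r)) := by
      rw [Measure.addHaar_real_closedBall' volume (0 : Euc m) (by positivity : 0 ≤ 2 * r),
        finrank_euclideanSpace_fin, mul_pow]
      have : r ^ m ≠ 0 := by positivity
      field_simp
      rw [hr]
      ring
    rw [e1, ← hr, e2]
    have h1 : ∀ y, edist (ballAvg r ψ y) (ballAvg (r * 2⁻¹) ψ y) ≤
        ENNReal.ofReal (2 ^ (m + 1) * m * kernelConst m * (r / r ^ m)) *
          ν (Metric.closedBall y (2 * r)) := by
      intro y
      have h := abs_ballAvg_scale_le hψ hb (ρ := r) (ρ' := r * 2⁻¹) (by positivity) (by linarith)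
        (by linarith) y
      have hfin : ν (Metric.closedBall y (2 * r)) ≠ ∞ := (isCompact_closedBall _ _).measure_lt_top.ne
      rw [edist_comm, edist_dist, Real.dist_eq, ← ENNReal.ofReal_toReal hfin,
        ← ENNReal.ofReal_mul (by positivity)]
      exact ENNReal.ofReal_le_ofReal (h.trans_eq (by rw [← mul_assoc]; rfl))
    refine (lintegral_mono h1).trans ?_
    rw [lintegral_const_mul' _ _ ENNReal.ofReal_ne_top, ENNReal.ofReal_mul (p := 2 ^ (m + 1) * m * kernelConst m * (r / r ^ m)) (by positivity),
      mul_assoc (ENNReal.ofReal _)]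
    refine mul_le_mul' le_rfl ?_
    refine (lintegral_measure_closedBall_le ν x ρ (2 * r)).trans ?_
    rw [ofReal_measureReal measure_closedBall_lt_top.ne]
    gcongr
    linarith
  calc ∫⁻ y in Metric.ball x ρ, edist (ballAvg ρ ψ y) (ψ y)
      ≤ ∫⁻ y in Metric.ball x ρ, ∑' k : ℕ,
        edist (ballAvg (ρ * 2⁻¹ ^ k) ψ y) (ballAvg (ρ * 2⁻¹ ^ (k + 1)) ψ y) := by
        refine lintegral_mono_ae (ae_restrict_of_ae ?_)
        filter_upwards [ae_tendsto_ballAvg hψ hρ] with y hy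
        have := edist_le_tsum_of_edist_le_of_tendsto₀ _ (fun k => le_rfl) hy
        simpa using this
    _ = ∑' k : ℕ, ∫⁻ y in Metric.ball x ρ,
        edist (ballAvg (ρ * 2⁻¹ ^ k) ψ y) (ballAvg (ρ * 2⁻¹ ^ (k + 1)) ψ y) :=
        lintegral_tsum fun k => ((hc k).edist (hc (k + 1))).aemeasurable
    _ ≤ ∑' k : ℕ, ENNReal.ofReal (2 ^ (m + 1) * m * kernelConst m * 2 ^ m *
        volume.real (Metric.closedBall (0 : Euc m) 1) * ρ * 2⁻¹ ^ k) *
        ν (Metric.closedBall x (3 * ρ)) := ENNReal.tsum_le_tsum hk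
    _ = _ := by
        rw [ENNReal.tsum_mul_right, ← ENNReal.ofReal_tsum_of_nonneg (fun k => by positivity)
          (Summable.mul_left _ (summable_geometric_of_lt_one (by norm_num) (by norm_num))),
          tsum_mul_left, tsum_geometric_of_lt_one (by norm_num) (by norm_num)]
        congr 2
        norm_num
        ring

/-- The limit of the averages is a Lebesgue value. -/
lemma hasLebesgueValue_of_ballAvg {ψ : Euc m → ℝ} {ν : Measure (Euc m)}
    [IsLocallyFiniteMeasure ν] (hm : 1 ≤ m) {s : ℝ} (hs : 0 < s) (hψ : LocallyIntegrable ψ)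
    (hb : DerivBound ψ ν) {x : Euc m} (hU : rieszPotential (1 - s) ν x ≠ ∞) {l : ℝ}
    (hl : ∀ ρ, 0 < ρ → |ballAvg ρ ψ x - l| ≤
      scaleConst m s * (ρ ^ s * (rieszPotential (1 - s) ν x).toReal)) :
    HasLebesgueValue ψ x l := by
  have hK := kernelConst_pos m
  have hV := volume_real_unit_pos m
  have hD := scaleConst_nonneg m hs
  obtain ⟨U, hUd⟩ : ∃ U, U = (rieszPotential (1 - s) ν x).toReal := ⟨_, rfl⟩
  have hU0 : 0 ≤ U := hUd ▸ ENNReal.toReal_nonneg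
  -- `ψ - l` is the sum of `ψ - ballAvg ρ ψ`, which is small in the mean over the ball, and of
  -- `ballAvg ρ ψ - l`, which is small at every point of the ball.
  obtain ⟨C, hC⟩ : ∃ C : ℝ, ∀ ρ, 0 < ρ → ⨍ y in Metric.ball x ρ, |ψ y - l| ≤ C * ρ ^ s := by
    obtain ⟨C₁, hC₁⟩ : ∃ C₁, C₁ = 2 ^ (m + 2) * m * kernelConst m * 2 ^ m *
      volume.real (Metric.closedBall (0 : Euc m) 1) := ⟨_, rfl⟩
    have hC₁0 : 0 ≤ C₁ := by rw [hC₁]; positivity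
    refine ⟨C₁ / volume.real (Metric.closedBall (0 : Euc m) 1) * (3 ^ ((m : ℝ) - 1 + s) * U) +
      (m * kernelConst m * (2 ^ ((m : ℝ) - 1 + s) * U) + scaleConst m s * U), fun ρ hρ => ?_⟩
    have hint : IntegrableOn ψ (Metric.ball x ρ) :=
      (hψ.integrableOn_isCompact (isCompact_closedBall x ρ)).mono_set Metric.ball_subset_closedBall
    have hvol : volume.real (Metric.ball x ρ) =
        ρ ^ m * volume.real (Metric.closedBall (0 : Euc m) 1) := by
      have : Nonempty (Fin m) := ⟨⟨0, hm⟩⟩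
      rw [← Measure.addHaar_real_closedBall_eq_addHaar_real_ball,
        Measure.addHaar_real_closedBall' _ _ hρ.le, finrank_euclideanSpace_fin]
    have hA : IntegrableOn (ballAvg ρ ψ) (Metric.ball x ρ) :=
      ((continuous_ballAvg hψ ρ).continuousOn.integrableOn_compact
        (isCompact_closedBall x ρ)).mono_set Metric.ball_subset_closedBall
    have h1 : ∫ y in Metric.ball x ρ, |ballAvg ρ ψ y - ψ y| ≤
        C₁ * ρ * ν.real (Metric.closedBall x (3 * ρ)) := by
      have h := lintegral_edist_ballAvg_le hψ hb hρ x
      rw [← hC₁] at h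
      have hfin : ν (Metric.closedBall x (3 * ρ)) ≠ ∞ := (isCompact_closedBall _ _).measure_lt_top.ne
      have h2 := ENNReal.toReal_mono (ENNReal.mul_ne_top ENNReal.ofReal_ne_top hfin) h
      rw [ENNReal.toReal_mul, ENNReal.toReal_ofReal (by positivity)] at h2
      refine le_trans (le_of_eq ?_) h2
      simp_rw [edist_eq_enorm_sub, ← Real.norm_eq_abs]
      exact integral_norm_eq_lintegral_enorm (hA.sub hint).aestronglyMeasurable
    have h2 : ∀ y ∈ Metric.ball x ρ, |ballAvg ρ ψ y - l| ≤
        (m * kernelConst m * (2 ^ ((m : ℝ) - 1 + s) * U) + scaleConst m s * U) * ρ ^ s := by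
      intro y hy
      have h3 := abs_ballAvg_sub_ballAvg_le hψ hb hρ (Metric.mem_closedBall_self hρ.le)
        (Metric.ball_subset_closedBall hy)
      have h4 : ‖y - x‖ ≤ ρ := (mem_ball_iff_norm.1 hy).le
      have h5 := scaled_measure_closedBall_le hm hs ν hU hρ two_pos
      rw [← hUd] at h5
      have h6 := hl ρ hρ
      rw [← hUd] at h6
      rw [← two_mul] at h3
      calc _ ≤ |ballAvg ρ ψ y - ballAvg ρ ψ x| + |ballAvg ρ ψ x - l| := abs_sub_le _ _ _
        _ ≤ m * (kernelConst m / ρ ^ m * ν.real (Metric.closedBall x (2 * ρ))) * ρ +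
          scaleConst m s * (ρ ^ s * U) := by
            refine add_le_add (h3.trans ?_) h6
            gcongr
        _ = m * kernelConst m * (ρ / ρ ^ m * ν.real (Metric.closedBall x (2 * ρ))) +
          scaleConst m s * (ρ ^ s * U) := by ring
        _ ≤ m * kernelConst m * (2 ^ ((m : ℝ) - 1 + s) * (ρ ^ s * U)) +
          scaleConst m s * (ρ ^ s * U) := by gcongr
        _ = _ := by ring
    obtain ⟨C₂, hC₂⟩ : ∃ C₂, C₂ = m * kernelConst m * (2 ^ ((m : ℝ) - 1 + s) * U) +
      scaleConst m s * U := ⟨_, rfl⟩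
    rw [← hC₂] at h2 ⊢
    have hfinb : volume (Metric.ball x ρ) ≠ ∞ := measure_ball_lt_top.ne
    have hcst : IntegrableOn (fun _ : Euc m => C₂ * ρ ^ s) (Metric.ball x ρ) :=
      integrableOn_const hfinb
    have h3 : ∫ y in Metric.ball x ρ, |ψ y - l| ≤
        C₁ * ρ * ν.real (Metric.closedBall x (3 * ρ)) + volume.real (Metric.ball x ρ) *
          (C₂ * ρ ^ s) := by
      calc ∫ y in Metric.ball x ρ, |ψ y - l|
          ≤ ∫ y in Metric.ball x ρ, (|ballAvg ρ ψ y - ψ y| + C₂ * ρ ^ s) := by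
            refine setIntegral_mono_on (hint.sub (integrableOn_const hfinb)).abs
              ((hA.sub hint).abs.add hcst) Metric.isOpen_ball.measurableSet fun y hy => ?_
            have h := abs_sub_le (ψ y) (ballAvg ρ ψ y) l
            rw [abs_sub_comm (ψ y) (ballAvg ρ ψ y)] at h
            exact h.trans (add_le_add le_rfl (h2 y hy))
        _ = (∫ y in Metric.ball x ρ, |ballAvg ρ ψ y - ψ y|) +
            volume.real (Metric.ball x ρ) * (C₂ * ρ ^ s) := by
            rw [integral_add (f := fun y => |ballAvg ρ ψ y - ψ y|) (hA.sub hint).abs hcst, setIntegral_const, smul_eq_mul]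
        _ ≤ _ := add_le_add h1 le_rfl
    have h5 := scaled_measure_closedBall_le hm hs ν hU hρ three_pos
    rw [← hUd] at h5
    rw [setAverage_eq, smul_eq_mul, hvol]
    rw [hvol] at h3
    have hρm : (0 : ℝ) < ρ ^ m := by positivity
    calc _ ≤ (ρ ^ m * volume.real (Metric.closedBall (0 : Euc m) 1))⁻¹ *
          (C₁ * ρ * ν.real (Metric.closedBall x (3 * ρ)) +
          ρ ^ m * volume.real (Metric.closedBall (0 : Euc m) 1) * (C₂ * ρ ^ s)) := by
          gcongr
      _ = C₁ / volume.real (Metric.closedBall (0 : Euc m) 1) *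
          (ρ / ρ ^ m * ν.real (Metric.closedBall x (3 * ρ))) + C₂ * ρ ^ s := by
          field_simp
      _ ≤ C₁ / volume.real (Metric.closedBall (0 : Euc m) 1) *
          (3 ^ ((m : ℝ) - 1 + s) * (ρ ^ s * U)) + C₂ * ρ ^ s := by gcongr
      _ = _ := by ring
  refine squeeze_zero' (g := fun ρ => C * ρ ^ s) (Eventually.of_forall fun ρ => ?_) ?_ ?_
  · rw [setAverage_eq]
    exact smul_nonneg (by positivity) (integral_nonneg fun y => abs_nonneg _)
  · filter_upwards [self_mem_nhdsWithin] with ρ hρ using hC ρ hρ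
  · have : Tendsto (fun ρ : ℝ => C * ρ ^ s) (𝓝 0) (𝓝 (C * 0 ^ s)) :=
      (tendsto_id.rpow_const (Or.inr hs.le)).const_mul C
    rw [Real.zero_rpow hs.ne', mul_zero] at this
    exact this.mono_left nhdsWithin_le_nhds

end

/-! ### Differentiability of Lipschitz functions -/

section
variable {m : ℕ}

lemma measurable_partialDeriv {f : Euc m → ℝ} {K : ℝ≥0} (hf : LipschitzWith K f) (i : Fin m) :
    Measurable (partialDeriv i f) := measurable_lineDeriv hf.continuous

lemma abs_partialDeriv_le {f : Euc m → ℝ} {K : ℝ≥0} (hf : LipschitzWith K f) (i : Fin m)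
    (x : Euc m) : |partialDeriv i f x| ≤ K := by
  have h := norm_lineDeriv_le_of_lipschitz ℝ hf (x₀ := x) (v := EuclideanSpace.single i (1 : ℝ))
  simpa [partialDeriv] using h

lemma isLocallyFiniteMeasure_withDensity_partialDeriv {f : Euc m → ℝ} {K : ℝ≥0}
    (hf : LipschitzWith K f) :
    IsLocallyFiniteMeasure (volume.withDensity fun x => ∑ i, ‖partialDeriv i f x‖ₑ) := by
  have h : (volume.withDensity fun x => ∑ i, ‖partialDeriv i f x‖ₑ) ≤
      (m * (K : ℝ≥0∞)) • (volume : Measure (Euc m)) := by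
    rw [← withDensity_const]
    refine withDensity_mono (Eventually.of_forall fun x => ?_)
    calc ∑ i, ‖partialDeriv i f x‖ₑ ≤ ∑ i : Fin m, (K : ℝ≥0∞) := by
          refine Finset.sum_le_sum fun i _ => ?_
          rw [← ofReal_norm, ← ENNReal.ofReal_coe_nnreal]
          exact ENNReal.ofReal_le_ofReal (abs_partialDeriv_le hf i x)
      _ = _ := by simp
  have : IsLocallyFiniteMeasure ((m * (K : ℝ≥0∞)) • (volume : Measure (Euc m))) := by
    refine ⟨fun x => ⟨Metric.closedBall x 1, Metric.closedBall_mem_nhds x one_pos, ?_⟩⟩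
    rw [Measure.smul_apply, smul_eq_mul]
    exact ENNReal.mul_lt_top (ENNReal.mul_lt_top (ENNReal.natCast_lt_top m) ENNReal.coe_lt_top)
      measure_closedBall_lt_top
  exact Measure.isLocallyFiniteMeasure_of_le h

/-- A Lipschitz function is differentiable wherever all its partial derivatives, as functions
defined almost everywhere, have Lebesgue values, and these values are the partial derivatives. -/
lemma hasFDerivAt_of_hasLebesgueValue (hm : 1 ≤ m) {f : Euc m → ℝ} {K : ℝ≥0}
    (hf : LipschitzWith K f) {x : Euc m} {l : Fin m → ℝ}
    (hl : ∀ i, HasLebesgueValue (partialDeriv i f) x (l i)) :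
    HasFDerivAt f (∑ i, l i • (EuclideanSpace.proj i : Euc m →L[ℝ] ℝ)) x := by
  have : Nonempty (Fin m) := ⟨⟨0, hm⟩⟩
  obtain ⟨L, hL⟩ : ∃ L, L = ∑ i, l i • (EuclideanSpace.proj i : Euc m →L[ℝ] ℝ) := ⟨_, rfl⟩
  rw [← hL]
  obtain ⟨K', hK'⟩ : ∃ K' : ℝ≥0, K' = K + ‖L‖₊ := ⟨_, rfl⟩
  have hLip : LipschitzWith K' (fun y => f y - L y) := hK' ▸ hf.sub L.lipschitz
  obtain ⟨μ, hμ⟩ : ∃ μ : Measure (Euc m), μ = volume.withDensity fun x =>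
    ∑ i, ‖partialDeriv i (fun y => f y - L y) x‖ₑ := ⟨_, rfl⟩
  have hb : DerivBound (fun y => f y - L y) μ := hμ ▸ hLip.derivBound
  have hfinμ : IsLocallyFiniteMeasure μ :=
    hμ ▸ isLocallyFiniteMeasure_withDensity_partialDeriv hLip
  have hψ : LocallyIntegrable (fun y => f y - L y) := hLip.continuous.locallyIntegrable
  have hK := kernelConst_pos m
  have hd : ∀ᵐ y, ∀ i, partialDeriv i (fun y => f y - L y) y = partialDeriv i f y - l i := by
    rw [ae_all_iff]
    intro i
    filter_upwards [hf.ae_lineDifferentiableAt (μ := volume) (EuclideanSpace.single i (1 : ℝ))]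
      with y hy
    have h1 : HasLineDerivAt ℝ L (L (EuclideanSpace.single i (1 : ℝ))) y
        (EuclideanSpace.single i (1 : ℝ)) := L.hasFDerivAt.hasLineDerivAt _
    have h2 : L (EuclideanSpace.single i (1 : ℝ)) = l i := by
      rw [hL]
      simp
    rw [h2] at h1
    have h3 : HasLineDerivAt ℝ (fun y => f y - L y) (partialDeriv i f y - l i) y
        (EuclideanSpace.single i (1 : ℝ)) := HasDerivAt.sub hy.hasLineDerivAt h1
    exact h3.lineDeriv
  -- All Lebesgue values of the derivatives of `f - L` at `x` are zero, so the mass of `μ` in small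
  -- balls around `x` is of lower order than the volume.
  have hmass : Tendsto (fun h : ℝ => μ.real (Metric.closedBall x (2 * h)) / h ^ m) (𝓝[>] 0)
      (𝓝 0) := by
    have h3 : Tendsto (fun h : ℝ => 3 * h) (𝓝[>] 0) (𝓝[>] 0) := by
      refine tendsto_nhdsWithin_iff.2 ⟨?_, ?_⟩
      · have : Tendsto (fun h : ℝ => 3 * h) (𝓝 0) (𝓝 (3 * 0)) := tendsto_id.const_mul 3
        rw [mul_zero] at this
        exact this.mono_left nhdsWithin_le_nhds
      · filter_upwards [self_mem_nhdsWithin] with h hh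
        exact mul_pos three_pos (show (0 : ℝ) < h from hh)
    have hlim : Tendsto (fun h : ℝ => 3 ^ m * volume.real (Metric.closedBall (0 : Euc m) 1) *
        ∑ i, ⨍ y in Metric.ball x (3 * h), |partialDeriv i f y - l i|) (𝓝[>] 0) (𝓝 0) := by
      have := (tendsto_finsetSum Finset.univ fun i _ => (hl i).comp h3).const_mul
        (3 ^ m * volume.real (Metric.closedBall (0 : Euc m) 1))
      simpa using this
    refine squeeze_zero' (Eventually.of_forall fun h => ?_) ?_ hlim
    · by_cases hh : 0 ≤ h
      · positivity
      · rw [Metric.closedBall_eq_empty.2 (by linarith)]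
        simp
    filter_upwards [self_mem_nhdsWithin] with h hh
    have hh : 0 < h := hh
    rw [div_le_iff₀ (by positivity)]
    have hi : ∀ i, IntegrableOn (fun y => |partialDeriv i f y - l i|) (Metric.ball x (3 * h)) :=
      fun i => Measure.integrableOn_of_bounded (M := K + |l i|) measure_ball_lt_top.ne
        ((measurable_partialDeriv hf i).sub_const _).norm.aestronglyMeasurable
        (Eventually.of_forall fun y => by
          rw [norm_abs_eq_norm]
          exact (norm_sub_le _ _).trans (add_le_add (abs_partialDeriv_le hf i y) le_rfl))
    have e : μ (Metric.closedBall x (2 * h)) ≤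
        ENNReal.ofReal (∑ i, ∫ y in Metric.ball x (3 * h), |partialDeriv i f y - l i|) := by
      rw [hμ, withDensity_apply _ Metric.isClosed_closedBall.measurableSet,
        ENNReal.ofReal_sum_of_nonneg fun i _ => integral_nonneg fun y => abs_nonneg _]
      calc ∫⁻ y in Metric.closedBall x (2 * h), ∑ i, ‖partialDeriv i (fun y => f y - L y) y‖ₑ
          ≤ ∫⁻ y in Metric.ball x (3 * h), ∑ i, ‖partialDeriv i (fun y => f y - L y) y‖ₑ :=
            lintegral_mono_set (Metric.closedBall_subset_ball (by linarith))
        _ = ∫⁻ y in Metric.ball x (3 * h), ∑ i, ‖partialDeriv i f y - l i‖ₑ := by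
            refine lintegral_congr_ae (ae_restrict_of_ae ?_)
            filter_upwards [hd] with y hy
            simp only [hy]
        _ = ∑ i, ∫⁻ y in Metric.ball x (3 * h), ‖partialDeriv i f y - l i‖ₑ :=
            lintegral_finsetSum _ fun i _ => ((measurable_partialDeriv hf i).sub_const _).enorm
        _ ≤ _ := by
            refine Finset.sum_le_sum fun i _ => ?_
            rw [ofReal_integral_eq_lintegral_ofReal (hi i)
              (Eventually.of_forall fun y => abs_nonneg _)]
            refine lintegral_mono fun y => ?_
            rw [← ofReal_norm, Real.norm_eq_abs]
    have e2 := ENNReal.toReal_mono ENNReal.ofReal_ne_top e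
    rw [ENNReal.toReal_ofReal (Finset.sum_nonneg fun i _ => integral_nonneg fun y => abs_nonneg _)]
      at e2
    refine e2.trans (le_of_eq ?_)
    have hvol : volume.real (Metric.ball x (3 * h)) =
        (3 * h) ^ m * volume.real (Metric.closedBall (0 : Euc m) 1) := by
      rw [← Measure.addHaar_real_closedBall_eq_addHaar_real_ball,
        Measure.addHaar_real_closedBall' _ _ (by positivity), finrank_euclideanSpace_fin]
    have hV := (volume_real_unit_pos m).ne'
    rw [Finset.mul_sum, Finset.sum_mul]
    refine Finset.sum_congr rfl fun i _ => ?_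
    rw [setAverage_eq, smul_eq_mul, hvol, mul_pow]
    field_simp
  rw [hasFDerivAt_iff_isLittleO, Asymptotics.isLittleO_iff]
  intro c hc
  -- At distance `h` from `x`, compare with the average of `f - L` at scale `δ h`: the error
  -- at both points is at most `c h / 4`, and the increment of the average is `o(h)` for fixed `δ`.
  obtain ⟨δ, hδ0, hδ1, hδ⟩ : ∃ δ : ℝ, 0 < δ ∧ δ ≤ 1 ∧ 2 * K' * δ ≤ c / 2 := by
    refine ⟨min 1 (c / (4 * (K' + 1))), by positivity, min_le_left _ _, ?_⟩
    calc 2 * (K' : ℝ) * min 1 (c / (4 * (K' + 1)))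
        ≤ 2 * (K' + 1) * (c / (4 * (K' + 1))) := by
          gcongr
          · linarith
          · exact min_le_right _ _
      _ = c / 2 := by field_simp; norm_num
  have hev : ∀ᶠ h : ℝ in 𝓝[>] 0, m * (kernelConst m / δ ^ m) *
      (μ.real (Metric.closedBall x (2 * h)) / h ^ m) < c / 2 := by
    have := hmass.const_mul (m * (kernelConst m / δ ^ m))
    rw [mul_zero] at this
    exact this.eventually (gt_mem_nhds (by positivity))
  obtain ⟨h₀, hh₀, hsmall⟩ := mem_nhdsGT_iff_exists_Ioo_subset.1 hev
  filter_upwards [Metric.ball_mem_nhds x hh₀] with y hy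
  obtain ⟨h, hh⟩ : ∃ h, h = ‖y - x‖ := ⟨_, rfl⟩
  rcases eq_or_ne y x with rfl | hyx
  · simp
  have hh0 : 0 < h := hh ▸ norm_pos_iff.2 (sub_ne_zero.2 hyx)
  have hhh : h < h₀ := by rw [hh]; exact mem_ball_iff_norm.1 hy
  have hs : m * (kernelConst m / δ ^ m) *
      (μ.real (Metric.closedBall x (2 * h)) / h ^ m) < c / 2 := hsmall ⟨hh0, hhh⟩
  have hδh : 0 < δ * h := by positivity
  have hA : ∀ z, |ballAvg (δ * h) (fun y => f y - L y) z - (f z - L z)| ≤ K' * (δ * h) := by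
    intro z
    refine abs_ballAvg_sub_le hψ hδh fun t ht => ?_
    have := hLip.dist_le_mul (z - t) z
    rw [Real.dist_eq, dist_eq_norm, sub_sub_cancel_left, norm_neg] at this
    exact this.trans (by gcongr)
  have hB := abs_ballAvg_sub_ballAvg_le hψ hb hδh (Metric.mem_closedBall_self hh0.le)
    (mem_closedBall_iff_norm.2 hh.ge)
  rw [← hh] at hB
  have hC : m * (kernelConst m / (δ * h) ^ m * μ.real (Metric.closedBall x (h + δ * h))) * h ≤
      c / 2 * h := by
    have h1 : μ.real (Metric.closedBall x (h + δ * h)) ≤ μ.real (Metric.closedBall x (2 * h)) :=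
      measureReal_mono (Metric.closedBall_subset_closedBall (by nlinarith))
        (isCompact_closedBall _ _).measure_lt_top.ne
    calc _ ≤ m * (kernelConst m / (δ * h) ^ m * μ.real (Metric.closedBall x (2 * h))) * h := by
          gcongr
      _ = m * (kernelConst m / δ ^ m) * (μ.real (Metric.closedBall x (2 * h)) / h ^ m) * h := by
          rw [mul_pow]
          field_simp
      _ ≤ _ := by gcongr
  have e : f y - f x - L (y - x) = (f y - L y) - (f x - L x) := by
    rw [map_sub]
    ring
  rw [e, ← hh, Real.norm_eq_abs]
  have h1 := hA y
  have h2 := hA x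
  have h3 := hB.trans hC
  rw [abs_le] at h1 h2 h3 ⊢
  constructor <;> nlinarith [mul_le_mul_of_nonneg_right hδ hh0.le]

lemma partialDeriv_eq_of_hasLebesgueValue (hm : 1 ≤ m) {f : Euc m → ℝ} {K : ℝ≥0}
    (hf : LipschitzWith K f) {x : Euc m} {l : Fin m → ℝ}
    (hl : ∀ i, HasLebesgueValue (partialDeriv i f) x (l i)) (i : Fin m) :
    partialDeriv i f x = l i := by
  have h := (hasFDerivAt_of_hasLebesgueValue hm hf hl).hasLineDerivAt
    (EuclideanSpace.single i (1 : ℝ))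
  have h2 : (∑ i, l i • (EuclideanSpace.proj i : Euc m →L[ℝ] ℝ)) (EuclideanSpace.single i (1 : ℝ)) =
      l i := by
    simp
  rw [h2] at h
  exact h.lineDeriv

end

/-! ### Taylor remainders -/

section
variable {m : ℕ}

lemma IsBVLoc.isGradientVariation {ψ : Euc m → ℝ} (h : IsBVLoc ψ) :
    IsGradientVariation ψ (gradientVariation ψ) := by
  rw [gradientVariation, dif_pos h.2]
  exact h.2.choose_spec

/-- The Riesz potential of the variation of the `i`-th partial derivative of `f`. -/
noncomputable def derivPotential (s : ℝ) (f : Euc m → ℝ) (i : Fin m) (x : Euc m) : ℝ≥0∞ :=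
  rieszPotential (1 - s) (gradientVariation (partialDeriv i f)) x

lemma measurable_derivPotential {s : ℝ} {f : Euc m → ℝ} {i : Fin m}
    (h : IsBVLoc (partialDeriv i f)) : Measurable (derivPotential s f i) := by
  have := h.isGradientVariation.1
  unfold derivPotential rieszPotential
  exact Measurable.lintegral_prod_right'
    (f := fun p : Euc m × Euc m => edist p.1 p.2 ^ (1 - s - (m : ℝ)))
    (measurable_edist.pow_const _)

/-- `f` is a Lipschitz function with partial derivatives of locally bounded variation. -/
structure LipschitzBV (K : ℝ≥0) (f : Euc m → ℝ) : Prop where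
  lip : LipschitzWith K f
  bv : ∀ i, IsBVLoc (partialDeriv i f)

/-- The behaviour of `f` at a point where all derivative potentials are finite: the averages of
its partial derivatives converge, with a rate, to the classical partial derivatives. -/
lemma LipschitzBV.exists_values {K : ℝ≥0} {f : Euc m → ℝ} {s : ℝ} (hf : LipschitzBV K f) (hs : 0 < s)
    {x : Euc m} (hx : ∀ i, derivPotential s f i x ≠ ∞) :
    (∀ i, HasLebesgueValue (partialDeriv i f) x (partialDeriv i f x)) ∧
    HasFDerivAt f (∑ i, partialDeriv i f x • (EuclideanSpace.proj i : Euc m →L[ℝ] ℝ)) x ∧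
    ∀ i ρ, 0 < ρ → |ballAvg ρ (partialDeriv i f) x - partialDeriv i f x| ≤
      scaleConst m s * (ρ ^ s * (derivPotential s f i x).toReal) := by
  rcases Nat.eq_zero_or_pos m with rfl | hm
  · refine ⟨fun i => i.elim0, ?_, fun i => i.elim0⟩
    have : Subsingleton (Euc 0) := inferInstance
    exact hasFDerivAt_of_subsingleton f x |>.congr_fderiv (by simp)
  have h : ∀ i, ∃ l : ℝ, ∀ ρ, 0 < ρ → |ballAvg ρ (partialDeriv i f) x - l| ≤
      scaleConst m s * (ρ ^ s * (derivPotential s f i x).toReal) := fun i =>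
    have := (hf.bv i).isGradientVariation.1
    exists_limit_ballAvg hm hs (hf.bv i).1 (hf.bv i).isGradientVariation.derivBound (hx i)
  choose l hl using h
  have hL : ∀ i, HasLebesgueValue (partialDeriv i f) x (l i) := fun i =>
    have := (hf.bv i).isGradientVariation.1
    hasLebesgueValue_of_ballAvg hm hs (hf.bv i).1 (hf.bv i).isGradientVariation.derivBound (hx i)
      (hl i)
  have e : (fun i => partialDeriv i f x) = l :=
    funext fun i => partialDeriv_eq_of_hasLebesgueValue hm hf.lip hL i
  have e' : ∀ i, partialDeriv i f x = l i := fun i => congrFun e i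
  simp only [e']
  exact ⟨hL, hasFDerivAt_of_hasLebesgueValue hm hf.lip hL, hl⟩

/-- The partial derivatives are Hölder continuous of order `s` with the potentials as weight. -/
lemma LipschitzBV.enorm_partialDeriv_sub_le {K : ℝ≥0} {f : Euc m → ℝ} {s : ℝ}
    (hf : LipschitzBV K f) (hs : 0 < s)
    {x y : Euc m} (hx : ∀ i, derivPotential s f i x ≠ ∞)
    (hy : ∀ i, derivPotential s f i y ≠ ∞) (i : Fin m) :
    ‖partialDeriv i f x - partialDeriv i f y‖ₑ ≤ ENNReal.ofReal (2 * scaleConst m s) *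
      (‖y - x‖ₑ ^ s * (derivPotential s f i x + derivPotential s f i y)) := by
  rcases eq_or_ne x y with rfl | hxy
  · simp
  have hm : 1 ≤ m := Nat.pos_of_ne_zero fun h => by
    subst h
    exact i.elim0
  have := (hf.bv i).isGradientVariation.1
  have hD := scaleConst_nonneg m hs
  have h := abs_limit_sub_limit_le hm hs (hf.bv i).1 (hf.bv i).isGradientVariation.derivBound (hx i)
    ((hf.exists_values hs hx).2.2 i) ((hf.exists_values hs hy).2.2 i) hxy
  rw [← ofReal_norm, Real.norm_eq_abs]
  refine (ENNReal.ofReal_le_ofReal h).trans (le_of_eq ?_)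
  rw [ENNReal.ofReal_mul (p := 2 * scaleConst m s) (by positivity),
    ENNReal.ofReal_mul (p := ‖y - x‖ ^ s) (by positivity), ← ENNReal.ofReal_rpow_of_nonneg (norm_nonneg _) hs.le, ofReal_norm,
    ENNReal.ofReal_add ENNReal.toReal_nonneg ENNReal.toReal_nonneg]
  congr 3
  · exact ENNReal.ofReal_toReal (hx i)
  · exact ENNReal.ofReal_toReal (hy i)

/-- The Taylor remainder is of order `1 + s`, with the potentials along the segment as weight. -/
lemma LipschitzBV.enorm_remainder_le {K : ℝ≥0} {f : Euc m → ℝ} {s : ℝ} (hf : LipschitzBV K f) (hs : 0 < s)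
    (x y : Euc m) :
    ‖f y - f x - ∑ i, partialDeriv i f x * (y i - x i)‖ₑ ≤ ENNReal.ofReal (2 * scaleConst m s + 1) *
      (‖y - x‖ₑ ^ (1 + s) * ∑ i, ((∫⁻ t in Icc (0 : ℝ) 1,
        derivPotential s f i (t • y + (1 - t) • x) * ENNReal.ofReal (t ^ s)) +
        derivPotential s f i x)) := by
  rcases eq_or_ne x y with rfl | hxy
  · simp
  have hD := scaleConst_nonneg m hs
  have hn0 : ‖y - x‖ₑ ≠ 0 := by simpa [sub_eq_zero] using hxy.symm
  obtain ⟨S, hS⟩ : ∃ S, S = ∑ i, ((∫⁻ t in Icc (0 : ℝ) 1,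
        derivPotential s f i (t • y + (1 - t) • x) * ENNReal.ofReal (t ^ s)) +
        derivPotential s f i x) := ⟨_, rfl⟩
  rw [← hS]
  -- If `S = ∞`, so is the right hand side: the summand `1` keeps its constant positive.
  by_cases hSt : S = ∞
  · rw [hSt, ENNReal.mul_top (ENNReal.rpow_pos (pos_iff_ne_zero.2 hn0) enorm_ne_top).ne',
      ENNReal.mul_top (by simpa using by positivity)]
    exact le_top
  have hfin := fun i : Fin m => ENNReal.add_ne_top.1
    (ENNReal.sum_ne_top.1 (hS ▸ hSt : ∑ i, _ ≠ ∞) i (Finset.mem_univ i))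
  have hx : ∀ i, derivPotential s f i x ≠ ∞ := fun i => (hfin i).2
  have hγ : Continuous fun t : ℝ => t • y + (1 - t) • x := by fun_prop
  have hmeas : ∀ i, Measurable fun t : ℝ => derivPotential s f i (t • y + (1 - t) • x) :=
    fun i => (measurable_derivPotential (hf.bv i)).comp hγ.measurable
  have hmt : Measurable fun t : ℝ => ENNReal.ofReal (t ^ s) :=
    (measurable_id.pow_const s).ennreal_ofReal
  -- The weight `t ^ s` is positive, so almost all points of the segment have finite potentials and
  -- are points of differentiability.
  have hae : ∀ᵐ t ∂volume.restrict (Ioc (0 : ℝ) 1),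
      ∀ i, derivPotential s f i (t • y + (1 - t) • x) ≠ ∞ := by
    rw [ae_all_iff]
    intro i
    have h1 : ∀ᵐ t ∂volume.restrict (Icc (0 : ℝ) 1), derivPotential s f i (t • y + (1 - t) • x) *
        ENNReal.ofReal (t ^ s) < ∞ := ae_lt_top ((hmeas i).mul hmt) (hfin i).1
    filter_upwards [ae_mono (Measure.restrict_mono_set volume Ioc_subset_Icc_self) h1,
      ae_restrict_mem measurableSet_Ioc] with t ht ht0 htop
    rw [htop, ENNReal.top_mul (by simpa using Real.rpow_pos_of_pos ht0.1 s)] at ht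
    exact lt_irrefl _ ht
  obtain ⟨g, hg⟩ : ∃ g : ℝ → ℝ, g = fun t => f (t • y + (1 - t) • x) := ⟨_, rfl⟩
  have hgL : LipschitzWith (K * ‖y - x‖₊) g := by
    rw [hg]
    refine hf.lip.comp (LipschitzWith.of_dist_le_mul fun t t' => ?_)
    rw [dist_eq_norm, show t • y + (1 - t) • x - (t' • y + (1 - t') • x) = (t - t') • (y - x) by
      module, norm_smul, mul_comm, coe_nnnorm, dist_eq_norm]
  have hFTC : f y - f x = ∫ t in (0 : ℝ)..1, deriv g t := by
    rw [(hgL.lipschitzOnWith (s := uIcc 0 1)).absolutelyContinuousOnInterval.integral_deriv_eq_sub, hg]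
    simp
  have hder : ∀ᵐ t ∂volume.restrict (Ioc (0 : ℝ) 1), deriv g t =
      ∑ i, partialDeriv i f (t • y + (1 - t) • x) * (y i - x i) := by
    filter_upwards [hae] with t ht
    have h1 : HasDerivAt (fun t : ℝ => t • y + (1 - t) • x) (y - x) t := by
      have := ((hasDerivAt_id t).smul_const y).add (((hasDerivAt_id t).const_sub 1).smul_const x)
      exact HasDerivAt.congr_deriv this (by simp [sub_eq_add_neg])
    have h2 := (hf.exists_values hs ht).2.1.comp_hasDerivAt t h1
    rw [hg]
    refine h2.deriv.trans ?_
    simp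
  have hgi : IntegrableOn (deriv g) (Ioc 0 1) :=
    Measure.integrableOn_of_bounded (M := (K * ‖y - x‖₊ : ℝ≥0)) measure_Ioc_lt_top.ne
      (measurable_deriv g).aestronglyMeasurable
      (Eventually.of_forall fun t => norm_deriv_le_of_lipschitz hgL)
  have e : f y - f x - ∑ i, partialDeriv i f x * (y i - x i) = ∫ t in Ioc (0 : ℝ) 1,
      ∑ i, (partialDeriv i f (t • y + (1 - t) • x) - partialDeriv i f x) * (y i - x i) := by
    rw [hFTC, intervalIntegral.integral_of_le zero_le_one]
    have : ∑ i, partialDeriv i f x * (y i - x i) =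
        ∫ t in Ioc (0 : ℝ) 1, ∑ i, partialDeriv i f x * (y i - x i) := by simp
    rw [this, ← integral_sub hgi (integrableOn_const measure_Ioc_lt_top.ne)]
    refine integral_congr_ae ?_
    filter_upwards [hder] with t ht
    rw [ht, ← Finset.sum_sub_distrib]
    simp only [sub_mul]
  rw [e]
  refine (enorm_integral_le_lintegral_enorm _).trans ?_
  have hle1 : ENNReal.ofReal (2 * scaleConst m s) ≤ ENNReal.ofReal (2 * scaleConst m s + 1) :=
    ENNReal.ofReal_le_ofReal (by linarith)
  calc ∫⁻ t in Ioc (0 : ℝ) 1,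
        ‖∑ i, (partialDeriv i f (t • y + (1 - t) • x) - partialDeriv i f x) * (y i - x i)‖ₑ
      ≤ ∫⁻ t in Ioc (0 : ℝ) 1, ∑ i, ENNReal.ofReal (2 * scaleConst m s) * ‖y - x‖ₑ ^ (1 + s) *
          (derivPotential s f i (t • y + (1 - t) • x) * ENNReal.ofReal (t ^ s) +
            derivPotential s f i x * ENNReal.ofReal (t ^ s)) := by
        refine lintegral_mono_ae ?_
        filter_upwards [hae, ae_restrict_mem measurableSet_Ioc] with t ht ht0
        refine (enorm_sum_le _ _).trans (Finset.sum_le_sum fun i _ => ?_)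
        rw [enorm_mul]
        have h1 := hf.enorm_partialDeriv_sub_le hs ht hx i
        have h2 : ‖y i - x i‖ₑ ≤ ‖y - x‖ₑ := by
          rw [← ofReal_norm, ← ofReal_norm]
          exact ENNReal.ofReal_le_ofReal (PiLp.norm_apply_le (y - x) i)
        have h3 : ‖x - (t • y + (1 - t) • x)‖ₑ = ENNReal.ofReal t * ‖y - x‖ₑ := by
          rw [show x - (t • y + (1 - t) • x) = (-t) • (y - x) by module, enorm_smul, enorm_neg,
            Real.enorm_eq_ofReal ht0.1.le]
        rw [h3, ENNReal.mul_rpow_of_nonneg _ _ hs.le, ENNReal.ofReal_rpow_of_pos ht0.1] at h1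
        calc _ ≤ ENNReal.ofReal (2 * scaleConst m s) *
              (ENNReal.ofReal (t ^ s) * ‖y - x‖ₑ ^ s * (derivPotential s f i
              (t • y + (1 - t) • x) + derivPotential s f i x)) * ‖y - x‖ₑ := mul_le_mul' h1 h2
          _ = _ := by
            rw [add_comm 1 s, ENNReal.rpow_add s 1 hn0 enorm_ne_top, ENNReal.rpow_one]
            ring
    _ = ∑ i, ENNReal.ofReal (2 * scaleConst m s) * ‖y - x‖ₑ ^ (1 + s) *
          ((∫⁻ t in Ioc (0 : ℝ) 1, derivPotential s f i (t • y + (1 - t) • x) *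
            ENNReal.ofReal (t ^ s)) +
            derivPotential s f i x * ∫⁻ t in Ioc (0 : ℝ) 1, ENNReal.ofReal (t ^ s)) := by
        rw [lintegral_finsetSum]
        · refine Finset.sum_congr rfl fun i _ => ?_
          rw [lintegral_const_mul' _ _ (ENNReal.mul_ne_top ENNReal.ofReal_ne_top
            (ENNReal.rpow_ne_top_of_nonneg (by linarith) enorm_ne_top)),
            lintegral_add_left (f := fun t => derivPotential s f i (t • y + (1 - t) • x) *
              ENNReal.ofReal (t ^ s)) ((hmeas i).mul hmt), lintegral_const_mul _ hmt]
        · exact fun i _ => (((hmeas i).mul hmt).add (hmt.const_mul _)).const_mul _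
    _ ≤ ∑ i, ENNReal.ofReal (2 * scaleConst m s + 1) * ‖y - x‖ₑ ^ (1 + s) *
          ((∫⁻ t in Icc (0 : ℝ) 1, derivPotential s f i (t • y + (1 - t) • x) *
            ENNReal.ofReal (t ^ s)) + derivPotential s f i x) := by
        refine Finset.sum_le_sum fun i _ => ?_
        gcongr
        · exact Ioc_subset_Icc_self
        · have : ∫⁻ t in Ioc (0 : ℝ) 1, ENNReal.ofReal (t ^ s) ≤ 1 := by
            calc _ ≤ ∫⁻ t in Ioc (0 : ℝ) 1, 1 := by
                  refine setLIntegral_mono' measurableSet_Ioc fun t ht => ?_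
                  rw [ENNReal.ofReal_le_one]
                  exact Real.rpow_le_one ht.1.le ht.2 hs.le
              _ = 1 := by simp
          exact mul_le_of_le_one_right' this
    _ = _ := by
        rw [hS, Finset.mul_sum, Finset.mul_sum]
        simp only [mul_assoc]

end

/-! ### Power kernels on an interval -/

/-- The kernel `(r - θ) ^ p` for `θ < r`, continued by zero. -/
noncomputable def causalKernel (p r θ : ℝ) : ℝ≥0∞ :=
  if θ < r then ENNReal.ofReal ((r - θ) ^ p) else 0

lemma measurable_causalKernel (p : ℝ) :
    Measurable fun q : ℝ × ℝ => causalKernel p q.1 q.2 :=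
  Measurable.ite (measurableSet_lt measurable_snd measurable_fst)
    ((measurable_fst.sub measurable_snd).pow_const p).ennreal_ofReal measurable_const

lemma lintegral_rpow_Ioc {δ L : ℝ} (hδ : 0 < δ) (hL : 0 ≤ L) :
    ∫⁻ u in Ioc 0 L, ENNReal.ofReal (u ^ (δ - 1)) = ENNReal.ofReal (L ^ δ / δ) := by
  have h1 : IntervalIntegrable (fun u : ℝ => u ^ (δ - 1)) volume 0 L :=
    intervalIntegral.intervalIntegrable_rpow' (by linarith)
  rw [intervalIntegrable_iff_integrableOn_Ioc_of_le hL] at h1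
  rw [← ofReal_integral_eq_lintegral_ofReal h1, ← intervalIntegral.integral_of_le hL,
    integral_rpow (Or.inl (by linarith))]
  · simp [Real.zero_rpow hδ.ne']
  · filter_upwards [ae_restrict_mem measurableSet_Ioc] with u hu
    exact Real.rpow_nonneg hu.1.le _

lemma lintegral_causalKernel_left {a b δ : ℝ} (hδ : 0 < δ) {r : ℝ} (hr : r ∈ Icc a b) :
    ∫⁻ θ in Icc a b, causalKernel (δ - 1) r θ ≤ ENNReal.ofReal ((b - a) ^ δ / δ) := by
  rw [← lintegral_rpow_Ioc hδ (by linarith [hr.1, hr.2]),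
    ← lintegral_indicator measurableSet_Icc, ← lintegral_indicator measurableSet_Ioc,
    ← lintegral_sub_left_eq_self _ r]
  refine lintegral_mono fun θ => ?_
  by_cases hθ : r - θ ∈ Icc a b
  · rw [indicator_of_mem hθ, causalKernel]
    split_ifs with h
    · rw [sub_sub_cancel, indicator_of_mem (show θ ∈ Ioc 0 (b - a) from
        ⟨by linarith, by linarith [hθ.1, hr.2]⟩)]
    · exact zero_le
  · rw [indicator_of_notMem hθ]
    exact zero_le

lemma lintegral_causalKernel_right {a b δ : ℝ} (hδ : 0 < δ) {θ : ℝ} (hθ : θ ∈ Icc a b) :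
    ∫⁻ r in Icc a b, causalKernel (δ - 1) r θ ≤ ENNReal.ofReal ((b - a) ^ δ / δ) := by
  rw [← lintegral_rpow_Ioc hδ (by linarith [hθ.1, hθ.2]),
    ← lintegral_indicator measurableSet_Icc, ← lintegral_indicator measurableSet_Ioc,
    ← lintegral_sub_right_eq_self (fun u => (Ioc 0 (b - a)).indicator _ u) θ]
  refine lintegral_mono fun r => ?_
  by_cases hr : r ∈ Icc a b
  · rw [indicator_of_mem hr, causalKernel]
    split_ifs with h
    · rw [indicator_of_mem (show r - θ ∈ Ioc 0 (b - a) from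
        ⟨by linarith, by linarith [hθ.1, hr.2]⟩)]
    · exact zero_le
  · rw [indicator_of_notMem hr]
    exact zero_le

lemma lintegral_causalKernel_mul_left {a b δ : ℝ} (hδ : 0 < δ) {p : ℝ → ℝ≥0∞} :
    ∫⁻ r in Icc a b, ∫⁻ θ in Icc a b, causalKernel (δ - 1) r θ * p r ≤
      ENNReal.ofReal ((b - a) ^ δ / δ) * ∫⁻ r in Icc a b, p r := by
  rw [← lintegral_const_mul' _ _ ENNReal.ofReal_ne_top]
  refine setLIntegral_mono' measurableSet_Icc fun r hr => ?_
  have hm : Measurable (causalKernel (δ - 1) r) :=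
    (measurable_causalKernel _).comp (measurable_const.prodMk measurable_id)
  rw [lintegral_mul_const _ hm]
  gcongr
  exact lintegral_causalKernel_left hδ hr

lemma lintegral_causalKernel_mul_right {a b δ : ℝ} (hδ : 0 < δ) {p : ℝ → ℝ≥0∞}
    (hp : Measurable p) :
    ∫⁻ r in Icc a b, ∫⁻ θ in Icc a b, causalKernel (δ - 1) r θ * p θ ≤
      ENNReal.ofReal ((b - a) ^ δ / δ) * ∫⁻ r in Icc a b, p r := by
  rw [lintegral_lintegral_swap (f := fun r θ => causalKernel (δ - 1) r θ * p θ)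
    ((measurable_causalKernel _).mul (hp.comp measurable_snd)).aemeasurable,
    ← lintegral_const_mul' _ _ ENNReal.ofReal_ne_top]
  refine setLIntegral_mono' measurableSet_Icc fun θ hθ => ?_
  have hm : Measurable fun r => causalKernel (δ - 1) r θ :=
    (measurable_causalKernel _).comp (measurable_id.prodMk measurable_const)
  rw [lintegral_mul_const _ hm]
  gcongr
  exact lintegral_causalKernel_right hδ hθ

lemma lintegral_rpow_Ioi {κ ℓ : ℝ} (hκ : 0 < κ) (hℓ : 0 < ℓ) :
    ∫⁻ v in Ioi ℓ, ENNReal.ofReal (v ^ (-(κ + 1))) = ENNReal.ofReal (ℓ ^ (-κ) / κ) := by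
  have h1 : IntegrableOn (fun u : ℝ => u ^ (-(κ + 1))) (Ioi ℓ) :=
    integrableOn_Ioi_rpow_of_lt (by linarith) hℓ
  rw [← ofReal_integral_eq_lintegral_ofReal h1, integral_Ioi_rpow_of_lt (by linarith) hℓ]
  · congr 1
    rw [show -(κ + 1) + 1 = -κ by ring, neg_div_neg_eq]
  · filter_upwards [ae_restrict_mem measurableSet_Ioi] with u hu
    exact Real.rpow_nonneg (hℓ.trans hu).le _

/-- The part of the Marchaud integral beyond the left end point is explicit. -/
lemma lintegral_marchaud_le {a b κ r : ℝ} (hκ : 0 < κ) (hr : r ∈ Ioc a b) {φ h : ℝ → ℝ} {c : ℝ}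
    (h1 : ∀ v, 0 < v → v ≤ r - a → φ v = h (r - v)) (h2 : ∀ v, r - a < v → φ v = c) :
    ∫⁻ v in Ioi (0 : ℝ), ‖φ v‖ₑ * ENNReal.ofReal (v ^ (-(κ + 1))) ≤
      (∫⁻ θ in Icc a b, causalKernel (-(κ + 1)) r θ * ‖h θ‖ₑ) +
        ‖c‖ₑ * ENNReal.ofReal ((r - a) ^ (-κ) / κ) := by
  have hra : 0 < r - a := by linarith [hr.1]
  rw [← Ioc_union_Ioi_eq_Ioi hra.le]
  refine (lintegral_union_le _ _ _).trans (add_le_add ?_ ?_)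
  · rw [← lintegral_indicator measurableSet_Ioc, ← lintegral_indicator measurableSet_Icc,
      ← lintegral_sub_left_eq_self (fun θ => (Icc a b).indicator _ θ) r]
    refine lintegral_mono fun v => ?_
    by_cases hv : v ∈ Ioc 0 (r - a)
    · rw [indicator_of_mem hv, indicator_of_mem
          (show r - v ∈ Icc a b from ⟨by linarith [hv.2], by linarith [hv.1, hr.2]⟩),
        causalKernel, if_pos (by linarith [hv.1]), sub_sub_cancel, h1 v hv.1 hv.2, mul_comm]
    · rw [indicator_of_notMem hv]
      exact zero_le
  · rw [← lintegral_rpow_Ioi hκ hra, ← lintegral_const_mul' _ _ enorm_ne_top]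
    refine setLIntegral_mono' measurableSet_Ioi fun v hv => ?_
    rw [h2 v hv]

/-- Finiteness of the weighted double integral of `φ` gives all integrability properties of the
Marchaud functionals of `φ r`. -/
lemma marchaud_of_lintegral_ne_top {a b κ : ℝ} (hκ : 0 < κ) (hκ1 : κ < 1) {φ : ℝ → ℝ → ℝ}
    (hφ : Measurable (Function.uncurry φ))
    (hJ : ∫⁻ r in Icc a b, ∫⁻ v in Ioi (0 : ℝ), ‖φ r v‖ₑ * ENNReal.ofReal (v ^ (-(κ + 1))) ≠ ∞) :
    (∀ᵐ r ∂volume.restrict (Icc a b), MarchaudIntegrable κ (φ r)) ∧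
    IntegrableOn (fun r => ∫ v in Ioi (0 : ℝ), |φ r v| / v ^ (κ + 1)) (Icc a b) ∧
    ∫⁻ r in Icc a b, ‖marchaud κ (φ r)‖ₑ ≤ ENNReal.ofReal (κ / Real.Gamma (1 - κ)) *
      ∫⁻ r in Icc a b, ∫⁻ v in Ioi (0 : ℝ), ‖φ r v‖ₑ * ENNReal.ofReal (v ^ (-(κ + 1))) := by
  have hm : Measurable fun p : ℝ × ℝ => ‖φ p.1 p.2‖ₑ * ENNReal.ofReal (p.2 ^ (-(κ + 1))) :=
    hφ.enorm.mul (measurable_snd.pow_const _).ennreal_ofReal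
  have hmq : Measurable fun p : ℝ × ℝ => φ p.1 p.2 / p.2 ^ (κ + 1) :=
    Measurable.div hφ (measurable_snd.pow_const _)
  have e : ∀ r v, v ∈ Ioi (0 : ℝ) → ‖φ r v / v ^ (κ + 1)‖ₑ =
      ‖φ r v‖ₑ * ENNReal.ofReal (v ^ (-(κ + 1))) := by
    intro r v hv
    rw [Real.rpow_neg (le_of_lt hv), div_eq_mul_inv, enorm_mul,
      Real.enorm_eq_ofReal (inv_nonneg.2 (Real.rpow_nonneg (le_of_lt hv) _))]
  have e2 : ∀ r, ∫⁻ v in Ioi (0 : ℝ), ‖φ r v / v ^ (κ + 1)‖ₑ =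
      ∫⁻ v in Ioi (0 : ℝ), ‖φ r v‖ₑ * ENNReal.ofReal (v ^ (-(κ + 1))) := fun r =>
    setLIntegral_congr_fun measurableSet_Ioi fun v hv => e r v hv
  have hin : ∀ᵐ r ∂volume.restrict (Icc a b), MarchaudIntegrable κ (φ r) := by
    filter_upwards [ae_lt_top hm.lintegral_prod_right' hJ] with r hr
    refine ⟨(hmq.comp (measurable_const.prodMk measurable_id)).aestronglyMeasurable, ?_⟩
    rw [HasFiniteIntegral]
    exact (e2 r).trans_lt hr
  have e3 : ∀ r, ∫⁻ v in Ioi (0 : ℝ), ‖|φ r v| / v ^ (κ + 1)‖ₑ =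
      ∫⁻ v in Ioi (0 : ℝ), ‖φ r v‖ₑ * ENNReal.ofReal (v ^ (-(κ + 1))) := fun r => by
    rw [← e2]
    refine setLIntegral_congr_fun measurableSet_Ioi fun v hv => ?_
    rw [div_eq_mul_inv, div_eq_mul_inv, enorm_mul, enorm_mul, ← ofReal_norm |φ r v|, norm_abs_eq_norm,
      ofReal_norm]
  refine ⟨hin, ⟨?_, ?_⟩, ?_⟩
  · refine (StronglyMeasurable.integral_prod_right' (f := fun p : ℝ × ℝ => |φ p.1 p.2| / p.2 ^ (κ + 1))
      (Measurable.stronglyMeasurable ?_)).aestronglyMeasurable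
    exact Measurable.div hφ.norm (measurable_snd.pow_const _)
  · rw [HasFiniteIntegral]
    refine lt_of_le_of_lt (lintegral_mono fun r => ?_) hJ.lt_top
    exact (enorm_integral_le_lintegral_enorm _).trans (e3 r).le
  · rw [← lintegral_const_mul' _ _ ENNReal.ofReal_ne_top]
    refine lintegral_mono fun r => ?_
    rw [marchaud, enorm_mul, Real.enorm_eq_ofReal
      (div_nonneg hκ.le (Real.Gamma_pos_of_pos (by linarith)).le)]
    gcongr
    exact (enorm_integral_le_lintegral_enorm _).trans (e2 r).le

/-! ### A Hardy inequality -/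

/-- Absorption of a small multiple of the left hand side, which has to be finite. -/
lemma ENNReal.le_of_le_mul_add {T D : ℝ≥0∞} {q : ℝ} (hq0 : 0 ≤ q) (hq : q < 1) (hT : T ≠ ∞)
    (h : T ≤ ENNReal.ofReal q * T + D) : T ≤ ENNReal.ofReal (1 / (1 - q)) * D := by
  have hp : 0 < 1 / (1 - q) := by
    have : 0 < 1 - q := by linarith
    positivity
  by_cases hD : D = ∞
  · rw [hD, ENNReal.mul_top (by simpa using hp)]
    exact le_top
  have h2 := ENNReal.toReal_mono
    (ENNReal.add_ne_top.2 ⟨ENNReal.mul_ne_top ENNReal.ofReal_ne_top hT, hD⟩) h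
  rw [ENNReal.toReal_add (ENNReal.mul_ne_top ENNReal.ofReal_ne_top hT) hD, ENNReal.toReal_mul,
    ENNReal.toReal_ofReal hq0] at h2
  rw [← ENNReal.ofReal_toReal hT, ← ENNReal.ofReal_toReal hD, ← ENNReal.ofReal_mul hp.le]
  refine ENNReal.ofReal_le_ofReal ?_
  rw [one_div, inv_mul_eq_div, le_div_iff₀ (by linarith)]
  linarith

lemma lintegral_Ioc_comp_two_mul (L : ℝ) {F : ℝ → ℝ≥0∞} (hF : Measurable F) :
    ∫⁻ u in Ioc 0 (L / 2), F (2 * u) = ENNReal.ofReal 2⁻¹ * ∫⁻ u in Ioc 0 L, F u := by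
  rw [← lintegral_indicator measurableSet_Ioc, ← lintegral_indicator measurableSet_Ioc]
  have h := lintegral_map (μ := volume) (f := (Ioc 0 L).indicator F) (g := fun u : ℝ => 2 * u)
    (hF.indicator measurableSet_Ioc) (measurable_const_mul 2)
  rw [Real.map_volume_mul_left two_ne_zero, lintegral_smul_measure, abs_of_pos (by norm_num)] at h
  rw [← smul_eq_mul, h]
  refine lintegral_congr fun u => ?_
  by_cases hu : u ∈ Ioc 0 (L / 2)
  · rw [indicator_of_mem hu, indicator_of_mem (show 2 * u ∈ Ioc 0 L from
      ⟨by linarith [hu.1], by linarith [hu.2]⟩)]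
  · rw [indicator_of_notMem hu, indicator_of_notMem]
    exact fun h => hu ⟨by linarith [h.1], by linarith [h.2]⟩

lemma lintegral_Icc_eq_Ioc_add (a b : ℝ) (h : ℝ → ℝ≥0∞) :
    ∫⁻ r in Icc a b, h r = ∫⁻ u in Ioc 0 (b - a), h (a + u) := by
  rw [← setLIntegral_congr (Ioc_ae_eq_Icc (a := a) (b := b)), ← lintegral_indicator measurableSet_Ioc,
    ← lintegral_indicator measurableSet_Ioc, ← lintegral_add_left_eq_self _ a]
  refine lintegral_congr fun u => ?_
  by_cases hu : u ∈ Ioc 0 (b - a)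
  · rw [indicator_of_mem hu, indicator_of_mem (show a + u ∈ Ioc a b from
      ⟨by linarith [hu.1], by linarith [hu.2]⟩)]
  · rw [indicator_of_notMem hu, indicator_of_notMem]
    exact fun h => hu ⟨by linarith [h.1], by linarith [h.2]⟩

/-- A Hardy type inequality. Comparing the values at `u` and at `2 * u`, the weighted integral is
controlled by a multiple `2 ^ (γ - 1) < 1` of itself and by the increments. -/
lemma lintegral_hardy_le {γ L B : ℝ} (hγ0 : 0 < γ) (hγ : γ < 1) (hL : 0 < L) {G : ℝ → ℝ}
    (hG : Measurable G) (hB : ∀ u, |G u| ≤ B) {P : ℝ → ℝ≥0∞} (hP : Measurable P) {D : ℝ≥0∞}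
    (hD : D ≠ ∞)
    (h : ∀ᵐ u ∂volume.restrict (Ioc 0 (L / 2)), ‖G u - G (2 * u)‖ₑ * ENNReal.ofReal (u ^ (-γ)) ≤
      D * (P u + P (2 * u))) :
    ∫⁻ u in Ioc 0 L, ‖G u‖ₑ * ENNReal.ofReal (u ^ (-γ)) ≤
      ENNReal.ofReal (1 / (1 - 2 ^ (γ - 1))) * (ENNReal.ofReal ((L / 2) ^ (-γ)) *
        (∫⁻ u in Ioc 0 L, ‖G u‖ₑ) + 2 * D * ∫⁻ u in Ioc 0 L, P u) := by
  have hw : Measurable fun u : ℝ => ENNReal.ofReal (u ^ (-γ)) :=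
    (measurable_id.pow_const _).ennreal_ofReal
  have hB0 : 0 ≤ B := (abs_nonneg _).trans (hB 0)
  refine ENNReal.le_of_le_mul_add (by positivity)
    (Real.rpow_lt_one_of_one_lt_of_neg one_lt_two (by linarith)) ?_ ?_
  -- The left hand side is finite because `G` is bounded, but this bound does not enter the result.
  · refine ne_top_of_le_ne_top ?_ (lintegral_mono fun u => mul_le_mul'
      (show ‖G u‖ₑ ≤ ENNReal.ofReal B from ?_) le_rfl)
    · rw [lintegral_const_mul' _ _ ENNReal.ofReal_ne_top, show -γ = (1 - γ) - 1 by ring,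
        lintegral_rpow_Ioc (by linarith) hL.le]
      exact ENNReal.mul_ne_top ENNReal.ofReal_ne_top ENNReal.ofReal_ne_top
    · rw [← ofReal_norm]
      exact ENNReal.ofReal_le_ofReal (hB u)
  have h1 : ∫⁻ u in Ioc 0 (L / 2), ‖G u‖ₑ * ENNReal.ofReal (u ^ (-γ)) ≤
      ENNReal.ofReal (2 ^ (γ - 1)) * (∫⁻ u in Ioc 0 L, ‖G u‖ₑ * ENNReal.ofReal (u ^ (-γ))) +
        2 * D * ∫⁻ u in Ioc 0 L, P u := by
    have e1 : ∫⁻ u in Ioc 0 (L / 2), ENNReal.ofReal (2 ^ γ) *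
        (‖G (2 * u)‖ₑ * ENNReal.ofReal ((2 * u) ^ (-γ))) =
        ENNReal.ofReal (2 ^ (γ - 1)) * (∫⁻ u in Ioc 0 L, ‖G u‖ₑ * ENNReal.ofReal (u ^ (-γ))) := by
      rw [lintegral_const_mul' _ _ ENNReal.ofReal_ne_top,
        lintegral_Ioc_comp_two_mul L (F := fun u => ‖G u‖ₑ * ENNReal.ofReal (u ^ (-γ)))
        (hG.enorm.mul hw), ← mul_assoc, ← ENNReal.ofReal_mul (by positivity),
        Real.rpow_sub_one two_ne_zero, div_eq_mul_inv]
    have e2 : ∫⁻ u in Ioc 0 (L / 2), D * (P u + P (2 * u)) ≤ 2 * D * ∫⁻ u in Ioc 0 L, P u := by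
      rw [lintegral_const_mul' _ _ hD, lintegral_add_left hP, lintegral_Ioc_comp_two_mul L hP,
        mul_comm 2 D, mul_assoc, two_mul]
      gcongr
      · linarith
      · refine mul_le_of_le_one_left' ?_
        rw [ENNReal.ofReal_le_one]
        norm_num
    rw [← e1]
    refine le_trans ?_ (add_le_add le_rfl e2)
    rw [← lintegral_add_left (f := fun u => ENNReal.ofReal (2 ^ γ) *
      (‖G (2 * u)‖ₑ * ENNReal.ofReal ((2 * u) ^ (-γ)))) (((hG.comp (measurable_const_mul 2)).enorm.mul
      (hw.comp (measurable_const_mul 2))).const_mul _)]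
    refine lintegral_mono_ae ?_
    filter_upwards [h, ae_restrict_mem measurableSet_Ioc] with u hu hu0
    have e3 : ENNReal.ofReal (2 ^ γ) * (‖G (2 * u)‖ₑ * ENNReal.ofReal ((2 * u) ^ (-γ))) =
        ‖G (2 * u)‖ₑ * ENNReal.ofReal (u ^ (-γ)) := by
      rw [mul_left_comm, ← ENNReal.ofReal_mul (by positivity), Real.mul_rpow zero_le_two hu0.1.le,
        ← mul_assoc, ← Real.rpow_add two_pos, add_neg_cancel, Real.rpow_zero, one_mul]
    rw [e3]
    refine le_trans ?_ (add_le_add le_rfl hu)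
    rw [← add_mul]
    gcongr
    calc ‖G u‖ₑ = ‖G (2 * u) + (G u - G (2 * u))‖ₑ := by rw [add_sub_cancel]
      _ ≤ _ := enorm_add_le _ _
  have h2 : ∫⁻ u in Ioc (L / 2) L, ‖G u‖ₑ * ENNReal.ofReal (u ^ (-γ)) ≤
      ENNReal.ofReal ((L / 2) ^ (-γ)) * ∫⁻ u in Ioc 0 L, ‖G u‖ₑ := by
    rw [← lintegral_const_mul' _ _ ENNReal.ofReal_ne_top]
    refine (setLIntegral_mono' measurableSet_Ioc fun u hu => ?_).trans
      (lintegral_mono_set (Ioc_subset_Ioc_left (by linarith)))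
    rw [mul_comm]
    gcongr ENNReal.ofReal ?_ * _
    exact Real.rpow_le_rpow_of_nonpos (by linarith) hu.1.le (by linarith)
  rw [← Ioc_union_Ioc_eq_Ioc (by linarith : (0 : ℝ) ≤ L / 2) (by linarith : L / 2 ≤ L)]
  refine (lintegral_union_le _ _ _).trans ?_
  rw [Ioc_union_Ioc_eq_Ioc (by linarith : (0 : ℝ) ≤ L / 2) (by linarith : L / 2 ≤ L)]
  refine (add_le_add h1 h2).trans (le_of_eq ?_)
  ring

/-! ### Estimates along a Hölder path -/

/-- A path on the line, continuous everywhere, that is `β`-Hölder with constant `A` on `[a, b]`. -/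
structure HolderPath {m : ℕ} (a b β : ℝ) (A : ℝ≥0) (X : ℝ → Euc m) : Prop where
  cont : Continuous X
  holder : ∀ t ∈ Icc a b, ∀ u ∈ Icc a b, ‖X t - X u‖ₑ ≤ A * ENNReal.ofReal (|t - u| ^ β)

lemma HolderPath.rpow_le {m : ℕ} {a b β : ℝ} {A : ℝ≥0} {X : ℝ → Euc m}
    (hX : HolderPath a b β A X) {p : ℝ} (hp : 0 ≤ p) {t u : ℝ} (ht : t ∈ Icc a b)
    (hu : u ∈ Icc a b) :
    ‖X t - X u‖ₑ ^ p ≤ (A : ℝ≥0∞) ^ p * ENNReal.ofReal (|t - u| ^ (β * p)) := by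
  refine (ENNReal.rpow_le_rpow (hX.holder t ht u hu) hp).trans (le_of_eq ?_)
  rw [ENNReal.mul_rpow_of_nonneg _ _ hp, ENNReal.ofReal_rpow_of_nonneg (by positivity) hp,
    ← Real.rpow_mul (abs_nonneg _)]

lemma lintegral_lintegral_const_mul_sum {ι : Type*} [Fintype ι] {μ ν : Measure ℝ} [SFinite ν]
    {C : ℝ≥0∞}
    (hC : C ≠ ∞) {p : ι → ℝ → ℝ → ℝ≥0∞} (hp : ∀ i, Measurable (Function.uncurry (p i))) :
    ∫⁻ r, ∫⁻ θ, C * ∑ i, p i r θ ∂ν ∂μ = C * ∑ i, ∫⁻ r, ∫⁻ θ, p i r θ ∂ν ∂μ := by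
  have hr : ∀ i r, Measurable (p i r) := fun i r =>
    (hp i).comp (measurable_const.prodMk measurable_id)
  have hi : ∀ i, Measurable fun r => ∫⁻ θ, p i r θ ∂ν := fun i => (hp i).lintegral_prod_right'
  simp_rw [lintegral_const_mul' _ _ hC]
  have h1 : ∀ r, ∫⁻ θ, ∑ i, p i r θ ∂ν = ∑ i, ∫⁻ θ, p i r θ ∂ν := fun r =>
    lintegral_finsetSum _ fun i _ => hr i r
  simp_rw [h1]
  rw [lintegral_finsetSum _ fun i _ => hi i]

lemma lintegral_lintegral_add {μ ν : Measure ℝ} [SFinite ν] {p q : ℝ → ℝ → ℝ≥0∞}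
    (hp : Measurable fun z : ℝ × ℝ => p z.1 z.2) :
    ∫⁻ r, ∫⁻ θ, (p r θ + q r θ) ∂ν ∂μ = (∫⁻ r, ∫⁻ θ, p r θ ∂ν ∂μ) + ∫⁻ r, ∫⁻ θ, q r θ ∂ν ∂μ := by
  have hr : ∀ r, Measurable (p r) := fun r => hp.comp (measurable_const.prodMk measurable_id)
  have hi : Measurable fun r => ∫⁻ θ, p r θ ∂ν := hp.lintegral_prod_right'
  have h1 : ∀ r, ∫⁻ θ, (p r θ + q r θ) ∂ν = (∫⁻ θ, p r θ ∂ν) + ∫⁻ θ, q r θ ∂ν := fun r =>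
    lintegral_add_left (hr r) _
  simp_rw [h1]
  rw [lintegral_add_left hi]

/-- Lowering the exponent of the kernel on a bounded interval. -/
lemma causalKernel_mul_ofReal_le {a b p q p' : ℝ} (h : p' ≤ p + q) {r θ : ℝ} (hr : r ∈ Icc a b)
    (hθ : θ ∈ Icc a b) :
    causalKernel p r θ * ENNReal.ofReal (|r - θ| ^ q) ≤
      ENNReal.ofReal ((b - a) ^ (p + q - p')) * causalKernel p' r θ := by
  unfold causalKernel
  split_ifs with hlt
  · have hpos : 0 < r - θ := by linarith
    rw [abs_of_pos hpos, ← ENNReal.ofReal_mul (by positivity), ← Real.rpow_add hpos,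
      ← ENNReal.ofReal_mul (Real.rpow_nonneg (by linarith [hr.2, hθ.1]) _)]
    refine ENNReal.ofReal_le_ofReal ?_
    calc (r - θ) ^ (p + q) = (r - θ) ^ (p + q - p') * (r - θ) ^ p' := by
          rw [← Real.rpow_add hpos, sub_add_cancel]
      _ ≤ _ := by
          gcongr
          · exact hr.2
          · exact hθ.1
  · simp

section
variable {m : ℕ} {K : ℝ≥0} {f : Euc m → ℝ} {s a b β : ℝ} {A : ℝ≥0} {X : ℝ → Euc m}

/-- The fractional double integral of the Taylor remainder along the path. -/
lemma LipschitzBV.lintegral_taylorRemainder_le (hf : LipschitzBV K f) (hs : 0 < s)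
    (hX : HolderPath a b β A X) {α ε : ℝ} (hε : 0 < ε) (he : α + ε ≤ β * (1 + s)) :
    ∫⁻ r in Icc a b, ∫⁻ θ in Icc a b, causalKernel (-(α + 1)) r θ * ‖taylorRemainder f X θ r‖ₑ ≤
      ENNReal.ofReal (2 * scaleConst m s + 1) * A ^ (1 + s) *
        ENNReal.ofReal ((b - a) ^ (β * (1 + s) - α - ε)) *
        ∑ i, (segmentVariability a b s ε (partialDeriv i f) X +
          ENNReal.ofReal ((b - a) ^ ε / ε) * variabilityNorm a b s (partialDeriv i f) X) := by
  obtain ⟨C, hC⟩ : ∃ C : ℝ≥0∞, C = ENNReal.ofReal (2 * scaleConst m s + 1) * A ^ (1 + s) *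
        ENNReal.ofReal ((b - a) ^ (β * (1 + s) - α - ε)) := ⟨_, rfl⟩
  have hCt : C ≠ ∞ := by
    rw [hC]
    exact ENNReal.mul_ne_top (ENNReal.mul_ne_top ENNReal.ofReal_ne_top
      (ENNReal.rpow_ne_top_of_nonneg (by linarith) ENNReal.coe_ne_top)) ENNReal.ofReal_ne_top
  rw [← hC]
  obtain ⟨T, hT⟩ : ∃ T : Fin m → ℝ → ℝ → ℝ≥0∞, T = fun i r θ => ∫⁻ t in Icc (0 : ℝ) 1,
    derivPotential s f i (t • X r + (1 - t) • X θ) * ENNReal.ofReal (t ^ s) := ⟨_, rfl⟩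
  have hTm : ∀ i, Measurable (Function.uncurry (T i)) := by
    intro i
    rw [hT]
    have hc : Continuous fun q : (ℝ × ℝ) × ℝ => q.2 • X q.1.1 + (1 - q.2) • X q.1.2 := by
      have := hX.cont
      fun_prop
    exact Measurable.lintegral_prod_right'
      (f := fun q : (ℝ × ℝ) × ℝ => derivPotential s f i (q.2 • X q.1.1 + (1 - q.2) • X q.1.2) *
        ENNReal.ofReal (q.2 ^ s))
      (((measurable_derivPotential (hf.bv i)).comp hc.measurable).mul
        (measurable_snd.pow_const s).ennreal_ofReal)
  have hPm : ∀ i, Measurable fun t => derivPotential s f i (X t) := fun i =>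
    (measurable_derivPotential (hf.bv i)).comp hX.cont.measurable
  have hk := measurable_causalKernel (ε - 1)
  calc ∫⁻ r in Icc a b, ∫⁻ θ in Icc a b, causalKernel (-(α + 1)) r θ * ‖taylorRemainder f X θ r‖ₑ
      ≤ ∫⁻ r in Icc a b, ∫⁻ θ in Icc a b, C * ∑ i, (causalKernel (ε - 1) r θ * T i r θ +
          causalKernel (ε - 1) r θ * derivPotential s f i (X θ)) := by
        refine setLIntegral_mono' measurableSet_Icc fun r hr =>
          setLIntegral_mono' measurableSet_Icc fun θ hθ => ?_
        have h1 := hf.enorm_remainder_le hs (X θ) (X r)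
        have h2 := hX.rpow_le (p := 1 + s) (by linarith) hr hθ
        have h3 := causalKernel_mul_ofReal_le (p := -(α + 1)) (q := β * (1 + s)) (p' := ε - 1)
          (by linarith) hr hθ
        rw [show -(α + 1) + β * (1 + s) - (ε - 1) = β * (1 + s) - α - ε by ring] at h3
        obtain ⟨S, hS⟩ : ∃ S, S = ∑ i, (T i r θ + derivPotential s f i (X θ)) := ⟨_, rfl⟩
        have e : ∑ i, ((∫⁻ t in Icc (0 : ℝ) 1, derivPotential s f i (t • X r + (1 - t) • X θ) *
          ENNReal.ofReal (t ^ s)) + derivPotential s f i (X θ)) = S := by rw [hS, hT]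
        rw [e] at h1
        simp_rw [← mul_add]
        rw [← Finset.mul_sum, ← hS]
        calc _ ≤ causalKernel (-(α + 1)) r θ * (ENNReal.ofReal (2 * scaleConst m s + 1) *
              (A ^ (1 + s) * ENNReal.ofReal (|r - θ| ^ (β * (1 + s))) * S)) := by
              gcongr
              exact h1.trans (by gcongr)
          _ = ENNReal.ofReal (2 * scaleConst m s + 1) * A ^ (1 + s) * (causalKernel (-(α + 1)) r θ *
              ENNReal.ofReal (|r - θ| ^ (β * (1 + s)))) * S := by ring
          _ ≤ ENNReal.ofReal (2 * scaleConst m s + 1) * A ^ (1 + s) *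
              (ENNReal.ofReal ((b - a) ^ (β * (1 + s) - α - ε)) * causalKernel (ε - 1) r θ) * S := by
              gcongr
          _ = _ := by rw [hC]; ring
    _ = C * ∑ i, ∫⁻ r in Icc a b, ∫⁻ θ in Icc a b, (causalKernel (ε - 1) r θ * T i r θ +
          causalKernel (ε - 1) r θ * derivPotential s f i (X θ)) :=
        lintegral_lintegral_const_mul_sum hCt fun i =>
          (hk.mul (hTm i)).add (hk.mul ((hPm i).comp measurable_snd))
    _ ≤ _ := by
        gcongr with i
        rw [lintegral_lintegral_add (hk.mul (hTm i))]
        refine add_le_add ?_ (lintegral_causalKernel_mul_right hε (hPm i))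
        refine lintegral_mono fun r => lintegral_mono fun θ => ?_
        rw [hT]
        refine mul_le_mul' ?_ le_rfl
        unfold causalKernel
        split_ifs with hlt
        · rw [edist_dist, Real.dist_eq, abs_of_pos (by linarith), ENNReal.ofReal_rpow_of_pos
            (by linarith)]
        · exact zero_le

/-- The fractional double integral of the increments of a partial derivative along the path. -/
lemma LipschitzBV.lintegral_partialDeriv_sub_le (hf : LipschitzBV K f) (hs : 0 < s)
    (hX : HolderPath a b β A X)
    (hV : ∀ᵐ t ∂volume.restrict (Icc a b), ∀ i, derivPotential s f i (X t) ≠ ∞) (i : Fin m)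
    {γ : ℝ} (hγ : γ < β * s) :
    ∫⁻ r in Icc a b, ∫⁻ θ in Icc a b, causalKernel (-(γ + 1)) r θ *
        ‖partialDeriv i f (X r) - partialDeriv i f (X θ)‖ₑ ≤
      2 * ENNReal.ofReal (2 * scaleConst m s) * A ^ s *
        ENNReal.ofReal ((b - a) ^ (β * s - γ) / (β * s - γ)) *
        variabilityNorm a b s (partialDeriv i f) X := by
  obtain ⟨C, hC⟩ : ∃ C : ℝ≥0∞, C = ENNReal.ofReal (2 * scaleConst m s) * A ^ s := ⟨_, rfl⟩
  have hCt : C ≠ ∞ := by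
    rw [hC]
    exact ENNReal.mul_ne_top ENNReal.ofReal_ne_top
      (ENNReal.rpow_ne_top_of_nonneg hs.le ENNReal.coe_ne_top)
  have hPm : Measurable fun t => derivPotential s f i (X t) :=
    (measurable_derivPotential (hf.bv i)).comp hX.cont.measurable
  have hk := measurable_causalKernel (β * s - γ - 1)
  have hδ : 0 < β * s - γ := by linarith
  calc ∫⁻ r in Icc a b, ∫⁻ θ in Icc a b, causalKernel (-(γ + 1)) r θ *
        ‖partialDeriv i f (X r) - partialDeriv i f (X θ)‖ₑ
      ≤ ∫⁻ r in Icc a b, ∫⁻ θ in Icc a b, C *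
          (causalKernel (β * s - γ - 1) r θ * derivPotential s f i (X r) +
          causalKernel (β * s - γ - 1) r θ * derivPotential s f i (X θ)) := by
        refine lintegral_mono_ae ?_
        filter_upwards [hV, ae_restrict_mem measurableSet_Icc] with r hr hrI
        refine lintegral_mono_ae ?_
        filter_upwards [hV, ae_restrict_mem measurableSet_Icc] with θ hθ hθI
        have h1 := hf.enorm_partialDeriv_sub_le hs hr hθ i
        rw [← enorm_neg (X θ - X r), neg_sub] at h1
        have h2 := hX.rpow_le hs.le hrI hθI
        have h3 := causalKernel_mul_ofReal_le (p := -(γ + 1)) (q := β * s) (p' := β * s - γ - 1)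
          (by linarith) hrI hθI
        rw [show -(γ + 1) + β * s - (β * s - γ - 1) = 0 by ring, Real.rpow_zero, ENNReal.ofReal_one,
          one_mul] at h3
        calc _ ≤ causalKernel (-(γ + 1)) r θ * (ENNReal.ofReal (2 * scaleConst m s) *
              (A ^ s * ENNReal.ofReal (|r - θ| ^ (β * s)) *
              (derivPotential s f i (X r) + derivPotential s f i (X θ)))) := by
              gcongr
              exact h1.trans (by gcongr)
          _ = C * ((causalKernel (-(γ + 1)) r θ * ENNReal.ofReal (|r - θ| ^ (β * s))) *
              (derivPotential s f i (X r) + derivPotential s f i (X θ))) := by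
              rw [hC]; ring
          _ ≤ C * (causalKernel (β * s - γ - 1) r θ *
              (derivPotential s f i (X r) + derivPotential s f i (X θ))) := by gcongr
          _ = _ := by rw [mul_add]
    _ = C * ((∫⁻ r in Icc a b, ∫⁻ θ in Icc a b,
          causalKernel (β * s - γ - 1) r θ * derivPotential s f i (X r)) +
          ∫⁻ r in Icc a b, ∫⁻ θ in Icc a b,
          causalKernel (β * s - γ - 1) r θ * derivPotential s f i (X θ)) := by
        simp_rw [lintegral_const_mul' _ _ hCt]
        rw [lintegral_lintegral_add (hk.mul (hPm.comp measurable_fst))]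
    _ ≤ C * (ENNReal.ofReal ((b - a) ^ (β * s - γ) / (β * s - γ)) *
          variabilityNorm a b s (partialDeriv i f) X +
          ENNReal.ofReal ((b - a) ^ (β * s - γ) / (β * s - γ)) *
          variabilityNorm a b s (partialDeriv i f) X) := by
        gcongr
        · exact lintegral_causalKernel_mul_left hδ
        · exact lintegral_causalKernel_mul_right hδ hPm
    _ = _ := by rw [hC]; ring

/-- The weighted integral of a partial derivative along the path. The supremum of the derivative is
not allowed in the bound; the Hardy inequality replaces it by the mean and the increments. -/
lemma LipschitzBV.lintegral_partialDeriv_weight_le (hf : LipschitzBV K f) (hs : 0 < s)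
    (hX : HolderPath a b β A X) (hab : a < b)
    (hV : ∀ᵐ t ∂volume.restrict (Icc a b), ∀ i, derivPotential s f i (X t) ≠ ∞) (i : Fin m)
    {γ : ℝ} (hγ0 : 0 < γ) (hγ1 : γ < 1) (hγ : γ < β * s) :
    ∫⁻ r in Icc a b, ‖partialDeriv i f (X r)‖ₑ * ENNReal.ofReal ((r - a) ^ (-γ)) ≤
      ENNReal.ofReal (1 / (1 - 2 ^ (γ - 1))) * (ENNReal.ofReal (((b - a) / 2) ^ (-γ)) *
        (∫⁻ r in Icc a b, ‖partialDeriv i f (X r)‖ₑ) + 2 * (ENNReal.ofReal (2 * scaleConst m s) *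
        A ^ s * ENNReal.ofReal ((b - a) ^ (β * s - γ))) *
        variabilityNorm a b s (partialDeriv i f) X) := by
  have hXa : Continuous fun u => X (a + u) := hX.cont.comp (by fun_prop)
  have hPm : Measurable fun u => derivPotential s f i (X (a + u)) :=
    (measurable_derivPotential (hf.bv i)).comp hXa.measurable
  have hGm : Measurable fun u => partialDeriv i f (X (a + u)) :=
    (measurable_partialDeriv hf.lip i).comp hXa.measurable
  unfold variabilityNorm
  rw [lintegral_Icc_eq_Ioc_add, lintegral_Icc_eq_Ioc_add, lintegral_Icc_eq_Ioc_add]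
  simp only [add_sub_cancel_left]
  refine lintegral_hardy_le hγ0 hγ1 (by linarith) hGm (fun u => abs_partialDeriv_le hf.lip i _) hPm
    (ENNReal.mul_ne_top (ENNReal.mul_ne_top ENNReal.ofReal_ne_top
      (ENNReal.rpow_ne_top_of_nonneg hs.le ENNReal.coe_ne_top)) ENNReal.ofReal_ne_top) ?_
  have hV' : ∀ᵐ t, t ∈ Icc a b → ∀ i, derivPotential s f i (X t) ≠ ∞ :=
    (ae_restrict_iff' measurableSet_Icc).1 hV
  have hq1 : ∀ᵐ u : ℝ, a + u ∈ Icc a b → ∀ i, derivPotential s f i (X (a + u)) ≠ ∞ :=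
    (measurePreserving_add_left volume a).quasiMeasurePreserving.ae hV'
  have hq2 : ∀ᵐ u : ℝ, a + 2 * u ∈ Icc a b → ∀ i, derivPotential s f i (X (a + 2 * u)) ≠ ∞ := by
    have hmul : Measure.QuasiMeasurePreserving (fun u : ℝ => 2 * u) volume volume := by
      refine ⟨measurable_const_mul 2, ?_⟩
      rw [Real.map_volume_mul_left two_ne_zero]
      exact Measure.smul_absolutelyContinuous
    exact hmul.ae hq1
  filter_upwards [ae_restrict_of_ae hq1, ae_restrict_of_ae hq2, ae_restrict_mem measurableSet_Ioc]
    with u h1 h2 hu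
  have hI1 : a + u ∈ Icc a b := ⟨by linarith [hu.1], by linarith [hu.1, hu.2]⟩
  have hI2 : a + 2 * u ∈ Icc a b := ⟨by linarith [hu.1], by linarith [hu.1, hu.2]⟩
  have h3 := hf.enorm_partialDeriv_sub_le hs (h1 hI1) (h2 hI2) i
  have h4 := hX.rpow_le hs.le hI2 hI1
  rw [show a + 2 * u - (a + u) = u by ring, abs_of_pos hu.1] at h4
  have h5 : ENNReal.ofReal (u ^ (β * s)) * ENNReal.ofReal (u ^ (-γ)) ≤
      ENNReal.ofReal ((b - a) ^ (β * s - γ)) := by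
    rw [← ENNReal.ofReal_mul (Real.rpow_nonneg hu.1.le _), ← Real.rpow_add hu.1]
    refine ENNReal.ofReal_le_ofReal ?_
    exact Real.rpow_le_rpow hu.1.le (by linarith [hu.2, hu.1]) (by linarith)
  calc _ ≤ ENNReal.ofReal (2 * scaleConst m s) * (A ^ s * ENNReal.ofReal (u ^ (β * s)) *
        (derivPotential s f i (X (a + u)) + derivPotential s f i (X (a + 2 * u)))) *
        ENNReal.ofReal (u ^ (-γ)) := by
        gcongr
        exact h3.trans (by gcongr)
    _ = ENNReal.ofReal (2 * scaleConst m s) * A ^ s *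
        (ENNReal.ofReal (u ^ (β * s)) * ENNReal.ofReal (u ^ (-γ))) *
        (derivPotential s f i (X (a + u)) + derivPotential s f i (X (a + 2 * u))) := by ring
    _ ≤ _ := by gcongr

/-- The supremum along the path is bounded by the mean and the oscillation. -/
lemma LipschitzBV.enorm_comp_le (hf : LipschitzBV K f) (hX : HolderPath a b β A X) (hab : a < b)
    (hβ : 0 ≤ β) {r : ℝ} (hr : r ∈ Icc a b) :
    ‖f (X r)‖ₑ ≤ ENNReal.ofReal (1 / (b - a)) * (∫⁻ t in Icc a b, ‖f (X t)‖ₑ) +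
      K * (A * ENNReal.ofReal ((b - a) ^ β)) := by
  have hL : 0 < b - a := by linarith
  have h1 : ∀ t ∈ Icc a b, ‖f (X r)‖ₑ ≤ ‖f (X t)‖ₑ + K * (A * ENNReal.ofReal ((b - a) ^ β)) := by
    intro t ht
    have h2 : ‖f (X r) - f (X t)‖ₑ ≤ K * ‖X r - X t‖ₑ := by
      have := hf.lip (X r) (X t)
      rwa [edist_eq_enorm_sub, edist_eq_enorm_sub] at this
    have h3 : ENNReal.ofReal (|r - t| ^ β) ≤ ENNReal.ofReal ((b - a) ^ β) :=
      ENNReal.ofReal_le_ofReal (Real.rpow_le_rpow (abs_nonneg _)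
        (abs_le.2 ⟨by linarith [hr.1, ht.2], by linarith [hr.2, ht.1]⟩) hβ)
    calc ‖f (X r)‖ₑ = ‖f (X t) + (f (X r) - f (X t))‖ₑ := by rw [add_sub_cancel]
      _ ≤ ‖f (X t)‖ₑ + ‖f (X r) - f (X t)‖ₑ := enorm_add_le _ _
      _ ≤ _ := by
        gcongr
        exact h2.trans (by gcongr; exact (hX.holder r hr t ht).trans (by gcongr))
  have h4 : ENNReal.ofReal (b - a) * ‖f (X r)‖ₑ ≤ (∫⁻ t in Icc a b, ‖f (X t)‖ₑ) +
      ENNReal.ofReal (b - a) * (K * (A * ENNReal.ofReal ((b - a) ^ β))) := by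
    have := setLIntegral_mono' (μ := volume) measurableSet_Icc h1
    rw [lintegral_add_right _ measurable_const, setLIntegral_const, setLIntegral_const,
      Real.volume_Icc] at this
    rw [mul_comm, mul_comm (ENNReal.ofReal (b - a))]
    exact this
  have h5 : ENNReal.ofReal (1 / (b - a)) * ENNReal.ofReal (b - a) = 1 := by
    rw [← ENNReal.ofReal_mul (by positivity), one_div_mul_cancel hL.ne', ENNReal.ofReal_one]
  calc ‖f (X r)‖ₑ = ENNReal.ofReal (1 / (b - a)) * (ENNReal.ofReal (b - a) * ‖f (X r)‖ₑ) := by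
        rw [← mul_assoc, h5, one_mul]
    _ ≤ ENNReal.ofReal (1 / (b - a)) * ((∫⁻ t in Icc a b, ‖f (X t)‖ₑ) +
      ENNReal.ofReal (b - a) * (K * (A * ENNReal.ofReal ((b - a) ^ β)))) := by gcongr
    _ = _ := by rw [mul_add, ← mul_assoc (ENNReal.ofReal (1 / (b - a))), h5, one_mul]

end

/-! ### Weighted integrals of the increments -/

section
variable {m : ℕ}

/-- The function `f(X)` on `[a, b]`, continued by zero. -/
noncomputable def pathValue (a b : ℝ) (f : Euc m → ℝ) (X : ℝ → Euc m) (t : ℝ) : ℝ :=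
  (Icc a b).indicator (fun t => f (X t)) t

/-- The coordinates of `X`, centred at time `a`. -/
noncomputable def pathCoord (a : ℝ) (X : ℝ → Euc m) (i : Fin m) (t : ℝ) : ℝ := X t i - X a i

/-- The compensated increments of `f(X)`, with `∂ᵢf(X)` as compensator. -/
noncomputable def pathCompInc (a b : ℝ) (f : Euc m → ℝ) (X : ℝ → Euc m) (r v : ℝ) : ℝ :=
  compInc (pathValue a b f X) (fun i => pathValue a b (partialDeriv i f) X) (pathCoord a X) r v

/-- The increments of `∂ᵢf(X)`. -/
noncomputable def pathDerivInc (a b : ℝ) (f : Euc m → ℝ) (X : ℝ → Euc m) (i : Fin m) (r v : ℝ) : ℝ :=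
  pathValue a b (partialDeriv i f) X r - pathValue a b (partialDeriv i f) X (r - v)

lemma pathValue_of_mem {a b t : ℝ} (f : Euc m → ℝ) (X : ℝ → Euc m) (ht : t ∈ Icc a b) :
    pathValue a b f X t = f (X t) := indicator_of_mem ht _

lemma pathValue_of_notMem {a b t : ℝ} (f : Euc m → ℝ) (X : ℝ → Euc m) (ht : t ∉ Icc a b) :
    pathValue a b f X t = 0 := indicator_of_notMem ht _

lemma pathCompInc_eq {a b r : ℝ} (f : Euc m → ℝ) (X : ℝ → Euc m) (hr : r ∈ Icc a b) {v : ℝ}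
    (hv : 0 < v) (hv2 : v ≤ r - a) : pathCompInc a b f X r v = taylorRemainder f X (r - v) r := by
  have h : r - v ∈ Icc a b := ⟨by linarith, by linarith [hr.2]⟩
  unfold pathCompInc compInc taylorRemainder pathCoord
  simp only [pathValue_of_mem _ _ h, pathValue_of_mem _ _ hr, sub_sub_sub_cancel_right]

lemma pathCompInc_eq_of_lt {a b r : ℝ} (f : Euc m → ℝ) (X : ℝ → Euc m) (hr : r ∈ Icc a b) {v : ℝ}
    (hv : r - a < v) : pathCompInc a b f X r v = f (X r) := by
  have h : r - v ∉ Icc a b := fun h => by linarith [h.1]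
  unfold pathCompInc compInc
  simp [pathValue_of_notMem _ _ h, pathValue_of_mem _ _ hr]

lemma pathDerivInc_eq {a b r : ℝ} (f : Euc m → ℝ) (X : ℝ → Euc m) (i : Fin m) (hr : r ∈ Icc a b)
    {v : ℝ} (hv : 0 < v) (hv2 : v ≤ r - a) :
    pathDerivInc a b f X i r v = partialDeriv i f (X r) - partialDeriv i f (X (r - v)) := by
  have h : r - v ∈ Icc a b := ⟨by linarith, by linarith [hr.2]⟩
  unfold pathDerivInc
  simp only [pathValue_of_mem _ _ h, pathValue_of_mem _ _ hr]

lemma pathDerivInc_eq_of_lt {a b r : ℝ} (f : Euc m → ℝ) (X : ℝ → Euc m) (i : Fin m)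
    (hr : r ∈ Icc a b) {v : ℝ} (hv : r - a < v) :
    pathDerivInc a b f X i r v = partialDeriv i f (X r) := by
  have h : r - v ∉ Icc a b := fun h => by linarith [h.1]
  unfold pathDerivInc
  simp [pathValue_of_notMem _ _ h, pathValue_of_mem _ _ hr]

lemma measurable_pathValue {a b : ℝ} {f : Euc m → ℝ} {X : ℝ → Euc m} (hf : Measurable f)
    (hX : Continuous X) : Measurable (pathValue a b f X) :=
  (hf.comp hX.measurable).indicator measurableSet_Icc

lemma measurable_pathCoord {a : ℝ} {X : ℝ → Euc m} (hX : Continuous X) (i : Fin m) :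
    Measurable (pathCoord a X i) := by
  unfold pathCoord
  have : Continuous fun t => X t i := by fun_prop
  exact this.measurable.sub_const _

lemma measurable_pathCompInc {a b : ℝ} {K : ℝ≥0} {f : Euc m → ℝ} {X : ℝ → Euc m}
    (hf : LipschitzWith K f) (hX : Continuous X) :
    Measurable (Function.uncurry (pathCompInc a b f X)) :=
  measurable_compInc (measurable_pathValue hf.continuous.measurable hX)
    (fun i => measurable_pathValue (measurable_partialDeriv hf i) hX) (measurable_pathCoord hX)

lemma measurable_pathDerivInc {a b : ℝ} {K : ℝ≥0} {f : Euc m → ℝ} {X : ℝ → Euc m}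
    (hf : LipschitzWith K f) (hX : Continuous X) (i : Fin m) :
    Measurable (Function.uncurry (pathDerivInc a b f X i)) := by
  have h := measurable_pathValue (a := a) (b := b) (measurable_partialDeriv hf i) hX
  exact (h.comp measurable_fst).sub (h.comp (measurable_fst.sub measurable_snd))

/-- The weighted double integral of the compensated increments of `f(X)`. -/
noncomputable def compEnergy (a b α : ℝ) (f : Euc m → ℝ) (X : ℝ → Euc m) : ℝ≥0∞ :=
  ∫⁻ r in Icc a b, ∫⁻ v in Ioi (0 : ℝ), ‖pathCompInc a b f X r v‖ₑ * ENNReal.ofReal (v ^ (-(α + 1)))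

/-- The weighted double integral of the increments of `∂ᵢf(X)`. -/
noncomputable def derivEnergy (a b γ : ℝ) (f : Euc m → ℝ) (X : ℝ → Euc m) (i : Fin m) : ℝ≥0∞ :=
  ∫⁻ r in Icc a b, ∫⁻ v in Ioi (0 : ℝ), ‖pathDerivInc a b f X i r v‖ₑ *
    ENNReal.ofReal (v ^ (-(γ + 1)))

lemma ae_mem_Ioc (a b : ℝ) : ∀ᵐ r ∂volume.restrict (Icc a b), r ∈ Ioc a b := by
  rw [← restrict_Ioc_eq_restrict_Icc]
  exact ae_restrict_mem measurableSet_Ioc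

/-- The double integral of the compensated increments consists of the Taylor remainders and the
boundary term, whose singularity `(r - a)^{-α}` is integrable. -/
lemma exists_compEnergy_le (m : ℕ) {a b β s ε α : ℝ} (hab : a < b) (hβ : 0 ≤ β) (hs : 0 < s)
    (hε : 0 < ε) (hα0 : 0 < α) (hα1 : α < 1) (hα : α + ε ≤ β * (1 + s)) :
    ∃ C : ℝ≥0, ∀ (K A : ℝ≥0) (f : Euc m → ℝ) (X : ℝ → Euc m), LipschitzBV K f →
      HolderPath a b β A X → compEnergy a b α f X ≤
        C * ((∫⁻ t in Icc a b, ‖f (X t)‖ₑ) + K * A +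
          (∑ i, segmentVariability a b s ε (partialDeriv i f) X) * A ^ (1 + s) +
          (∑ i, variabilityNorm a b s (partialDeriv i f) X) * A ^ (1 + s)) := by
  have hL : 0 < b - a := by linarith
  obtain ⟨c1, hc1⟩ : ∃ c : ℝ≥0, (c : ℝ≥0∞) = ENNReal.ofReal (2 * scaleConst m s + 1) *
    ENNReal.ofReal ((b - a) ^ (β * (1 + s) - α - ε)) := ⟨_, rfl⟩
  obtain ⟨c2, hc2⟩ : ∃ c : ℝ≥0, (c : ℝ≥0∞) = ENNReal.ofReal ((b - a) ^ ε / ε) := ⟨_, rfl⟩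
  obtain ⟨c3, hc3⟩ : ∃ c : ℝ≥0, (c : ℝ≥0∞) =
    ENNReal.ofReal (1 / α) * ENNReal.ofReal ((b - a) ^ (1 - α) / (1 - α)) := ⟨_, rfl⟩
  obtain ⟨c4, hc4⟩ : ∃ c : ℝ≥0, (c : ℝ≥0∞) = ENNReal.ofReal (1 / (b - a)) := ⟨_, rfl⟩
  obtain ⟨c5, hc5⟩ : ∃ c : ℝ≥0, (c : ℝ≥0∞) = ENNReal.ofReal ((b - a) ^ β) := ⟨_, rfl⟩
  refine ⟨c3 * c4 + c3 * c5 + c1 + c1 * c2, fun K A f X hf hX => ?_⟩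
  obtain ⟨N, hN⟩ : ∃ N, N = ∫⁻ t in Icc a b, ‖f (X t)‖ₑ := ⟨_, rfl⟩
  obtain ⟨S, hS⟩ : ∃ S, S = ∑ i, segmentVariability a b s ε (partialDeriv i f) X := ⟨_, rfl⟩
  obtain ⟨V, hV⟩ : ∃ V, V = ∑ i, variabilityNorm a b s (partialDeriv i f) X := ⟨_, rfl⟩
  have h1 := hf.lintegral_taylorRemainder_le hs hX hε hα
  rw [Finset.sum_add_distrib, ← Finset.mul_sum, ← hS, ← hV, ← hc2,
    mul_right_comm (ENNReal.ofReal (2 * scaleConst m s + 1)), ← hc1] at h1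
  have h2 : ∫⁻ r in Icc a b, ‖f (X r)‖ₑ * ENNReal.ofReal ((r - a) ^ (-α) / α) ≤
      c3 * (c4 * N + K * (A * c5)) := by
    rw [hc3, hc4, hc5, hN]
    calc _ ≤ ∫⁻ r in Icc a b, (ENNReal.ofReal (1 / (b - a)) * (∫⁻ t in Icc a b, ‖f (X t)‖ₑ) +
          K * (A * ENNReal.ofReal ((b - a) ^ β))) * ENNReal.ofReal (1 / α) *
          ENNReal.ofReal ((r - a) ^ (-α)) := by
          refine setLIntegral_mono' measurableSet_Icc fun r hr => ?_
          rw [mul_assoc, ← ENNReal.ofReal_mul (by positivity), one_div_mul_eq_div]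
          gcongr
          exact hf.enorm_comp_le hX hab hβ hr
      _ = (ENNReal.ofReal (1 / (b - a)) * (∫⁻ t in Icc a b, ‖f (X t)‖ₑ) +
          K * (A * ENNReal.ofReal ((b - a) ^ β))) * ENNReal.ofReal (1 / α) *
          ENNReal.ofReal ((b - a) ^ (1 - α) / (1 - α)) := by
          have hm : Measurable fun r : ℝ => ENNReal.ofReal ((r - a) ^ (-α)) :=
            ((measurable_id.sub_const a).pow_const _).ennreal_ofReal
          rw [lintegral_const_mul _ hm,
            lintegral_Icc_eq_Ioc_add a b fun r => ENNReal.ofReal ((r - a) ^ (-α))]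
          simp only [add_sub_cancel_left]
          rw [show -α = (1 - α) - 1 by ring, lintegral_rpow_Ioc (by linarith) hL.le]
      _ = _ := by ring
  have h3 : compEnergy a b α f X ≤ c1 * A ^ (1 + s) * (S + c2 * V) +
      c3 * (c4 * N + K * (A * c5)) := by
    refine le_trans ?_ (add_le_add h1 h2)
    have hm : Measurable fun r => ‖f (X r)‖ₑ * ENNReal.ofReal ((r - a) ^ (-α) / α) :=
      (hf.lip.continuous.measurable.comp hX.cont.measurable).enorm.mul
        (((measurable_id.sub_const a).pow_const _).div_const _).ennreal_ofReal
    rw [← lintegral_add_right _ hm]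
    refine lintegral_mono_ae ?_
    filter_upwards [ae_mem_Ioc a b] with r hr
    exact lintegral_marchaud_le hα0 hr
      (fun v hv hv2 => pathCompInc_eq f X (Ioc_subset_Icc_self hr) hv hv2)
      (fun v hv => pathCompInc_eq_of_lt f X (Ioc_subset_Icc_self hr) hv)
  refine h3.trans ?_
  rw [← hN, ← hS, ← hV]
  calc (c1 : ℝ≥0∞) * A ^ (1 + s) * (S + c2 * V) + c3 * (c4 * N + K * (A * c5))
      = c3 * c4 * N + c3 * c5 * (K * A) + c1 * (S * A ^ (1 + s)) +
        c1 * c2 * (V * A ^ (1 + s)) := by ring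
    _ ≤ _ := by
      rw [mul_add, mul_add, mul_add]
      push_cast
      gcongr
      · exact le_add_right (le_add_right le_self_add)
      · exact le_add_right (le_add_right le_add_self)
      · exact le_add_right le_add_self
      · exact le_add_self

/-- The double integral of the increments of `∂ᵢf(X)` consists of the increments within `[a, b]` and
the boundary term with singularity `(r - a)^{-γ}`. -/
lemma exists_derivEnergy_le (m : ℕ) {a b β s γ : ℝ} (hab : a < b) (hs : 0 < s)
    (hγ0 : 0 < γ) (hγ1 : γ < 1) (hγ : γ < β * s) :
    ∃ C : ℝ≥0, ∀ (K A : ℝ≥0) (f : Euc m → ℝ) (X : ℝ → Euc m), LipschitzBV K f →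
      HolderPath a b β A X →
      (∀ᵐ t ∂volume.restrict (Icc a b), ∀ i, derivPotential s f i (X t) ≠ ∞) → ∀ i,
      derivEnergy a b γ f X i ≤ C * ((∫⁻ t in Icc a b, ‖partialDeriv i f (X t)‖ₑ) +
        variabilityNorm a b s (partialDeriv i f) X * A ^ s) := by
  obtain ⟨c1, hc1⟩ : ∃ c : ℝ≥0, (c : ℝ≥0∞) = 2 * ENNReal.ofReal (2 * scaleConst m s) *
    ENNReal.ofReal ((b - a) ^ (β * s - γ) / (β * s - γ)) :=
    ⟨2 * Real.toNNReal (2 * scaleConst m s) *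
      Real.toNNReal ((b - a) ^ (β * s - γ) / (β * s - γ)), by push_cast; rfl⟩
  obtain ⟨c2, hc2⟩ : ∃ c : ℝ≥0, (c : ℝ≥0∞) = ENNReal.ofReal (1 / γ) *
    ENNReal.ofReal (1 / (1 - 2 ^ (γ - 1))) := ⟨_, rfl⟩
  obtain ⟨c3, hc3⟩ : ∃ c : ℝ≥0, (c : ℝ≥0∞) = ENNReal.ofReal (((b - a) / 2) ^ (-γ)) := ⟨_, rfl⟩
  obtain ⟨c4, hc4⟩ : ∃ c : ℝ≥0, (c : ℝ≥0∞) = 2 * (ENNReal.ofReal (2 * scaleConst m s) *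
    ENNReal.ofReal ((b - a) ^ (β * s - γ))) :=
    ⟨2 * (Real.toNNReal (2 * scaleConst m s) * Real.toNNReal ((b - a) ^ (β * s - γ))),
      by push_cast; rfl⟩
  refine ⟨c2 * c3 + (c1 + c2 * c4), fun K A f X hf hX hV i => ?_⟩
  have h1 := hf.lintegral_partialDeriv_sub_le hs hX hV i hγ
  have h2 := hf.lintegral_partialDeriv_weight_le hs hX hab hV i hγ0 hγ1 hγ
  obtain ⟨N, hN⟩ : ∃ N, N = ∫⁻ t in Icc a b, ‖partialDeriv i f (X t)‖ₑ := ⟨_, rfl⟩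
  obtain ⟨V, hVd⟩ : ∃ V, V = variabilityNorm a b s (partialDeriv i f) X := ⟨_, rfl⟩
  have hm : Measurable fun r => ‖partialDeriv i f (X r)‖ₑ * ENNReal.ofReal ((r - a) ^ (-γ)) :=
    ((measurable_partialDeriv hf.lip i).comp hX.cont.measurable).enorm.mul
      ((measurable_id.sub_const a).pow_const _).ennreal_ofReal
  have h3 : derivEnergy a b γ f X i ≤ (∫⁻ r in Icc a b, ∫⁻ θ in Icc a b,
      causalKernel (-(γ + 1)) r θ * ‖partialDeriv i f (X r) - partialDeriv i f (X θ)‖ₑ) +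
      ENNReal.ofReal (1 / γ) *
      ∫⁻ r in Icc a b, ‖partialDeriv i f (X r)‖ₑ * ENNReal.ofReal ((r - a) ^ (-γ)) := by
    rw [← lintegral_const_mul' _ _ ENNReal.ofReal_ne_top, ← lintegral_add_right _ (hm.const_mul _)]
    refine lintegral_mono_ae ?_
    filter_upwards [ae_mem_Ioc a b] with r hr
    refine (lintegral_marchaud_le hγ0 hr
      (h := fun θ => partialDeriv i f (X r) - partialDeriv i f (X θ))
      (fun v hv hv2 => pathDerivInc_eq f X i (Ioc_subset_Icc_self hr) hv hv2)
      (fun v hv => pathDerivInc_eq_of_lt f X i (Ioc_subset_Icc_self hr) hv)).trans (le_of_eq ?_)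
    rw [mul_left_comm, ← ENNReal.ofReal_mul (by positivity), one_div_mul_eq_div]
  refine h3.trans ((add_le_add h1 (mul_le_mul' le_rfl h2)).trans ?_)
  rw [← hN, ← hVd]
  calc _ = ENNReal.ofReal (1 / γ) * ENNReal.ofReal (1 / (1 - 2 ^ (γ - 1))) *
        ENNReal.ofReal (((b - a) / 2) ^ (-γ)) * N + (2 * ENNReal.ofReal (2 * scaleConst m s) *
        ENNReal.ofReal ((b - a) ^ (β * s - γ) / (β * s - γ)) + ENNReal.ofReal (1 / γ) *
        ENNReal.ofReal (1 / (1 - 2 ^ (γ - 1))) * (2 * (ENNReal.ofReal (2 * scaleConst m s) *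
        ENNReal.ofReal ((b - a) ^ (β * s - γ))))) * (V * A ^ s) := by ring
    _ = c2 * c3 * N + (c1 + c2 * c4) * (V * A ^ s) := by rw [← hc1, ← hc2, ← hc3, ← hc4]
    _ ≤ _ := by
      rw [mul_add, ENNReal.coe_add, ENNReal.coe_add, ENNReal.coe_mul, ENNReal.coe_mul]
      exact add_le_add (mul_le_mul' le_self_add le_rfl) (mul_le_mul' le_add_self le_rfl)

end

/-! ### Right sided derivatives of the integrator and of the area -/

/-- The point of `[a, b]` nearest to `t`. -/
noncomputable def clamp (a b t : ℝ) : ℝ := max a (min b t)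

lemma clamp_mem {a b : ℝ} (hab : a < b) (t : ℝ) : clamp a b t ∈ Icc a b :=
  ⟨le_max_left _ _, max_le hab.le (min_le_left _ _)⟩

lemma clamp_of_mem {a b t : ℝ} (ht : t ∈ Icc a b) : clamp a b t = t := by
  rw [clamp, min_eq_right ht.2, max_eq_right ht.1]

lemma clamp_of_ge {a b t : ℝ} (hab : a < b) (ht : b ≤ t) : clamp a b t = b := by
  rw [clamp, min_eq_left ht, max_eq_right hab.le]

lemma continuous_clamp (a b : ℝ) : Continuous (clamp a b) := by
  unfold clamp
  fun_prop

lemma clamp_mono (a b : ℝ) : Monotone (clamp a b) := fun s t h => by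
  unfold clamp
  gcongr

lemma clamp_add_sub_le {a b : ℝ} (hab : a < b) (t : ℝ) {v : ℝ} (hv : 0 ≤ v) :
    clamp a b (t + v) - clamp a b t ≤ min v (b - a) := by
  refine le_min ?_ (by linarith [(clamp_mem hab (t + v)).2, (clamp_mem hab t).1])
  have h1 : clamp a b (t + v) ≤ clamp a b t + v := by
    unfold clamp
    refine max_le (by linarith [le_max_left a (min b t)]) ?_
    have : min b (t + v) ≤ min b t + v := by
      rcases le_total b t with h | h
      · rw [min_eq_left h]
        linarith [min_le_left b (t + v)]
      · rw [min_eq_right h]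
        exact min_le_right _ _
    linarith [le_max_right a (min b t)]
  linarith

lemma HolderVanishing.mono {a b β C C' : ℝ} {f : ℝ → ℝ} (hab : a < b)
    (hf : HolderVanishing a b β C f) (h : C ≤ C') : HolderVanishing a b β C' f :=
  ⟨hf.measurable, hf.vanish, fun t v ht hv => (hf.holder t v ht hv).trans (by
    have : 0 ≤ min v (b - a) := le_min hv.le (by linarith)
    gcongr)⟩

lemma HolderVanishing.marchaudIntegrable {κ a b β C : ℝ} {f : ℝ → ℝ}
    (hf : HolderVanishing a b β C f) (hκ : 0 < κ) (hβ : κ < β) (hab : a < b) {r : ℝ} (hr : a ≤ r) :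
    MarchaudIntegrable κ fun v => f r - f (r + v) :=
  marchaudIntegrable_of_le hκ hβ (sub_pos.2 hab)
    (measurable_const.sub (hf.measurable.comp (measurable_const_add r)))
    fun v hv => hf.holder r v hr hv

lemma marchaud_congr {κ : ℝ} {φ φ' : ℝ → ℝ} (h : ∀ v, 0 < v → φ v = φ' v) :
    marchaud κ φ = marchaud κ φ' := by
  unfold marchaud
  congr 1
  exact setIntegral_congr_fun measurableSet_Ioi fun v hv => by rw [h v hv]

/-- A scalar component of a multiplicative functional, with explicit Hölder constants. -/
structure ScalarRough (a b β A N N₂ : ℝ) (x y : ℝ → ℝ) (z : ℝ → ℝ → ℝ) : Prop where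
  left : ∀ t ∈ Icc a b, ∀ u ∈ Icc a b, |x t - x u| ≤ A * |t - u| ^ β
  right : ∀ t ∈ Icc a b, ∀ u ∈ Icc a b, |y t - y u| ≤ N * |t - u| ^ β
  cont : ContinuousOn (fun p : ℝ × ℝ => z p.1 p.2) {p : ℝ × ℝ | a ≤ p.1 ∧ p.1 ≤ p.2 ∧ p.2 ≤ b}
  chen : ∀ s u t : ℝ, a ≤ s → s ≤ u → u ≤ t → t ≤ b →
    z s u + z u t + (x u - x s) * (y t - y u) = z s t
  bound : ∀ s t : ℝ, a ≤ s → s ≤ t → t ≤ b → |z s t| ≤ N₂ * (t - s) ^ (2 * β)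

/-- The increments `y - y(b)`, with `y` constant outside `[a, b]`. -/
noncomputable def endInc (a b : ℝ) (y : ℝ → ℝ) (t : ℝ) : ℝ := y (clamp a b t) - y b

/-- The function `t ↦ z(a, b) - z(a, t)`, continued by constants outside `[a, b]`. -/
noncomputable def areaInc (a b : ℝ) (z : ℝ → ℝ → ℝ) (t : ℝ) : ℝ := z a b - z a (clamp a b t)

/-- The real part `r ↦ κ / Γ(1 - κ) ∫₀^∞ z(r, r + v) v^{-κ-1} dv` of the right sided derivative of
the function `z` of two parameters. Writing `|v|` for `v > 0` keeps the arguments of `z` ordered for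
all `v`, so that the integrand is continuous on the whole plane. -/
noncomputable def areaMarchaud (a b κ : ℝ) (z : ℝ → ℝ → ℝ) (r : ℝ) : ℝ :=
  marchaud κ fun v => z (clamp a b r) (clamp a b (r + |v|))

lemma holderVanishing_endInc {a b β N : ℝ} (hab : a < b) (hβ : 0 < β) (hN : 0 ≤ N) {y : ℝ → ℝ}
    (hy : ∀ t ∈ Icc a b, ∀ u ∈ Icc a b, |y t - y u| ≤ N * |t - u| ^ β) :
    HolderVanishing a b β N (endInc a b y) := by
  refine ⟨?_, fun t ht => by rw [endInc, clamp_of_ge hab ht, sub_self], fun t v _ hv => ?_⟩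
  · have hc : ContinuousOn y (Icc a b) := by
      refine fun t ht => tendsto_iff_dist_tendsto_zero.2 ?_
      have h0 : Tendsto (fun u => N * |u - t| ^ β) (𝓝[Icc a b] t) (𝓝 0) := by
        have h1 : Tendsto (fun u : ℝ => N * |u - t| ^ β) (𝓝 t) (𝓝 (N * |t - t| ^ β)) :=
          (((tendsto_id.sub_const t).abs).rpow_const (Or.inr hβ.le)).const_mul N
        rw [sub_self, abs_zero, Real.zero_rpow hβ.ne', mul_zero] at h1
        exact h1.mono_left nhdsWithin_le_nhds
      refine squeeze_zero' (Eventually.of_forall fun u => dist_nonneg) ?_ h0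
      filter_upwards [self_mem_nhdsWithin] with u hu using hy u hu t ht
    have : Continuous fun t => y (clamp a b t) :=
      hc.comp_continuous (continuous_clamp a b) (clamp_mem hab)
    exact this.measurable.sub_const _
  · unfold endInc
    rw [sub_sub_sub_cancel_right, abs_sub_comm]
    refine (hy _ (clamp_mem hab _) _ (clamp_mem hab _)).trans ?_
    rw [abs_of_nonneg (sub_nonneg.2 (clamp_mono a b (by linarith)))]
    gcongr
    · exact sub_nonneg.2 (clamp_mono a b (by linarith))
    · exact clamp_add_sub_le hab t hv.le

section
variable {a b β A N N₂ κ : ℝ} {x y : ℝ → ℝ} {z : ℝ → ℝ → ℝ}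

lemma ScalarRough.diag (h : ScalarRough a b β A N N₂ x y z) {t : ℝ} (ht : t ∈ Icc a b) :
    z t t = 0 := by
  have := h.chen t t t ht.1 le_rfl le_rfl ht.2
  rw [sub_self, zero_mul] at this
  linarith

lemma ScalarRough.continuous_comp (h : ScalarRough a b β A N N₂ x y z) (hab : a < b) {α : Type*}
    [TopologicalSpace α] {p q : α → ℝ} (hp : Continuous p) (hq : Continuous q)
    (hpq : ∀ w, p w ≤ q w) : Continuous fun w => z (clamp a b (p w)) (clamp a b (q w)) :=
  h.cont.comp_continuous (f := fun w => (clamp a b (p w), clamp a b (q w)))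
    (((continuous_clamp a b).comp hp).prodMk ((continuous_clamp a b).comp hq))
    fun w => ⟨(clamp_mem hab _).1, clamp_mono a b (hpq w), (clamp_mem hab _).2⟩

/-- By Chen's relation `z(a, t) - z(a, u)` is the sum of `z(u, t)` and a product of increments, hence
of order `β`. -/
lemma ScalarRough.holderVanishing_areaInc (h : ScalarRough a b β A N N₂ x y z) (hab : a < b)
    (hβ : 0 < β) (hA : 0 ≤ A) (hN : 0 ≤ N) (hN₂ : 0 ≤ N₂) :
    HolderVanishing a b β (N₂ * (b - a) ^ β + A * (b - a) ^ β * N) (areaInc a b z) := by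
  have hL : 0 < b - a := by linarith
  refine ⟨?_, fun t ht => by rw [areaInc, clamp_of_ge hab ht, sub_self], fun t v ht hv => ?_⟩
  · have := h.continuous_comp hab (p := fun _ => a) (q := fun t => max a t) (by fun_prop)
      (by fun_prop) fun t => le_max_left _ _
    have e : areaInc a b z = fun t => z a b - z (clamp a b a) (clamp a b (max a t)) := by
      ext t
      rw [areaInc, clamp_of_mem (left_mem_Icc.2 hab.le)]
      congr 2
      unfold clamp
      rcases le_total a t with h | h
      · rw [max_eq_right h]
      · rw [max_eq_left h, min_eq_right hab.le, min_eq_right (h.trans hab.le), max_self,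
          max_eq_left h]
    rw [e]
    exact measurable_const.sub this.measurable
  · have hp := clamp_mem hab t
    have hq := clamp_mem hab (t + v)
    have hpq : clamp a b t ≤ clamp a b (t + v) := clamp_mono a b (by linarith)
    have hw := clamp_add_sub_le hab t hv.le
    have hw0 : 0 ≤ clamp a b (t + v) - clamp a b t := sub_nonneg.2 hpq
    have hmin : 0 ≤ min v (b - a) := hw0.trans hw
    have e : areaInc a b z t - areaInc a b z (t + v) = z (clamp a b t) (clamp a b (t + v)) +
        (x (clamp a b t) - x a) * (y (clamp a b (t + v)) - y (clamp a b t)) := by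
      have := h.chen a _ _ le_rfl hp.1 hpq hq.2
      unfold areaInc
      linarith
    rw [e]
    have h1 : |z (clamp a b t) (clamp a b (t + v))| ≤ N₂ * (b - a) ^ β * (min v (b - a)) ^ β := by
      refine (h.bound _ _ hp.1 hpq hq.2).trans ?_
      rw [mul_assoc, two_mul, Real.rpow_add_of_nonneg hw0 hβ.le hβ.le]
      gcongr
      · exact hq.2
      · exact hp.1
    have h2 : |x (clamp a b t) - x a| ≤ A * (b - a) ^ β := by
      refine (h.left _ hp _ (left_mem_Icc.2 hab.le)).trans ?_
      rw [abs_of_nonneg (sub_nonneg.2 hp.1)]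
      gcongr
      · exact sub_nonneg.2 hp.1
      · exact hp.2
    have h3 : |y (clamp a b (t + v)) - y (clamp a b t)| ≤ N * (min v (b - a)) ^ β := by
      refine (h.right _ hq _ hp).trans ?_
      rw [abs_of_nonneg hw0]
      gcongr
    refine (abs_add_le _ _).trans ?_
    rw [abs_mul, add_mul, mul_assoc (A * (b - a) ^ β)]
    gcongr

lemma ScalarRough.abs_area_le (h : ScalarRough a b β A N N₂ x y z) (hab : a < b)
    (hβ : 0 < β) (hN₂ : 0 ≤ N₂) (r : ℝ) {v : ℝ} (hv : 0 < v) :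
    |z (clamp a b r) (clamp a b (r + |v|))| ≤ N₂ * (min v (b - a)) ^ (2 * β) := by
  rw [abs_of_pos hv]
  have hpq : clamp a b r ≤ clamp a b (r + v) := clamp_mono a b (by linarith)
  refine (h.bound _ _ (clamp_mem hab r).1 hpq (clamp_mem hab _).2).trans ?_
  gcongr
  · exact clamp_add_sub_le hab r hv.le

lemma ScalarRough.measurable_area (h : ScalarRough a b β A N N₂ x y z) (hab : a < b) :
    Measurable (Function.uncurry fun r v => z (clamp a b r) (clamp a b (r + |v|))) :=
  (h.continuous_comp hab (p := fun w : ℝ × ℝ => w.1) (q := fun w => w.1 + |w.2|) (by fun_prop)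
    (by fun_prop) fun w => by linarith [abs_nonneg w.2]).measurable

lemma ScalarRough.marchaudIntegrable_area (h : ScalarRough a b β A N N₂ x y z) (hab : a < b)
    (hβ : 0 < β) (hN₂ : 0 ≤ N₂) (hκ : 0 < κ) (hκβ : κ < β) (r : ℝ) :
    MarchaudIntegrable κ fun v => z (clamp a b r) (clamp a b (r + |v|)) :=
  marchaudIntegrable_of_le hκ (by linarith : κ < 2 * β) (sub_pos.2 hab)
    ((h.measurable_area hab).comp (measurable_const.prodMk measurable_id))
    fun v hv => h.abs_area_le hab hβ hN₂ r hv

/-- By Chen's relation, the increments in `r` of `z(r, r + v)` are small both in the increment and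
in `v`. -/
lemma ScalarRough.abs_area_sub_le (h : ScalarRough a b β A N N₂ x y z) (hab : a < b)
    (hβ : 0 < β) (hA : 0 ≤ A) (hN : 0 ≤ N) (hN₂ : 0 ≤ N₂) (r : ℝ) {v w : ℝ} (hv : 0 < v)
    (hw : 0 < w) :
    |z (clamp a b r) (clamp a b (r + |v|)) - z (clamp a b (r + w)) (clamp a b (r + w + |v|))| ≤
      (2 * N₂ + 2 * (A * N)) * (min w (b - a)) ^ β * (min v (b - a)) ^ β := by
  have hL : 0 < b - a := by linarith
  have hmw : 0 ≤ min w (b - a) := le_min hw.le hL.le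
  have hmv : 0 ≤ min v (b - a) := le_min hv.le hL.le
  -- If `v ≤ w`, both values are of order `v^{2β}`. Otherwise Chen's relation for the two
  -- decompositions of `[r, r + w + v]` replaces the increments over distance `v` by those over `w`.
  rcases le_total v w with hvw | hvw
  · have h1 := h.abs_area_le hab hβ hN₂ r hv
    have h2 := h.abs_area_le hab hβ hN₂ (r + w) hv
    have h3 : (min v (b - a)) ^ (2 * β) ≤ (min w (b - a)) ^ β * (min v (b - a)) ^ β := by
      rw [two_mul, Real.rpow_add_of_nonneg hmv hβ.le hβ.le]
      gcongr
    refine (abs_sub _ _).trans ((add_le_add h1 h2).trans ?_)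
    have h4 : 0 ≤ A * N * ((min w (b - a)) ^ β * (min v (b - a)) ^ β) := by positivity
    nlinarith [mul_le_mul_of_nonneg_left h3 hN₂]
  rw [abs_of_pos hv]
  have hp := clamp_mem hab r
  have hp' := clamp_mem hab (r + w)
  have hq := clamp_mem hab (r + v)
  have hq' := clamp_mem hab (r + w + v)
  have hpq : clamp a b r ≤ clamp a b (r + v) := clamp_mono a b (by linarith)
  have hpp' : clamp a b r ≤ clamp a b (r + w) := clamp_mono a b (by linarith)
  have hqq' : clamp a b (r + v) ≤ clamp a b (r + w + v) := clamp_mono a b (by linarith)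
  have hp'q' : clamp a b (r + w) ≤ clamp a b (r + w + v) := clamp_mono a b (by linarith)
  have d1 := clamp_add_sub_le hab r hv.le
  have d2 := clamp_add_sub_le hab r hw.le
  have d3 := clamp_add_sub_le hab (r + v) hw.le
  have d4 := clamp_add_sub_le hab (r + w) hv.le
  rw [show r + v + w = r + w + v by ring] at d3
  have e : z (clamp a b r) (clamp a b (r + v)) - z (clamp a b (r + w)) (clamp a b (r + w + v)) =
      z (clamp a b r) (clamp a b (r + w)) - z (clamp a b (r + v)) (clamp a b (r + w + v)) +
      ((x (clamp a b (r + w)) - x (clamp a b r)) *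
        (y (clamp a b (r + w + v)) - y (clamp a b (r + w))) -
      (x (clamp a b (r + v)) - x (clamp a b r)) *
        (y (clamp a b (r + w + v)) - y (clamp a b (r + v)))) := by
    have c1 := h.chen _ _ _ hp.1 hpq hqq' hq'.2
    have c2 := h.chen _ _ _ hp.1 hpp' hp'q' hq'.2
    linarith
  have hz : ∀ s t, a ≤ s → s ≤ t → t ≤ b → t - s ≤ min w (b - a) →
      |z s t| ≤ N₂ * ((min w (b - a)) ^ β * (min v (b - a)) ^ β) := by
    intro s t hs hst ht hd
    refine (h.bound s t hs hst ht).trans ?_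
    rw [two_mul, Real.rpow_add_of_nonneg (sub_nonneg.2 hst) hβ.le hβ.le]
    have : min w (b - a) ≤ min v (b - a) := min_le_min_right _ hvw
    gcongr
    exact hd.trans this
  have hx : ∀ s t δ, s ∈ Icc a b → t ∈ Icc a b → s ≤ t → t - s ≤ δ →
      |x t - x s| ≤ A * δ ^ β := by
    intro s t δ hs ht hst hd
    refine (h.left t ht s hs).trans ?_
    rw [abs_of_nonneg (sub_nonneg.2 hst)]
    gcongr
  have hy : ∀ s t δ, s ∈ Icc a b → t ∈ Icc a b → s ≤ t → t - s ≤ δ →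
      |y t - y s| ≤ N * δ ^ β := by
    intro s t δ hs ht hst hd
    refine (h.right t ht s hs).trans ?_
    rw [abs_of_nonneg (sub_nonneg.2 hst)]
    gcongr
  rw [e]
  refine (abs_add_le _ _).trans ((add_le_add ((abs_sub _ _).trans (add_le_add
    (hz _ _ hp.1 hpp' hp'.2 d2) (hz _ _ hq.1 hqq' hq'.2 d3))) ((abs_sub _ _).trans
    (add_le_add (b := A * (min w (b - a)) ^ β * (N * (min v (b - a)) ^ β))
      (d := A * (min v (b - a)) ^ β * (N * (min w (b - a)) ^ β)) ?_ ?_))).trans (le_of_eq (by ring)))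
  · rw [abs_mul]
    exact mul_le_mul (hx _ _ _ hp hp' hpp' d2) (hy _ _ _ hp' hq' hp'q' d4) (abs_nonneg _)
      (by positivity)
  · rw [abs_mul]
    exact mul_le_mul (hx _ _ _ hp hq hpq d1) (hy _ _ _ hq hq' hqq' d3) (abs_nonneg _)
      (by positivity)

/-- The first right sided derivative of the area is again Hölder continuous of order `β`, so that the
second one, of order `κ < β`, exists and is bounded. -/
lemma ScalarRough.holderVanishing_areaMarchaud (h : ScalarRough a b β A N N₂ x y z) (hab : a < b)
    (hβ : 0 < β) (hA : 0 ≤ A) (hN : 0 ≤ N) (hN₂ : 0 ≤ N₂) (hκ : 0 < κ) (hκ1 : κ < 1)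
    (hκβ : κ < β) :
    HolderVanishing a b β ((2 * N₂ + 2 * (A * N)) * (marchaudConst κ β * (b - a) ^ (β - κ)))
      (areaMarchaud a b κ z) := by
  refine ⟨measurable_marchaud (h.measurable_area hab), fun t ht => ?_, fun t v ht hv => ?_⟩
  · have : ∀ v, z (clamp a b t) (clamp a b (t + |v|)) = 0 := fun v => by
      rw [clamp_of_ge hab ht, clamp_of_ge hab (by linarith [abs_nonneg v]),
        h.diag (right_mem_Icc.2 hab.le)]
    simp [areaMarchaud, marchaud, this]
  · have e : areaMarchaud a b κ z t - areaMarchaud a b κ z (t + v) =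
        marchaud κ fun u => z (clamp a b t) (clamp a b (t + |u|)) +
          -1 * z (clamp a b (t + v)) (clamp a b (t + v + |u|)) := by
      have h2 := marchaud_const_mul (-1) (h.marchaudIntegrable_area hab hβ hN₂ hκ hκβ (t + v))
      rw [(marchaud_add (h.marchaudIntegrable_area hab hβ hN₂ hκ hκβ t) h2.1).2, h2.2]
      unfold areaMarchaud
      ring
    rw [e]
    refine (abs_marchaud_le hκ hκ1 hκβ (sub_pos.2 hab) (C := (2 * N₂ + 2 * (A * N)) *
      (min v (b - a)) ^ β) fun u hu => ?_).trans (le_of_eq (by ring))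
    rw [neg_one_mul, ← sub_eq_add_neg]
    exact h.abs_area_sub_le hab hβ hA hN hN₂ t hu hv

/-- Chen's relation for the right sided derivatives. -/
lemma ScalarRough.areaMarchaud_eq (h : ScalarRough a b β A N N₂ x y z) (hab : a < b)
    (hβ : 0 < β) (hA : 0 ≤ A) (hN : 0 ≤ N) (hN₂ : 0 ≤ N₂) (hκ : 0 < κ) (hκβ : κ < β) {r : ℝ}
    (hr : r ∈ Icc a b) :
    areaMarchaud a b κ z r = rightMarchaud κ (areaInc a b z) r +
      (x r - x a) * rightMarchaud κ (endInc a b y) r := by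
  have h1 := (h.holderVanishing_areaInc hab hβ hA hN hN₂).marchaudIntegrable hκ hκβ hab hr.1
  have h2 := marchaud_const_mul (x r - x a)
    ((holderVanishing_endInc hab hβ hN h.right).marchaudIntegrable hκ hκβ hab hr.1)
  unfold rightMarchaud
  rw [← h2.2, ← (marchaud_add h1 h2.1).2]
  refine marchaud_congr fun v hv => ?_
  have hq := clamp_mem hab (r + v)
  have hrq : r ≤ clamp a b (r + v) := by
    have := clamp_mono a b (show r ≤ r + v by linarith)
    rwa [clamp_of_mem hr] at this
  have := h.chen a r _ le_rfl hr.1 hrq hq.2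
  unfold areaInc endInc
  rw [abs_of_pos hv, clamp_of_mem hr]
  linarith

/-- The right sided derivative of a function of two parameters is a Marchaud functional. -/
lemma ScalarRough.rightDerivTwo_eq (h : ScalarRough a b β A N N₂ x y z) (hab : a < b)
    (hβ : 0 < β) (hN₂ : 0 ≤ N₂) (hκ : 0 < κ) (hκβ : κ < β) {r : ℝ} (hr : r ∈ Ico a b) :
    RightDerivTwoDefined b κ z r ∧
      rightDerivTwo b κ z r = (-1 : ℂ) ^ (κ : ℂ) * (areaMarchaud a b κ z r : ℂ) := by
  have hrI : r ∈ Icc a b := ⟨hr.1, hr.2.le⟩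
  have hi := h.marchaudIntegrable_area hab hβ hN₂ hκ hκβ r
  have h0 : ∀ v, b - r < v → z (clamp a b r) (clamp a b (r + |v|)) = z r b := by
    intro v hv
    rw [clamp_of_mem hrI, clamp_of_ge hab (by linarith [le_abs_self v])]
  have h1 : ∀ v, 0 < v → v < b - r → z (clamp a b r) (clamp a b (r + |v|)) = z r (r + v) := by
    intro v hv hv2
    rw [clamp_of_mem hrI, abs_of_pos hv,
      clamp_of_mem (⟨by linarith [hr.1], by linarith⟩ : r + v ∈ Icc a b)]
  have hbr : 0 < b - r := by linarith [hr.2]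
  constructor
  · exact (intervalIntegrable_right_iff hr.2 h1).1
      ((marchaudIntegrable_iff_of_eventually_const hκ hbr h0).1 hi)
  · rw [areaMarchaud, marchaud_eq_of_eventually_const hκ hbr h0 hi, integral_right_eq hr.2 h1,
      rightDerivTwo]
    push_cast
    ring

/-- The right sided derivative of a multiple of a real function is a Marchaud functional. -/
lemma HolderVanishing.rightDeriv_eq {C : ℝ} {f : ℝ → ℝ} (hf : HolderVanishing a b β C f)
    (hab : a < b) (hκ : 0 < κ) (hκβ : κ < β) {c : ℂ} {u : ℝ → ℂ} {r : ℝ} (hr : r ∈ Ico a b)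
    (hu : ∀ t ∈ Ico a b, u t = c * (f t : ℂ)) :
    RightDerivDefined b κ u r ∧
      rightDeriv b κ u r = (-1 : ℂ) ^ (κ : ℂ) * (c * (rightMarchaud κ f r : ℂ)) := by
  have hi := hf.marchaudIntegrable hκ hκβ hab hr.1
  have h0 : ∀ v, b - r < v → f r - f (r + v) = f r := by
    intro v hv
    rw [hf.vanish (r + v) (by linarith), sub_zero]
  have h1 : ∀ v, 0 < v → v < b - r → f r - f (r + v) = (fun s => f r - f s) (r + v) :=
    fun v _ _ => rfl
  have hbr : 0 < b - r := by linarith [hr.2]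
  have hi2 := (intervalIntegrable_right_iff (h := fun s => f r - f s) hr.2 h1).1
    ((marchaudIntegrable_iff_of_eventually_const hκ hbr h0).1 hi)
  have e : ∀ s ∈ Ioo r b, (u r - u s) / (((s - r) ^ (κ + 1) : ℝ) : ℂ) =
      c * (((f r - f s) / (s - r) ^ (κ + 1) : ℝ) : ℂ) := by
    intro s hs
    rw [hu r hr, hu s ⟨hr.1.trans hs.1.le, hs.2⟩]
    push_cast
    ring
  constructor
  · have h2 : IntervalIntegrable (fun s => c * (((f r - f s) / (s - r) ^ (κ + 1) : ℝ) : ℂ))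
        volume r b := by
      rw [intervalIntegrable_iff] at hi2 ⊢
      exact hi2.ofReal.const_mul c
    refine (intervalIntegrable_congr_uIoo fun s hs => ?_).1 h2
    rw [uIoo_of_le hr.2.le] at hs
    exact (e s hs).symm
  · have h3 : ∫ s in r..b, (u r - u s) / (((s - r) ^ (κ + 1) : ℝ) : ℂ) =
        c * ((∫ s in r..b, (f r - f s) / (s - r) ^ (κ + 1) : ℝ) : ℂ) := by
      rw [← intervalIntegral.integral_ofReal, ← intervalIntegral.integral_const_mul]
      refine intervalIntegral.integral_congr_uIoo fun s hs => ?_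
      rw [uIoo_of_le hr.2.le] at hs
      exact e s hs
    rw [rightMarchaud, marchaud_eq_of_eventually_const hκ hbr h0 hi,
      integral_right_eq (h := fun s => f r - f s) hr.2 h1, rightDeriv, h3, hu r hr]
    push_cast
    ring

end

/-! ### The integrals of one component -/

section
variable {m : ℕ} {a b : ℝ}

/-- The compensated derivative is a Marchaud functional of the compensated increments. -/
lemma compDeriv_eq_marchaud {α : ℝ} (hα : 0 < α) (f : Euc m → ℝ) {X X₀ : ℝ → Euc m}
    (hX : ∀ t ∈ Icc a b, X t = X₀ t) {r : ℝ} (hr : r ∈ Ioc a b)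
    (hi : MarchaudIntegrable α (pathCompInc a b f X r)) :
    CompDerivDefined a α f X₀ r ∧ compDeriv a α f X₀ r = marchaud α (pathCompInc a b f X r) := by
  have hrI := Ioc_subset_Icc_self hr
  have hra : 0 < r - a := by linarith [hr.1]
  have h0 : ∀ v, r - a < v → pathCompInc a b f X r v = f (X₀ r) := fun v hv => by
    rw [pathCompInc_eq_of_lt f X hrI hv, hX r hrI]
  have h1 : ∀ v, 0 < v → v < r - a →
      pathCompInc a b f X r v = (fun θ => taylorRemainder f X₀ θ r) (r - v) := fun v hv hv2 => by
    have h : r - v ∈ Icc a b := ⟨by linarith, by linarith [hr.2]⟩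
    rw [pathCompInc_eq f X hrI hv hv2.le]
    simp only [taylorRemainder, hX r hrI, hX _ h]
  constructor
  · exact (intervalIntegrable_left_iff (h := fun θ => taylorRemainder f X₀ θ r) hr.1 h1).1
      ((marchaudIntegrable_iff_of_eventually_const hα hra h0).1 hi)
  · rw [marchaud_eq_of_eventually_const hα hra h0 hi,
      integral_left_eq (h := fun θ => taylorRemainder f X₀ θ r) hr.1 h1, compDeriv]

/-- The left sided derivative of `∂ᵢf(X)` is a Marchaud functional of the increments. -/
lemma leftDeriv_eq_marchaud {γ : ℝ} (hγ : 0 < γ) (f : Euc m → ℝ) {X X₀ : ℝ → Euc m}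
    (hX : ∀ t ∈ Icc a b, X t = X₀ t) (i : Fin m) {r : ℝ} (hr : r ∈ Ioc a b)
    (hi : MarchaudIntegrable γ (pathDerivInc a b f X i r)) :
    LeftDerivDefined a γ (fun t => partialDeriv i f (X₀ t)) r ∧
      leftDeriv a γ (fun t => partialDeriv i f (X₀ t)) r =
        marchaud γ (pathDerivInc a b f X i r) := by
  have hrI := Ioc_subset_Icc_self hr
  have hra : 0 < r - a := by linarith [hr.1]
  have h0 : ∀ v, r - a < v → pathDerivInc a b f X i r v = partialDeriv i f (X₀ r) := fun v hv => by
    rw [pathDerivInc_eq_of_lt f X i hrI hv, hX r hrI]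
  have h1 : ∀ v, 0 < v → v < r - a → pathDerivInc a b f X i r v =
      (fun θ => partialDeriv i f (X₀ r) - partialDeriv i f (X₀ θ)) (r - v) := fun v hv hv2 => by
    have h : r - v ∈ Icc a b := ⟨by linarith, by linarith [hr.2]⟩
    rw [pathDerivInc_eq f X i hrI hv hv2.le]
    simp only [hX r hrI, hX _ h]
  constructor
  · exact (intervalIntegrable_left_iff
      (h := fun θ => partialDeriv i f (X₀ r) - partialDeriv i f (X₀ θ)) hr.1 h1).1
      ((marchaudIntegrable_iff_of_eventually_const hγ hra h0).1 hi)
  · rw [marchaud_eq_of_eventually_const hγ hra h0 hi, integral_left_eq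
      (h := fun θ => partialDeriv i f (X₀ r) - partialDeriv i f (X₀ θ)) hr.1 h1, leftDeriv]

/-- The first real integrand in the rough integral of one component. -/
noncomputable def compTerm (a b κ : ℝ) (f : Euc m → ℝ) (X : ℝ → Euc m) (y : ℝ → ℝ) (r : ℝ) : ℝ :=
  marchaud (1 - κ) (pathCompInc a b f X r) * rightMarchaud κ (endInc a b y) r

/-- The second real integrand in the rough integral of one component. -/
noncomputable def areaTerm (a b κ : ℝ) (f : Euc m → ℝ) (X : ℝ → Euc m) (i : Fin m)
    (z : ℝ → ℝ → ℝ) (r : ℝ) : ℝ :=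
  marchaud (1 - (κ + κ)) (pathDerivInc a b f X i r) * rightMarchaud κ (areaMarchaud a b κ z) r

variable {β N κ : ℝ} {A K : ℝ≥0} {N₂ : Fin m → ℝ} {X : ℝ → Euc m} {f : Euc m → ℝ} {y : ℝ → ℝ}
  {z : Fin m → ℝ → ℝ → ℝ}

lemma exists_bound_pathValue (hf : LipschitzBV K f) (hX : HolderPath a b β A X) :
    ∃ B, 0 ≤ B ∧ ∀ t, |pathValue a b f X t| ≤ B := by
  have hc : ContinuousOn (fun t => f (X t)) (Icc a b) :=
    (hf.lip.continuous.comp hX.cont).continuousOn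
  obtain ⟨B, hB⟩ := isCompact_Icc.exists_bound_of_continuousOn hc
  refine ⟨max B 0, le_max_right _ _, fun t => ?_⟩
  by_cases ht : t ∈ Icc a b
  · rw [pathValue_of_mem _ _ ht]
    exact (hB t ht).trans (le_max_left _ _)
  · rw [pathValue_of_notMem _ _ ht, abs_zero]
    exact le_max_right _ _

lemma boundedOn_pathValue_partialDeriv (hf : LipschitzBV K f) (hX : HolderPath a b β A X)
    (i : Fin m) : BoundedOn a b K (pathValue a b (partialDeriv i f) X) := by
  refine ⟨measurable_pathValue (measurable_partialDeriv hf.lip i) hX.cont, fun t => ?_,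
    fun t ht => pathValue_of_notMem _ _ fun h => by linarith [h.1],
    fun t ht => pathValue_of_notMem _ _ fun h => by linarith [h.2]⟩
  by_cases ht : t ∈ Icc a b
  · rw [pathValue_of_mem _ _ ht]
    exact abs_partialDeriv_le hf.lip i _
  · rw [pathValue_of_notMem _ _ ht, abs_zero]
    exact K.2

/-- If the double integrals are finite, the integrals in the rough integral exist, and their
combination is the limit of expressions that do not depend on `κ`. -/
lemma tendsto_mollified_rough_integral (hf : LipschitzBV K f) (hX : HolderPath a b β A X) {M : ℝ}
    (hM : ∀ i t, |pathCoord a X i t| ≤ M) (hab : a < b) (hκ : 0 < κ) (hκ2 : κ < 1 / 2)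
    (hκβ : κ < β) (hN : 0 ≤ N) (hN₂ : ∀ i, 0 ≤ N₂ i)
    (hy : ∀ t ∈ Icc a b, ∀ u ∈ Icc a b, |y t - y u| ≤ N * |t - u| ^ β)
    (hz : ∀ i, ScalarRough a b β A N (N₂ i) (fun t => X t i) y (z i))
    (hc : compEnergy a b (1 - κ) f X ≠ ∞) (hd : ∀ i, derivEnergy a b (1 - (κ + κ)) f X i ≠ ∞) :
    IntegrableOn (compTerm a b κ f X y) (Icc a b) ∧
    (∀ i, IntegrableOn (areaTerm a b κ f X i (z i)) (Icc a b)) ∧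
    Tendsto (fun n : ℕ =>
      (∫ r in Icc a b, deriv (leftMoll (1 / ((n : ℝ) + 1)) (uncontrolled (pathValue a b f X)
        (fun i => pathValue a b (partialDeriv i f) X) (pathCoord a X))) r * endInc a b y r) -
      ∑ i, ∫ r in Icc a b, deriv (leftMoll (1 / ((n : ℝ) + 1))
        (pathValue a b (partialDeriv i f) X)) r * areaInc a b (z i) r) atTop
      (𝓝 ((∫ r in Icc a b, compTerm a b κ f X y r) -
        ∑ i, ∫ r in Icc a b, areaTerm a b κ f X i (z i) r)) := by
  have hβ : 0 < β := hκ.trans hκβ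
  have hκ1 : κ < 1 := by linarith
  have hL : 0 < b - a := by linarith
  have hA : (0 : ℝ) ≤ A := A.2
  obtain ⟨B, hB0, hB⟩ := exists_bound_pathValue hf hX
  have hg := fun i => boundedOn_pathValue_partialDeriv hf hX i
  have hxm : ∀ i, Measurable (pathCoord a X i) := fun i => measurable_pathCoord hX.cont i
  have hFm := measurable_pathValue (a := a) (b := b) hf.lip.continuous.measurable hX.cont
  -- a common Hölder constant for the three right hand functions
  obtain ⟨C, hC1, hC2, hC3⟩ : ∃ C : ℝ, N ≤ C ∧
      (∀ i, N₂ i * (b - a) ^ β + A * (b - a) ^ β * N ≤ C) ∧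
      ∀ i, (2 * N₂ i + 2 * (A * N)) * (marchaudConst κ β * (b - a) ^ (β - κ)) ≤ C := by
    have hmc := marchaudConst_nonneg hκ hκ1 hκβ
    have h1 : ∀ i, 0 ≤ N₂ i * (b - a) ^ β + A * (b - a) ^ β * N := fun i => by
      have := hN₂ i
      positivity
    have h2 : ∀ i, 0 ≤ (2 * N₂ i + 2 * (A * N)) * (marchaudConst κ β * (b - a) ^ (β - κ)) :=
      fun i => by
        have := hN₂ i
        positivity
    have s1 := Finset.sum_nonneg fun i (_ : i ∈ Finset.univ) => h1 i
    have s2 := Finset.sum_nonneg fun i (_ : i ∈ Finset.univ) => h2 i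
    refine ⟨N + ∑ i, (N₂ i * (b - a) ^ β + A * (b - a) ^ β * N) +
      ∑ i, (2 * N₂ i + 2 * (A * N)) * (marchaudConst κ β * (b - a) ^ (β - κ)), by linarith,
      fun i => ?_, fun i => ?_⟩
    · have := Finset.single_le_sum (fun i _ => h1 i) (Finset.mem_univ i)
      linarith
    · have := Finset.single_le_sum (fun i _ => h2 i) (Finset.mem_univ i)
      linarith
  have hyv := (holderVanishing_endInc hab hβ hN hy).mono hab hC1
  have hζv := fun i => ((hz i).holderVanishing_areaInc hab hβ hA hN (hN₂ i)).mono hab (hC2 i)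
  have hHv := fun i =>
    ((hz i).holderVanishing_areaMarchaud hab hβ hA hN (hN₂ i) hκ hκ1 hκβ).mono hab (hC3 i)
  have hF : BoundedOn a b (B + ∑ _i : Fin m, K * M) (uncontrolled (pathValue a b f X)
      (fun i => pathValue a b (partialDeriv i f) X) (pathCoord a X)) := by
    refine ⟨?_, fun t => ?_, fun t ht => ?_, fun t ht => ?_⟩
    · unfold uncontrolled
      exact hFm.sub (Finset.measurable_sum _ fun i _ => (hg i).measurable.mul (hxm i))
    · unfold uncontrolled
      refine (abs_sub _ _).trans (add_le_add (hB t) ((Finset.abs_sum_le_sum_abs _ _).trans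
        (Finset.sum_le_sum fun i _ => ?_)))
      rw [abs_mul]
      exact mul_le_mul ((hg i).bound t) (hM i t) (abs_nonneg _) K.2
    · have : t ∉ Icc a b := fun h => by linarith [h.1]
      simp [uncontrolled, pathValue_of_notMem _ _ this]
    · have : t ∉ Icc a b := fun h => by linarith [h.2]
      simp [uncontrolled, pathValue_of_notMem _ _ this]
  have hcb : ∀ r t, |pathCompInc a b f X r t| ≤ B + B + ∑ _i : Fin m, K * (M + M) := by
    intro r t
    unfold pathCompInc compInc
    refine (abs_sub _ _).trans (add_le_add ((abs_sub _ _).trans (add_le_add (hB _) (hB _)))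
      ((Finset.abs_sum_le_sum_abs _ _).trans (Finset.sum_le_sum fun i _ => ?_)))
    rw [abs_mul]
    exact mul_le_mul ((hg i).bound _) ((abs_sub _ _).trans (add_le_add (hM i _) (hM i _)))
      (abs_nonneg _) K.2
  have hdb : ∀ i r t, |pathDerivInc a b f X i r t| ≤ K + K := fun i r t =>
    (abs_sub _ _).trans (add_le_add ((hg i).bound _) ((hg i).bound _))
  obtain ⟨hci, hcI, -⟩ := marchaud_of_lintegral_ne_top (by linarith) (by linarith)
    (measurable_pathCompInc hf.lip hX.cont) hc
  have hdd := fun i => marchaud_of_lintegral_ne_top (by linarith) (by linarith)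
    (measurable_pathDerivInc hf.lip hX.cont i) (hd i)
  obtain ⟨t1, t2⟩ := tendsto_integral_marchaud_mollInc (by linarith) (by linarith)
    (measurable_pathCompInc hf.lip hX.cont) hcb hyv.measurable_rightMarchaud
    (fun r hr _ => hyv.abs_rightMarchaud_le hκ hκ1 hκβ hab hr) hci hcI
  have t3 := fun i => tendsto_integral_marchaud_mollInc (by linarith) (by linarith)
    (measurable_pathDerivInc hf.lip hX.cont i) (hdb i) (hHv i).measurable_rightMarchaud
    (fun r hr _ => (hHv i).abs_rightMarchaud_le hκ hκ1 hκβ hab hr) (hdd i).1 (hdd i).2.1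
  refine ⟨t1, fun i => (t3 i).1, ?_⟩
  refine (t2.sub (tendsto_finsetSum _ fun i _ => (t3 i).2)).congr fun n => ?_
  exact mollified_rough_integral_eq hκ hκ2 hκβ hab Nat.one_div_pos_of_nat hF hg hxm hM hyv hζv hHv
    fun i r hr hr2 => (hz i).areaMarchaud_eq hab hβ hA hN (hN₂ i) hκ hκβ ⟨hr, hr2⟩

lemma enorm_compTerm_integral_le (hf : LipschitzBV K f) (hX : HolderPath a b β A X) (hab : a < b)
    (hκ : 0 < κ) (hκ1 : κ < 1) (hκβ : κ < β) (hN : 0 ≤ N)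
    (hy : ∀ t ∈ Icc a b, ∀ u ∈ Icc a b, |y t - y u| ≤ N * |t - u| ^ β)
    (hc : compEnergy a b (1 - κ) f X ≠ ∞) :
    ‖∫ r in Icc a b, compTerm a b κ f X y r‖ₑ ≤
      ENNReal.ofReal ((1 - κ) / Real.Gamma (1 - (1 - κ))) *
        ENNReal.ofReal (marchaudConst κ β * (b - a) ^ (β - κ)) *
        (compEnergy a b (1 - κ) f X * ENNReal.ofReal N) := by
  obtain ⟨-, -, h1⟩ := marchaud_of_lintegral_ne_top (by linarith) (by linarith)
    (measurable_pathCompInc hf.lip hX.cont) hc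
  have hyv := holderVanishing_endInc hab (hκ.trans hκβ) hN hy
  refine (enorm_integral_le_lintegral_enorm _).trans ?_
  calc ∫⁻ r in Icc a b, ‖compTerm a b κ f X y r‖ₑ
      ≤ ∫⁻ r in Icc a b, ‖marchaud (1 - κ) (pathCompInc a b f X r)‖ₑ *
          ENNReal.ofReal (N * marchaudConst κ β * (b - a) ^ (β - κ)) := by
        refine setLIntegral_mono' measurableSet_Icc fun r hr => ?_
        rw [compTerm, enorm_mul]
        gcongr
        rw [← ofReal_norm]
        exact ENNReal.ofReal_le_ofReal (hyv.abs_rightMarchaud_le hκ hκ1 hκβ hab hr.1)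
    _ ≤ (ENNReal.ofReal ((1 - κ) / Real.Gamma (1 - (1 - κ))) * compEnergy a b (1 - κ) f X) *
          ENNReal.ofReal (N * marchaudConst κ β * (b - a) ^ (β - κ)) := by
        rw [lintegral_mul_const' _ _ ENNReal.ofReal_ne_top]
        gcongr
        exact h1
    _ = _ := by
        rw [mul_assoc N, ENNReal.ofReal_mul hN]
        ring

/-- The summand `A * N` comes from the Hölder constant of `areaMarchaud`, that is, from Chen's
relation. -/
lemma enorm_areaTerm_integral_le (hf : LipschitzBV K f) (hX : HolderPath a b β A X) (hab : a < b)
    (hκ : 0 < κ) (hκ2 : κ < 1 / 2) (hκβ : κ < β) (hN : 0 ≤ N) (i : Fin m) (hN₂ : 0 ≤ N₂ i)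
    (hz : ScalarRough a b β A N (N₂ i) (fun t => X t i) y (z i))
    (hd : derivEnergy a b (1 - (κ + κ)) f X i ≠ ∞) :
    ‖∫ r in Icc a b, areaTerm a b κ f X i (z i) r‖ₑ ≤
      2 * ENNReal.ofReal ((1 - (κ + κ)) / Real.Gamma (1 - (1 - (κ + κ)))) *
        ENNReal.ofReal (marchaudConst κ β * (b - a) ^ (β - κ)) ^ 2 *
        (derivEnergy a b (1 - (κ + κ)) f X i *
          (ENNReal.ofReal (N₂ i) + A * ENNReal.ofReal N)) := by
  have hκ1 : κ < 1 := by linarith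
  have hmc := marchaudConst_nonneg hκ hκ1 hκβ
  have hL : 0 < b - a := by linarith
  obtain ⟨-, -, h1⟩ := marchaud_of_lintegral_ne_top (by linarith) (by linarith)
    (measurable_pathDerivInc hf.lip hX.cont i) hd
  have hv := hz.holderVanishing_areaMarchaud hab (hκ.trans hκβ) A.2 hN hN₂ hκ hκ1 hκβ
  obtain ⟨D, hD⟩ : ∃ D, D = marchaudConst κ β * (b - a) ^ (β - κ) := ⟨_, rfl⟩
  have hD0 : 0 ≤ D := by
    rw [hD]
    positivity
  rw [← hD] at hv ⊢
  have e : ENNReal.ofReal ((2 * N₂ i + 2 * (A * N)) * D * marchaudConst κ β * (b - a) ^ (β - κ)) =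
      2 * ENNReal.ofReal D ^ 2 * (ENNReal.ofReal (N₂ i) + A * ENNReal.ofReal N) := by
    rw [mul_assoc _ (marchaudConst κ β), ← hD,
      show (2 * N₂ i + 2 * (A * N)) * D * D = 2 * (D * D) * (N₂ i + A * N) by ring,
      ENNReal.ofReal_mul (by positivity), ENNReal.ofReal_mul two_pos.le, ENNReal.ofReal_mul hD0,
      ENNReal.ofReal_add hN₂ (by positivity), ENNReal.ofReal_mul A.coe_nonneg]
    simp [sq]
  refine (enorm_integral_le_lintegral_enorm _).trans ?_
  calc ∫⁻ r in Icc a b, ‖areaTerm a b κ f X i (z i) r‖ₑ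
      ≤ ∫⁻ r in Icc a b, ‖marchaud (1 - (κ + κ)) (pathDerivInc a b f X i r)‖ₑ *
          ENNReal.ofReal ((2 * N₂ i + 2 * (A * N)) * D * marchaudConst κ β * (b - a) ^ (β - κ)) := by
        refine setLIntegral_mono' measurableSet_Icc fun r hr => ?_
        rw [areaTerm, enorm_mul]
        gcongr
        rw [← ofReal_norm]
        exact ENNReal.ofReal_le_ofReal (hv.abs_rightMarchaud_le hκ hκ1 hκβ hab hr.1)
    _ ≤ (ENNReal.ofReal ((1 - (κ + κ)) / Real.Gamma (1 - (1 - (κ + κ)))) *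
          derivEnergy a b (1 - (κ + κ)) f X i) * ENNReal.ofReal
          ((2 * N₂ i + 2 * (A * N)) * D * marchaudConst κ β * (b - a) ^ (β - κ)) := by
        rw [lintegral_mul_const' _ _ ENNReal.ofReal_ne_top]
        gcongr
        exact h1
    _ = _ := by
        rw [e]
        ring

end

/-! ### The bound for one component -/

section
variable {m : ℕ} {a b β N α κ : ℝ} {A K : ℝ≥0} {N₂ : Fin m → ℝ} {X X₀ : ℝ → Euc m}
  {f : Euc m → ℝ} {y : ℝ → ℝ} {z : Fin m → ℝ → ℝ → ℝ}

lemma ae_mem_Ioo (a b : ℝ) : ∀ᵐ r ∂volume.restrict (Icc a b), r ∈ Ioo a b := by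
  rw [← restrict_Ioo_eq_restrict_Icc]
  exact ae_restrict_mem measurableSet_Ioo

/-- The first integrand of the rough integral is a real function up to a constant phase. -/
lemma firstIntegrand_ae_eq (hf : LipschitzBV K f) (hX : HolderPath a b β A X)
    (hXX : ∀ t ∈ Icc a b, X t = X₀ t) (hab : a < b) (hκ : 0 < κ) (hκ1 : κ < 1) (hκβ : κ < β)
    (hN : 0 ≤ N) (hy : ∀ t ∈ Icc a b, ∀ u ∈ Icc a b, |y t - y u| ≤ N * |t - u| ^ β)
    (hc : compEnergy a b (1 - κ) f X ≠ ∞) (hα : κ = 1 - α) :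
    ∀ᵐ r ∂volume.restrict (Icc a b), CompDerivDefined a α f X₀ r ∧
      RightDerivDefined b (1 - α) (fun t => ((y t - y b : ℝ) : ℂ)) r ∧
      firstIntegrand a b α f X₀ y r = (-1 : ℂ) ^ (κ : ℂ) * (compTerm a b κ f X y r : ℂ) := by
  have e1 : α = 1 - κ := by linarith
  obtain ⟨hi, -, -⟩ := marchaud_of_lintegral_ne_top (by linarith) (by linarith)
    (measurable_pathCompInc hf.lip hX.cont) hc
  have hyv := holderVanishing_endInc hab (hκ.trans hκβ) hN hy
  filter_upwards [hi, ae_mem_Ioo a b] with r hir hr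
  rw [← e1] at hir
  obtain ⟨h1, h2⟩ := compDeriv_eq_marchaud (by linarith) f hXX (Ioo_subset_Ioc_self hr) hir
  obtain ⟨h3, h4⟩ := hyv.rightDeriv_eq hab hκ hκβ (c := 1)
    (u := fun t => ((y t - y b : ℝ) : ℂ)) (Ioo_subset_Ico_self hr) fun t ht => by
      rw [one_mul, endInc, clamp_of_mem (Ico_subset_Icc_self ht)]
  rw [← hα]
  refine ⟨h1, h3, ?_⟩
  rw [firstIntegrand, ← hα, h2, h4, compTerm, ← e1]
  push_cast
  ring

/-- The second integrand of the rough integral is a real function up to a constant phase. -/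
lemma secondIntegrand_ae_eq (hf : LipschitzBV K f) (hX : HolderPath a b β A X)
    (hXX : ∀ t ∈ Icc a b, X t = X₀ t) (hab : a < b) (hκ : 0 < κ) (hκ2 : κ < 1 / 2) (hκβ : κ < β)
    (hN : 0 ≤ N) (i : Fin m) (hN₂ : 0 ≤ N₂ i)
    (hz : ScalarRough a b β A N (N₂ i) (fun t => X t i) y (z i))
    (hd : derivEnergy a b (1 - (κ + κ)) f X i ≠ ∞) (hα : κ = 1 - α) :
    ∀ᵐ r ∂volume.restrict (Icc a b),
      LeftDerivDefined a (2 * α - 1) (fun t => partialDeriv i f (X₀ t)) r ∧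
      RightDerivTwoDefined b (1 - α) (z i) r ∧
      RightDerivDefined b (1 - α) (rightDerivTwo b (1 - α) (z i)) r ∧
      secondIntegrand a b α i f X₀ (z i) r =
        (-1 : ℂ) ^ (κ : ℂ) * (-1 : ℂ) ^ (κ : ℂ) * (areaTerm a b κ f X i (z i) r : ℂ) := by
  have e2 : 2 * α - 1 = 1 - (κ + κ) := by linarith
  have hβ : 0 < β := hκ.trans hκβ
  obtain ⟨hi, -, -⟩ := marchaud_of_lintegral_ne_top (by linarith) (by linarith)
    (measurable_pathDerivInc hf.lip hX.cont i) hd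
  have hv := hz.holderVanishing_areaMarchaud hab hβ A.2 hN hN₂ hκ (by linarith) hκβ
  filter_upwards [hi, ae_mem_Ioo a b] with r hir hr
  obtain ⟨h1, h2⟩ := leftDeriv_eq_marchaud (by linarith) f hXX i (Ioo_subset_Ioc_self hr) hir
  obtain ⟨h3, h4⟩ := hv.rightDeriv_eq hab hκ hκβ (c := (-1 : ℂ) ^ (κ : ℂ))
    (u := rightDerivTwo b κ (z i)) (Ioo_subset_Ico_self hr) fun t ht =>
      (hz.rightDerivTwo_eq hab hβ hN₂ hκ hκβ ht).2
  rw [← hα, e2]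
  refine ⟨h1, (hz.rightDerivTwo_eq hab hβ hN₂ hκ hκβ (Ioo_subset_Ico_self hr)).1, h3, ?_⟩
  rw [secondIntegrand, ← hα, e2, h2, h4, areaTerm]
  push_cast
  ring

/-- The integral of a real function with a constant complex phase. -/
lemma intervalIntegral_of_ae_eq_const_mul {F : ℝ → ℂ} {G : ℝ → ℝ} {c : ℂ} (hab : a ≤ b)
    (h : ∀ᵐ r ∂volume.restrict (Icc a b), F r = c * (G r : ℂ)) (hG : IntegrableOn G (Icc a b)) :
    IntervalIntegrable F volume a b ∧
      ∫ r in a..b, F r = c * ((∫ r in Icc a b, G r : ℝ) : ℂ) := by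
  have hG' : IntegrableOn (fun r => c * (G r : ℂ)) (Icc a b) := hG.ofReal.const_mul c
  constructor
  · rw [intervalIntegrable_iff_integrableOn_Icc_of_le hab]
    refine hG'.congr ?_
    filter_upwards [h] with r hr using hr.symm
  · rw [intervalIntegral.integral_of_le hab, ← integral_Icc_eq_integral_Ioc, integral_congr_ae h,
      integral_const_mul]
    congr 1
    exact integral_ofReal

end

/-- The exponents `κ = 1 - α` that correspond to the parameters `α` of the rough integral. -/
structure AdmissibleExponent (β s ε κ : ℝ) : Prop where
  pos : 0 < κ
  lt_half : κ < 1 / 2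
  lt : κ < β
  eps_pos : 0 < ε
  s_pos : 0 < s
  comp : 1 - κ + ε ≤ β * (1 + s)
  deriv : 1 - (κ + κ) < β * s

/-- The condition `1 / β - 2 < s` makes the lower bound on `ε` positive, and that lower bound gives
`2α - 1 < β s`, the condition for the derivative of `∂ᵢf(X)` of order `2α - 1`. -/
lemma admissibleExponent {β s ε α : ℝ} (hβ₁ : 1 / 3 < β) (hβ₂ : β < 1 / 2)
    (hs₁ : 1 / β - 2 < s) (hs₂ : s < 1) (hε₁ : 1 / 2 * (β * (1 + s) - (1 - β)) < ε)
    (hα : α ∈ Ioc (1 - β) (β * (1 + s) - ε)) : AdmissibleExponent β s ε (1 - α) := by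
  have hβ0 : 0 < β := by linarith
  have h1 : 1 - 2 * β < β * s := by
    have := mul_lt_mul_of_pos_left hs₁ hβ0
    rw [mul_sub, mul_one_div_cancel hβ0.ne'] at this
    linarith
  have hs0 : 0 < s := by
    by_contra h
    nlinarith
  have hε0 : 0 < ε := by nlinarith
  have hβs : β * s < β := by nlinarith
  obtain ⟨h2, h3⟩ := hα
  refine ⟨by nlinarith, by linarith, by linarith, hε0, hs0, by linarith, by nlinarith⟩

section
variable {m : ℕ} {a b β s ε κ : ℝ}

/-- The quantity that multiplies the Hölder seminorm of the integrator in the bound of the rough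
integral of one component. -/
noncomputable def firstWeight (a b s ε : ℝ) (K A : ℝ≥0) (f : Euc m → ℝ) (X : ℝ → Euc m) : ℝ≥0∞ :=
  (∫⁻ t in Icc a b, ‖f (X t)‖ₑ) + K * A +
    (∑ i, segmentVariability a b s ε (partialDeriv i f) X) * A ^ (1 + s) +
    (∑ i, variabilityNorm a b s (partialDeriv i f) X) * A ^ (1 + s)

/-- The quantity that multiplies the seminorm of the second order process in the bound. -/
noncomputable def secondWeight (a b s : ℝ) (A : ℝ≥0) (f : Euc m → ℝ) (X : ℝ → Euc m)
    (i : Fin m) : ℝ≥0∞ :=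
  (∫⁻ t in Icc a b, ‖partialDeriv i f (X t)‖ₑ) +
    variabilityNorm a b s (partialDeriv i f) X * A ^ s

variable {K A : ℝ≥0} {f : Euc m → ℝ} {X : ℝ → Euc m}

lemma firstWeight_ne_top (hs : 0 < s) (hf : LipschitzBV K f) (hX : HolderPath a b β A X)
    (hS : ∀ i, segmentVariability a b s ε (partialDeriv i f) X ≠ ∞)
    (hV : ∀ i, variabilityNorm a b s (partialDeriv i f) X ≠ ∞) :
    firstWeight a b s ε K A f X ≠ ∞ := by
  have hA : (A : ℝ≥0∞) ^ (1 + s) ≠ ∞ :=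
    ENNReal.rpow_ne_top_of_nonneg (by linarith) ENNReal.coe_ne_top
  have h1 : ∫⁻ t in Icc a b, ‖f (X t)‖ₑ ≠ ∞ := by
    have : IntegrableOn (fun t => f (X t)) (Icc a b) :=
      (hf.lip.continuous.comp hX.cont).continuousOn.integrableOn_compact isCompact_Icc
    exact this.2.ne
  exact ENNReal.add_ne_top.2 ⟨ENNReal.add_ne_top.2 ⟨ENNReal.add_ne_top.2 ⟨h1,
    ENNReal.mul_ne_top ENNReal.coe_ne_top ENNReal.coe_ne_top⟩,
    ENNReal.mul_ne_top (ENNReal.sum_ne_top.2 fun i _ => hS i) hA⟩,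
    ENNReal.mul_ne_top (ENNReal.sum_ne_top.2 fun i _ => hV i) hA⟩

/-- The crude bound of the mean of a derivative by the Lipschitz constant; it is only used where the
product of the Lipschitz constant and the Hölder seminorm is available. -/
lemma lintegral_partialDeriv_le (hf : LipschitzBV K f) (X : ℝ → Euc m) (i : Fin m) :
    ∫⁻ t in Icc a b, ‖partialDeriv i f (X t)‖ₑ ≤ K * ENNReal.ofReal (b - a) := by
  calc ∫⁻ t in Icc a b, ‖partialDeriv i f (X t)‖ₑ ≤ ∫⁻ _t in Icc a b, (K : ℝ≥0∞) := by
        refine lintegral_mono fun t => ?_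
        rw [← ofReal_norm, ← ENNReal.ofReal_coe_nnreal]
        exact ENNReal.ofReal_le_ofReal (abs_partialDeriv_le hf.lip i _)
    _ = _ := by rw [setLIntegral_const, Real.volume_Icc]

lemma secondWeight_ne_top (hs : 0 < s) (hf : LipschitzBV K f)
    (hV : ∀ i, variabilityNorm a b s (partialDeriv i f) X ≠ ∞) (i : Fin m) :
    secondWeight a b s A f X i ≠ ∞ :=
  ENNReal.add_ne_top.2 ⟨ne_top_of_le_ne_top (ENNReal.mul_ne_top ENNReal.coe_ne_top
    ENNReal.ofReal_ne_top) (lintegral_partialDeriv_le hf X i), ENNReal.mul_ne_top (hV i)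
    (ENNReal.rpow_ne_top_of_nonneg hs.le ENNReal.coe_ne_top)⟩

lemma ae_derivPotential_ne_top (hf : LipschitzBV K f) (hX : HolderPath a b β A X)
    (hV : ∀ i, variabilityNorm a b s (partialDeriv i f) X ≠ ∞) :
    ∀ᵐ t ∂volume.restrict (Icc a b), ∀ i, derivPotential s f i (X t) ≠ ∞ := by
  rw [ae_all_iff]
  intro i
  filter_upwards [ae_lt_top ((measurable_derivPotential (hf.bv i)).comp hX.cont.measurable) (hV i)]
    with t ht using ht.ne

/-- Both double integrals are bounded by the corresponding weights, with a common constant. -/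
lemma AdmissibleExponent.exists_energy_le (m : ℕ) (h : AdmissibleExponent β s ε κ) (hab : a < b)
    (hβ : 0 < β) :
    ∃ C : ℝ≥0, ∀ (K A : ℝ≥0) (f : Euc m → ℝ) (X : ℝ → Euc m), LipschitzBV K f →
      HolderPath a b β A X → (∀ i, variabilityNorm a b s (partialDeriv i f) X ≠ ∞) →
      compEnergy a b (1 - κ) f X ≤ C * firstWeight a b s ε K A f X ∧
      ∀ i, derivEnergy a b (1 - (κ + κ)) f X i ≤ C * secondWeight a b s A f X i := by
  have h0 := h.pos
  have h2 := h.lt_half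
  obtain ⟨C₁, hC₁⟩ := exists_compEnergy_le m hab hβ.le h.s_pos h.eps_pos (by linarith)
    (by linarith) h.comp
  obtain ⟨C₂, hC₂⟩ := exists_derivEnergy_le (β := β) m hab h.s_pos (by linarith)
    (by linarith) h.deriv
  refine ⟨C₁ + C₂, fun K A f X hf hX hV => ⟨(hC₁ K A f X hf hX).trans ?_, fun i =>
    (hC₂ K A f X hf hX (ae_derivPotential_ne_top hf hX hV) i).trans ?_⟩⟩
  · rw [ENNReal.coe_add]
    exact mul_le_mul' le_self_add le_rfl
  · rw [ENNReal.coe_add]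
    exact mul_le_mul' le_add_self le_rfl

/-- The bound for the rough integral of one component. The mixed term `A * N` coming from the
second order process is absorbed by the first weight. -/
lemma AdmissibleExponent.exists_component_bound (m : ℕ) (h : AdmissibleExponent β s ε κ)
    (hab : a < b) (hβ : 0 < β) :
    ∃ C : ℝ≥0, ∀ (K A N : ℝ≥0) (N₂ : Fin m → ℝ≥0) (f : Euc m → ℝ) (X : ℝ → Euc m) (y : ℝ → ℝ)
      (z : Fin m → ℝ → ℝ → ℝ), LipschitzBV K f → HolderPath a b β A X →
      (∀ i, segmentVariability a b s ε (partialDeriv i f) X ≠ ∞) →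
      (∀ i, variabilityNorm a b s (partialDeriv i f) X ≠ ∞) →
      (∀ t ∈ Icc a b, ∀ u ∈ Icc a b, |y t - y u| ≤ N * |t - u| ^ β) →
      (∀ i, ScalarRough a b β A N (N₂ i) (fun t => X t i) y (z i)) →
      ‖(∫ r in Icc a b, compTerm a b κ f X y r) -
          ∑ i, ∫ r in Icc a b, areaTerm a b κ f X i (z i) r‖ₑ ≤
        C * (firstWeight a b s ε K A f X * N) + C * ∑ i, secondWeight a b s A f X i * N₂ i := by
  have h0 := h.pos
  have h2 := h.lt_half
  have hs := h.s_pos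
  obtain ⟨C, hC⟩ := h.exists_energy_le m hab hβ
  obtain ⟨c1, hc1⟩ : ∃ c : ℝ≥0, (c : ℝ≥0∞) =
      ENNReal.ofReal ((1 - κ) / Real.Gamma (1 - (1 - κ))) *
        ENNReal.ofReal (marchaudConst κ β * (b - a) ^ (β - κ)) := ⟨_, rfl⟩
  obtain ⟨c2, hc2⟩ : ∃ c : ℝ≥0, (c : ℝ≥0∞) =
      2 * ENNReal.ofReal ((1 - (κ + κ)) / Real.Gamma (1 - (1 - (κ + κ)))) *
        ENNReal.ofReal (marchaudConst κ β * (b - a) ^ (β - κ)) ^ 2 :=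
    ⟨2 * Real.toNNReal ((1 - (κ + κ)) / Real.Gamma (1 - (1 - (κ + κ)))) *
        Real.toNNReal (marchaudConst κ β * (b - a) ^ (β - κ)) ^ 2, by push_cast; rfl⟩
  obtain ⟨L, hL⟩ : ∃ c : ℝ≥0, (c : ℝ≥0∞) = ENNReal.ofReal (b - a) := ⟨_, rfl⟩
  refine ⟨c1 * C + c2 * C * (m * L + 1) + c2 * C, ?_⟩
  intro K A N N₂ f X y z hf hX hS hV hy hz
  obtain ⟨hE1, hE2⟩ := hC K A f X hf hX hV
  obtain ⟨T, hT⟩ : ∃ T, T = firstWeight a b s ε K A f X := ⟨_, rfl⟩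
  have hTt : T ≠ ∞ := hT ▸ firstWeight_ne_top hs hf hX hS hV
  have hGt := fun i => secondWeight_ne_top (a := a) (b := b) (A := A) hs hf hV i
  rw [← hT] at hE1 ⊢
  have b1 := enorm_compTerm_integral_le hf hX hab h0 (by linarith) h.lt N.coe_nonneg hy
    (ne_top_of_le_ne_top (ENNReal.mul_ne_top ENNReal.coe_ne_top hTt) hE1)
  have b2 := fun i => enorm_areaTerm_integral_le (N₂ := fun i => N₂ i) hf hX hab h0 h2 h.lt
    N.coe_nonneg i (N₂ i).coe_nonneg (hz i)
    (ne_top_of_le_ne_top (ENNReal.mul_ne_top ENNReal.coe_ne_top (hGt i)) (hE2 i))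
  rw [← hc1, ENNReal.ofReal_coe_nnreal] at b1
  simp only [← hc2, ENNReal.ofReal_coe_nnreal] at b2
  -- the mixed terms are dominated by the first weight
  have hmix : ∑ i, secondWeight a b s A f X i * A ≤ (m * L + 1) * T := by
    have e1 : ∀ i, secondWeight a b s A f X i * A ≤
        L * (K * A) + variabilityNorm a b s (partialDeriv i f) X * A ^ (1 + s) := by
      intro i
      rw [secondWeight, add_mul, mul_assoc (variabilityNorm a b s (partialDeriv i f) X)]
      refine add_le_add ?_ (mul_le_mul' le_rfl ?_)
      · calc _ ≤ (K * ENNReal.ofReal (b - a)) * A :=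
              mul_le_mul' (lintegral_partialDeriv_le hf X i) le_rfl
          _ = _ := by rw [hL]; ring
      · rw [add_comm, ENNReal.rpow_add_of_nonneg _ _ hs.le zero_le_one, ENNReal.rpow_one]
    refine (Finset.sum_le_sum fun i _ => e1 i).trans ?_
    rw [Finset.sum_add_distrib, Finset.sum_const, Finset.card_univ, Fintype.card_fin, nsmul_eq_mul,
      ← Finset.sum_mul, add_mul, one_mul, ← mul_assoc]
    refine add_le_add (mul_le_mul' le_rfl ?_) ?_
    · rw [hT, firstWeight]
      exact le_add_right (le_add_right le_add_self)
    · rw [hT, firstWeight]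
      exact le_add_self
  calc _ ≤ ‖∫ r in Icc a b, compTerm a b κ f X y r‖ₑ +
        ∑ i, ‖∫ r in Icc a b, areaTerm a b κ f X i (z i) r‖ₑ :=
        enorm_sub_le.trans (add_le_add le_rfl (enorm_sum_le _ _))
    _ ≤ c1 * (C * T * N) + ∑ i, c2 * (C * secondWeight a b s A f X i * (N₂ i + A * N)) := by
        refine add_le_add (b1.trans (by gcongr)) (Finset.sum_le_sum fun i _ => (b2 i).trans ?_)
        gcongr
        exact hE2 i
    _ = c1 * C * (T * N) + c2 * C * N * (∑ i, secondWeight a b s A f X i * A) +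
        c2 * C * ∑ i, secondWeight a b s A f X i * N₂ i := by
        rw [Finset.mul_sum, Finset.mul_sum, add_assoc, ← Finset.sum_add_distrib]
        congr 1
        · ring
        · exact Finset.sum_congr rfl fun i _ => by ring
    _ ≤ c1 * C * (T * N) + c2 * C * N * ((m * L + 1) * T) +
        c2 * C * ∑ i, secondWeight a b s A f X i * N₂ i := by gcongr
    _ = (c1 * C + c2 * C * (m * L + 1)) * (T * N) +
        c2 * C * ∑ i, secondWeight a b s A f X i * N₂ i := by ring
    _ ≤ _ := by
        push_cast
        exact add_le_add (mul_le_mul' le_self_add le_rfl) (mul_le_mul' le_add_self le_rfl)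

end

/-! ### Seminorms as Hölder constants -/

section

lemma exists_lipConst_eq {E : Type*} [MetricSpace E] {K : ℝ≥0} {f : E → ℝ} (hf : LipschitzWith K f) :
    ∃ K' : ℝ≥0, (K' : ℝ≥0∞) = lipConst f ∧ LipschitzWith K' f :=
  have h : MemHolder 1 f := hf.holderWith.memHolder
  ⟨nnHolderNorm 1 f, h.coe_nnHolderNorm_eq_eHolderNorm, holderWith_one.1 h.holderWith⟩

/-- The Hölder seminorm on `[a, b]` is attained as a Hölder constant. -/
lemma exists_holderSeminorm_eq {E : Type*} [MetricSpace E] {a b β : ℝ} (hβ : 0 ≤ β) {C : ℝ≥0}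
    {f : ℝ → E} (hf : HolderOnWith C β.toNNReal f (Icc a b)) :
    ∃ A : ℝ≥0, (A : ℝ≥0∞) = holderSeminorm a b β f ∧
      ∀ t ∈ Icc a b, ∀ u ∈ Icc a b, edist (f t) (f u) ≤ A * ENNReal.ofReal (|t - u| ^ β) := by
  have h : MemHolder β.toNNReal (fun t : Icc a b => f t) := hf.holderWith.memHolder
  refine ⟨_, h.coe_nnHolderNorm_eq_eHolderNorm, fun t ht u hu => ?_⟩
  have h1 := h.holderWith ⟨t, ht⟩ ⟨u, hu⟩
  rw [Real.coe_toNNReal _ hβ, Subtype.edist_mk_mk, edist_dist t u, Real.dist_eq,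
    ENNReal.ofReal_rpow_of_nonneg (abs_nonneg _) hβ] at h1
  exact h1

lemma abs_sub_le_of_edist_le {x y B : ℝ} {A : ℝ≥0} (hB : 0 ≤ B)
    (h : edist x y ≤ A * ENNReal.ofReal B) : |x - y| ≤ A * B := by
  rw [edist_dist, ← ENNReal.ofReal_coe_nnreal, ← ENNReal.ofReal_mul A.coe_nonneg,
    ENNReal.ofReal_le_ofReal_iff (by positivity)] at h
  exact h

/-- The two parameter seminorm is attained as a constant if it is finite. -/
lemma exists_twoParamSeminorm_eq {a b γ C : ℝ} {F : ℝ → ℝ → ℝ}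
    (h0 : ∀ t, a ≤ t → t ≤ b → F t t = 0)
    (h : ∀ s t, a ≤ s → s ≤ t → t ≤ b → |F s t| ≤ C * (t - s) ^ γ) :
    ∃ N : ℝ≥0, (N : ℝ≥0∞) = twoParamSeminorm a b γ F ∧
      ∀ s t, a ≤ s → s ≤ t → t ≤ b → |F s t| ≤ N * (t - s) ^ γ := by
  have hle : twoParamSeminorm a b γ F ≤ ENNReal.ofReal C := by
    refine iSup_le fun s => iSup_le fun t => iSup_le fun hs => iSup_le fun hst => iSup_le fun ht => ?_
    refine ENNReal.ofReal_le_ofReal ?_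
    rw [div_le_iff₀ (Real.rpow_pos_of_pos (sub_pos.2 hst) _)]
    exact h s t hs hst.le ht
  have hne := ne_top_of_le_ne_top ENNReal.ofReal_ne_top hle
  refine ⟨(twoParamSeminorm a b γ F).toNNReal, ENNReal.coe_toNNReal hne, fun s t hs hst ht => ?_⟩
  rcases hst.eq_or_lt with rfl | hst
  · rw [h0 s hs ht, abs_zero]
    exact mul_nonneg NNReal.zero_le_coe (Real.rpow_nonneg (by linarith) _)
  · have h1 : ENNReal.ofReal (|F s t| / (t - s) ^ γ) ≤ twoParamSeminorm a b γ F :=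
      le_iSup_of_le s (le_iSup_of_le t (le_iSup_of_le hs (le_iSup_of_le hst
        (le_iSup_of_le ht le_rfl))))
    rw [← div_le_iff₀ (Real.rpow_pos_of_pos (sub_pos.2 hst) _)]
    exact ENNReal.ofReal_le_iff_le_toReal hne |>.1 h1

end

section
variable {m : ℕ} {a b β s ε κ κ' α : ℝ} {A K N : ℝ≥0} {N₂ : Fin m → ℝ≥0} {X X₀ : ℝ → Euc m}
  {f : Euc m → ℝ} {y : ℝ → ℝ} {z : Fin m → ℝ → ℝ → ℝ}

/-! ### Existence and independence of the parameter for one component -/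

/-- The data of one component of the rough integral: a Lipschitz function `f`, a path `X` on the
line that agrees with `X₀` on `[a, b]`, an integrator `y` and second order processes `z i`. -/
structure RoughComponent (a b β s ε : ℝ) (K A N : ℝ≥0) (N₂ : Fin m → ℝ≥0) (f : Euc m → ℝ)
    (X X₀ : ℝ → Euc m) (y : ℝ → ℝ) (z : Fin m → ℝ → ℝ → ℝ) : Prop where
  func : LipschitzBV K f
  path : HolderPath a b β A X
  eqOn : ∀ t ∈ Icc a b, X t = X₀ t
  bdd : ∃ M, ∀ i t, |pathCoord a X i t| ≤ M
  seg : ∀ i, segmentVariability a b s ε (partialDeriv i f) X ≠ ∞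
  var : ∀ i, variabilityNorm a b s (partialDeriv i f) X ≠ ∞
  integrator : ∀ t ∈ Icc a b, ∀ u ∈ Icc a b, |y t - y u| ≤ N * |t - u| ^ β
  rough : ∀ i, ScalarRough a b β A N (N₂ i) (fun t => X t i) y (z i)

/-- Up to sign, the value of one component of the rough integral. -/
noncomputable def roughValue (a b κ : ℝ) (f : Euc m → ℝ) (X : ℝ → Euc m) (y : ℝ → ℝ)
    (z : Fin m → ℝ → ℝ → ℝ) : ℝ :=
  (∫ r in Icc a b, compTerm a b κ f X y r) - ∑ i, ∫ r in Icc a b, areaTerm a b κ f X i (z i) r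

lemma RoughComponent.energy_ne_top (h : RoughComponent a b β s ε K A N N₂ f X X₀ y z)
    (hκ : AdmissibleExponent β s ε κ) (hab : a < b) :
    compEnergy a b (1 - κ) f X ≠ ∞ ∧ ∀ i, derivEnergy a b (1 - (κ + κ)) f X i ≠ ∞ := by
  obtain ⟨C, hC⟩ := hκ.exists_energy_le m hab (hκ.pos.trans hκ.lt)
  obtain ⟨h1, h2⟩ := hC K A f X h.func h.path h.var
  exact ⟨ne_top_of_le_ne_top (ENNReal.mul_ne_top ENNReal.coe_ne_top
    (firstWeight_ne_top hκ.s_pos h.func h.path h.seg h.var)) h1, fun i => ne_top_of_le_ne_top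
    (ENNReal.mul_ne_top ENNReal.coe_ne_top (secondWeight_ne_top hκ.s_pos h.func h.var i)) (h2 i)⟩

/-- The value does not depend on the exponent, being the limit of a sequence that does not. -/
lemma RoughComponent.roughValue_eq (h : RoughComponent a b β s ε K A N N₂ f X X₀ y z)
    (hκ : AdmissibleExponent β s ε κ) (hκ' : AdmissibleExponent β s ε κ') (hab : a < b) :
    roughValue a b κ f X y z = roughValue a b κ' f X y z := by
  obtain ⟨M, hM⟩ := h.bdd
  have key : ∀ {k : ℝ}, AdmissibleExponent β s ε k → _ := fun {k} hk =>
    (tendsto_mollified_rough_integral (N₂ := fun i => N₂ i) h.func h.path hM hab hk.pos hk.lt_half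
      hk.lt N.coe_nonneg (fun i => (N₂ i).coe_nonneg) h.integrator h.rough
      (h.energy_ne_top hk hab).1 (h.energy_ne_top hk hab).2).2.2
  exact tendsto_nhds_unique (key hκ) (key hκ')

lemma RoughComponent.first (h : RoughComponent a b β s ε K A N N₂ f X X₀ y z)
    (hα : AdmissibleExponent β s ε (1 - α)) (hab : a < b) :
    (∀ᵐ r ∂volume.restrict (Icc a b), CompDerivDefined a α f X₀ r ∧
      RightDerivDefined b (1 - α) (fun t => ((y t - y b : ℝ) : ℂ)) r) ∧
    IntervalIntegrable (firstIntegrand a b α f X₀ y) volume a b ∧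
    ∫ r in a..b, firstIntegrand a b α f X₀ y r =
      (-1 : ℂ) ^ ((1 - α : ℝ) : ℂ) * ((∫ r in Icc a b, compTerm a b (1 - α) f X y r : ℝ) : ℂ) := by
  obtain ⟨M, hM⟩ := h.bdd
  obtain ⟨e1, e2⟩ := h.energy_ne_top hα hab
  have h1 := firstIntegrand_ae_eq h.func h.path h.eqOn hab hα.pos (by linarith [hα.lt_half])
    hα.lt N.coe_nonneg h.integrator e1 rfl
  have h2 := (tendsto_mollified_rough_integral (N₂ := fun i => N₂ i) h.func h.path hM hab hα.pos
    hα.lt_half hα.lt N.coe_nonneg (fun i => (N₂ i).coe_nonneg) h.integrator h.rough e1 e2).1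
  refine ⟨h1.mono fun r hr => ⟨hr.1, hr.2.1⟩, ?_⟩
  exact intervalIntegral_of_ae_eq_const_mul hab.le (h1.mono fun r hr => hr.2.2) h2

lemma RoughComponent.second (h : RoughComponent a b β s ε K A N N₂ f X X₀ y z)
    (hα : AdmissibleExponent β s ε (1 - α)) (hab : a < b) (i : Fin m) :
    (∀ᵐ r ∂volume.restrict (Icc a b),
      LeftDerivDefined a (2 * α - 1) (fun t => partialDeriv i f (X₀ t)) r ∧
      RightDerivTwoDefined b (1 - α) (z i) r ∧
      RightDerivDefined b (1 - α) (rightDerivTwo b (1 - α) (z i)) r) ∧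
    IntervalIntegrable (secondIntegrand a b α i f X₀ (z i)) volume a b ∧
    ∫ r in a..b, secondIntegrand a b α i f X₀ (z i) r =
      (-1 : ℂ) ^ ((1 - α : ℝ) : ℂ) * (-1 : ℂ) ^ ((1 - α : ℝ) : ℂ) *
        ((∫ r in Icc a b, areaTerm a b (1 - α) f X i (z i) r : ℝ) : ℂ) := by
  obtain ⟨M, hM⟩ := h.bdd
  obtain ⟨e1, e2⟩ := h.energy_ne_top hα hab
  have h1 := secondIntegrand_ae_eq (N₂ := fun i => N₂ i) h.func h.path h.eqOn hab hα.pos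
    hα.lt_half hα.lt N.coe_nonneg i (N₂ i).coe_nonneg (h.rough i) (e2 i) rfl
  have h2 := (tendsto_mollified_rough_integral (N₂ := fun i => N₂ i) h.func h.path hM hab hα.pos
    hα.lt_half hα.lt N.coe_nonneg (fun i => (N₂ i).coe_nonneg) h.integrator h.rough e1 e2).2.1 i
  refine ⟨h1.mono fun r hr => ⟨hr.1, hr.2.1, hr.2.2.1⟩, ?_⟩
  exact intervalIntegral_of_ae_eq_const_mul hab.le (h1.mono fun r hr => hr.2.2.2) h2

/-- Almost every point of the path is a Lebesgue point of the partial derivatives, and a point of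
differentiability. -/
lemma RoughComponent.ae_values (h : RoughComponent a b β s ε K A N N₂ f X X₀ y z) (hs : 0 < s) :
    ∀ᵐ t ∂volume.restrict (Icc a b), ∀ i,
      HasLebesgueValue (partialDeriv i f) (X₀ t) (partialDeriv i f (X₀ t)) ∧
      LineDifferentiableAt ℝ f (X₀ t) (EuclideanSpace.single i (1 : ℝ)) := by
  filter_upwards [ae_derivPotential_ne_top h.func h.path h.var, ae_restrict_mem measurableSet_Icc]
    with t ht htm i
  obtain ⟨h1, h2, -⟩ := h.func.exists_values hs ht
  rw [h.eqOn t htm] at h1 h2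
  exact ⟨h1 i, (h2.hasLineDerivAt _).lineDifferentiableAt⟩

end

/-! ### The rough integral -/

/-- The phases of the first integral: orders `α` and `1 - α`. -/
lemma neg_one_cpow_mul_first (α : ℝ) :
    (-1 : ℂ) ^ (α : ℂ) * (-1 : ℂ) ^ ((1 - α : ℝ) : ℂ) = -1 := by
  rw [← Complex.cpow_add _ _ (by norm_num)]
  push_cast
  rw [show (α : ℂ) + (1 - α) = 1 by ring, Complex.cpow_one]

/-- The phases of the second integral: orders `2α - 1` and twice `1 - α`. -/
lemma neg_one_cpow_mul_second (α : ℝ) :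
    (-1 : ℂ) ^ ((2 * α - 1 : ℝ) : ℂ) *
      ((-1 : ℂ) ^ ((1 - α : ℝ) : ℂ) * (-1 : ℂ) ^ ((1 - α : ℝ) : ℂ)) = -1 := by
  rw [← Complex.cpow_add _ _ (by norm_num), ← Complex.cpow_add _ _ (by norm_num)]
  push_cast
  rw [show (2 * (α : ℂ) - 1) + ((1 - α) + (1 - α)) = 1 by ring, Complex.cpow_one]

section
variable {m d : ℕ} {a b β s ε α : ℝ} {A : ℝ≥0} {K N : Fin d → ℝ≥0} {N₂ : Fin d → Fin m → ℝ≥0}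
  {X X₀ : ℝ → Euc m} {Y : ℝ → Euc d} {Z : ℝ → ℝ → Matrix (Fin m) (Fin d) ℝ} {φ : Euc m → Euc d}

lemma roughIntegralConverges (hα : AdmissibleExponent β s ε (1 - α)) (hab : a < b)
    (h : ∀ j, RoughComponent a b β s ε (K j) A (N j) (N₂ j) (fun x => φ x j) X X₀
      (fun t => Y t j) (fun i r t => Z r t i j)) :
    RoughIntegralConverges a b α φ X₀ Y Z where
  partials := by
    filter_upwards [ae_all_iff.2 fun j => (h j).ae_values hα.s_pos] with r hr i j
      using (hr j i).2
  comp := by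
    filter_upwards [ae_all_iff.2 fun j => ((h j).first hα hab).1] with r hr j using (hr j).1
  left := by
    filter_upwards [ae_all_iff.2 fun j => ae_all_iff.2 fun i => ((h j).second hα hab i).1]
      with r hr i j using (hr j i).1
  right := by
    filter_upwards [ae_all_iff.2 fun j => ((h j).first hα hab).1] with r hr j using (hr j).2
  rightTwo := by
    filter_upwards [ae_all_iff.2 fun j => ae_all_iff.2 fun i => ((h j).second hα hab i).1]
      with r hr i j using (hr j i).2.1
  rightComp := by
    filter_upwards [ae_all_iff.2 fun j => ae_all_iff.2 fun i => ((h j).second hα hab i).1]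
      with r hr i j using (hr j i).2.2
  first_integrable j := ((h j).first hα hab).2.1
  second_integrable i j := ((h j).second hα hab i).2.1

lemma roughIntegralExpr_eq (hα : AdmissibleExponent β s ε (1 - α)) (hab : a < b)
    (h : ∀ j, RoughComponent a b β s ε (K j) A (N j) (N₂ j) (fun x => φ x j) X X₀
      (fun t => Y t j) (fun i r t => Z r t i j)) :
    roughIntegralExpr a b α φ X₀ Y Z = ((-∑ j, roughValue a b (1 - α) (fun x => φ x j) X
      (fun t => Y t j) (fun i r t => Z r t i j) : ℝ) : ℂ) := by
  have h1 := fun j => ((h j).first hα hab).2.2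
  have h2 := fun i j => ((h j).second hα hab i).2.2
  simp only [roughIntegralExpr, h1, h2, roughValue, ← Finset.mul_sum]
  rw [← mul_assoc, ← mul_assoc, neg_one_cpow_mul_first, neg_one_cpow_mul_second, Finset.sum_comm]
  push_cast
  rw [Finset.sum_sub_distrib]
  ring

lemma segmentVariability_congr {ψ : Euc m → ℝ} (h : ∀ t ∈ Icc a b, X t = X₀ t) :
    segmentVariability a b s ε ψ X = segmentVariability a b s ε ψ X₀ := by
  refine setLIntegral_congr_fun measurableSet_Icc fun r hr =>
    setLIntegral_congr_fun measurableSet_Icc fun θ hθ => ?_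
  simp only [h r hr, h θ hθ]

lemma variabilityNorm_congr {ψ : Euc m → ℝ} (h : ∀ t ∈ Icc a b, X t = X₀ t) :
    variabilityNorm a b s ψ X = variabilityNorm a b s ψ X₀ :=
  setLIntegral_congr_fun measurableSet_Icc fun r hr => by simp only [h r hr]

lemma firstWeight_congr {K : ℝ≥0} {f : Euc m → ℝ} (h : ∀ t ∈ Icc a b, X t = X₀ t) :
    firstWeight a b s ε K A f X = firstWeight a b s ε K A f X₀ := by
  simp only [firstWeight, segmentVariability_congr h, variabilityNorm_congr h]
  rw [setLIntegral_congr_fun (g := fun t => ‖f (X₀ t)‖ₑ) measurableSet_Icc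
    fun r hr => by simp only [h r hr]]

lemma secondWeight_congr {f : Euc m → ℝ} (h : ∀ t ∈ Icc a b, X t = X₀ t) (i : Fin m) :
    secondWeight a b s A f X i = secondWeight a b s A f X₀ i := by
  simp only [secondWeight, variabilityNorm_congr h]
  rw [setLIntegral_congr_fun (g := fun t => ‖partialDeriv i f (X₀ t)‖ₑ) measurableSet_Icc
    fun r hr => by simp only [h r hr]]

/-- A multiplicative functional and a Lipschitz integrand give the data of all components, with the
seminorms themselves as constants. The path is continued by constants outside `[a, b]`. -/
lemma exists_roughComponent (hab : a < b) (hβ : 0 < β)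
    (hZ : IsMultiplicativeFunctional a b β X₀ Y Z) (hφ : ∃ K : ℝ≥0, LipschitzWith K φ)
    (hbv : ∀ (i : Fin m) (j : Fin d), IsBVLoc (partialDeriv i fun x => φ x j))
    (hV : ∀ (i : Fin m) (j : Fin d), IsVariable a b s 1 (partialDeriv i fun x => φ x j) X₀)
    (hS : ∀ (i : Fin m) (j : Fin d),
      segmentVariability a b s ε (partialDeriv i fun x => φ x j) X₀ < ∞) :
    ∃ (A : ℝ≥0) (K N : Fin d → ℝ≥0) (N₂ : Fin d → Fin m → ℝ≥0) (X : ℝ → Euc m),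
      (A : ℝ≥0∞) = holderSeminorm a b β X₀ ∧
      (∀ j, (K j : ℝ≥0∞) = lipConst fun x => φ x j) ∧
      (∀ j, (N j : ℝ≥0∞) = holderSeminorm a b β fun t => Y t j) ∧
      (∀ j i, (N₂ j i : ℝ≥0∞) = twoParamSeminorm a b (2 * β) fun r t => Z r t i j) ∧
      (∀ t ∈ Icc a b, X t = X₀ t) ∧
      ∀ j, RoughComponent a b β s ε (K j) A (N j) (N₂ j) (fun x => φ x j) X X₀
        (fun t => Y t j) (fun i r t => Z r t i j) := by
  obtain ⟨CX, hCX⟩ := hZ.holder_left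
  obtain ⟨CY, hCY⟩ := hZ.holder_right
  obtain ⟨CZ, hCZ⟩ := hZ.bound
  obtain ⟨L, hL⟩ := hφ
  have hβ' : 0 < β.toNNReal := Real.toNNReal_pos.2 hβ
  obtain ⟨A, hA, hA'⟩ := exists_holderSeminorm_eq hβ.le hCX
  have hproj : ∀ {n : ℕ} (j : Fin n), LipschitzWith 1 fun x : Euc n => x j := fun j =>
    LipschitzWith.of_dist_le_mul fun x y => by
      rw [NNReal.coe_one, one_mul, dist_eq_norm, dist_eq_norm, ← PiLp.sub_apply]
      exact PiLp.norm_apply_le _ j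
  have hK : ∀ j, ∃ K' : ℝ≥0, (K' : ℝ≥0∞) = lipConst (fun x => φ x j) ∧
      LipschitzWith K' fun x => φ x j := fun j => exists_lipConst_eq ((hproj j).comp hL)
  choose K hK hK' using hK
  have hN : ∀ j, ∃ N : ℝ≥0, (N : ℝ≥0∞) = holderSeminorm a b β (fun t => Y t j) ∧
      ∀ t ∈ Icc a b, ∀ u ∈ Icc a b, edist (Y t j) (Y u j) ≤ N * ENNReal.ofReal (|t - u| ^ β) := by
    intro j
    refine exists_holderSeminorm_eq hβ.le (C := CY) fun t ht u hu => ?_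
    refine le_trans ?_ (hCY t ht u hu)
    simpa using hproj j (Y t) (Y u)
  choose N hN hN' using hN
  have hZ0 : ∀ i j t, a ≤ t → t ≤ b → Z t t i j = 0 := fun i j t h1 h2 => by
    have := hZ.chen t t t h1 le_rfl le_rfl h2 i j
    simp only [sub_self, zero_mul, add_zero] at this
    linarith
  have hN₂ := fun j i => exists_twoParamSeminorm_eq (γ := 2 * β) (C := CZ)
    (F := fun r t => Z r t i j) (hZ0 i j) fun s t h1 h2 h3 => hCZ s t h1 h2 h3 i j
  choose N₂ hN₂ hN₂' using hN₂
  have hX : ∀ t ∈ Icc a b, X₀ (clamp a b t) = X₀ t := fun t ht => by rw [clamp_of_mem ht]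
  have hXc := hCX.continuousOn hβ'
  have hcont : Continuous fun t => X₀ (clamp a b t) :=
    hXc.comp_continuous (continuous_clamp a b) (clamp_mem hab)
  refine ⟨A, K, N, N₂, fun t => X₀ (clamp a b t), hA, hK, hN, hN₂, hX, fun j =>
    ⟨⟨hK' j, fun i => hbv i j⟩, ⟨hcont, fun t ht u hu => ?_⟩, hX, ?_, fun i => ?_, fun i => ?_,
      fun t ht u hu => abs_sub_le_of_edist_le (by positivity) (hN' j t ht u hu), fun i => ?_⟩⟩
  · rw [hX t ht, hX u hu, ← edist_eq_enorm_sub]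
    exact hA' t ht u hu
  · obtain ⟨M, hM⟩ := isCompact_Icc.exists_bound_of_continuousOn hXc
    refine ⟨M + M, fun i t => (abs_sub _ _).trans (add_le_add ?_ ?_)⟩
    · exact (PiLp.norm_apply_le _ i).trans (hM _ (clamp_mem hab t))
    · exact (PiLp.norm_apply_le _ i).trans (hM _ (clamp_mem hab a))
  · rw [segmentVariability_congr hX]
    exact (hS i j).ne
  · rw [variabilityNorm_congr hX]
    have := hV i j
    simp only [IsVariable, ENNReal.rpow_one] at this
    exact this.ne
  · refine ⟨fun t ht u hu => ?_, fun t ht u hu => abs_sub_le_of_edist_le (by positivity)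
      (hN' j t ht u hu), ?_, fun s u t h1 h2 h3 h4 => ?_, hN₂' j i⟩
    · rw [hX t ht, hX u hu]
      refine abs_sub_le_of_edist_le (by positivity) (le_trans ?_ (hA' t ht u hu))
      simpa using hproj i (X₀ t) (X₀ u)
    · exact (continuous_apply_apply i j).comp_continuousOn hZ.continuousOn
    · rw [hX u ⟨h1.trans h2, h3.trans h4⟩, hX s ⟨h1, h2.trans (h3.trans h4)⟩]
      exact hZ.chen s u t h1 h2 h3 h4 i j

end

theorem theorem3p3 (m : ℕ) (a b β s ε : ℝ) (hab : a < b)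
    (hβ₁ : 1 / 3 < β) (hβ₂ : β < 1 / 2)
    (hs₁ : 1 / β - 2 < s) (hs₂ : s < 1)
    (hε₁ : 1 / 2 * (β * (1 + s) - (1 - β)) < ε) (hε₂ : ε < β * (1 + s) - (1 - β)) :
    ∃ c : ℝ≥0, ∀ (d : ℕ) (X : ℝ → Euc m) (Y : ℝ → Euc d)
      (Z : ℝ → ℝ → Matrix (Fin m) (Fin d) ℝ) (φ : Euc m → Euc d),
      IsMultiplicativeFunctional a b β X Y Z →
      (∃ K : ℝ≥0, LipschitzWith K φ) →
      (∀ (i : Fin m) (j : Fin d), IsBVLoc (partialDeriv i fun x => φ x j)) →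
      (∀ (i : Fin m) (j : Fin d), IsVariable a b s 1 (partialDeriv i fun x => φ x j) X) →
      (∀ (i : Fin m) (j : Fin d),
        segmentVariability a b s ε (partialDeriv i fun x => φ x j) X < ∞) →
      (∀ᵐ t ∂(volume.restrict (Icc a b)), ∀ (i : Fin m) (j : Fin d),
        HasLebesgueValue (partialDeriv i fun x => φ x j) (X t)
          (partialDeriv i (fun x => φ x j) (X t))) ∧
      ∃ I : ℝ, HasRoughIntegral a b (Ioc (1 - β) (β * (1 + s) - ε)) φ X Y Z I ∧
        ‖I‖ₑ ≤
          c * ∑ j : Fin d,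
            ((∫⁻ t in Icc a b, ‖φ (X t) j‖ₑ)
              + lipConst (fun x => φ x j) * holderSeminorm a b β X
              + (∑ i : Fin m, segmentVariability a b s ε (partialDeriv i fun x => φ x j) X)
                  * holderSeminorm a b β X ^ (1 + s)
              + (∑ i : Fin m, variabilityNorm a b s (partialDeriv i fun x => φ x j) X)
                  * holderSeminorm a b β X ^ (1 + s))
              * holderSeminorm a b β (fun t => Y t j)
          + c * ∑ j : Fin d, ∑ i : Fin m,
            ((∫⁻ t in Icc a b, ‖partialDeriv i (fun x => φ x j) (X t)‖ₑ)
              + variabilityNorm a b s (partialDeriv i fun x => φ x j) X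
                  * holderSeminorm a b β X ^ s)
              * twoParamSeminorm a b (2 * β) (fun r t => Z r t i j) := by
  have hβ : 0 < β := by linarith
  -- The value of the integral is the same for all parameters, so the constant in the bound may be
  -- taken for a single one, here the largest.
  have hadm : ∀ α ∈ Ioc (1 - β) (β * (1 + s) - ε), AdmissibleExponent β s ε (1 - α) :=
    fun α hα => admissibleExponent hβ₁ hβ₂ hs₁ hs₂ hε₁ hα
  obtain ⟨κ, hκ⟩ : ∃ κ, AdmissibleExponent β s ε κ :=
    ⟨_, hadm (β * (1 + s) - ε) ⟨by linarith, le_rfl⟩⟩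
  obtain ⟨C, hC⟩ := hκ.exists_component_bound m hab hβ
  refine ⟨C, fun d X₀ Y Z φ hZ hφ hbv hV hS => ?_⟩
  obtain ⟨A, K, N, N₂, X, hA, hK, hN, hN₂, hX, h⟩ := exists_roughComponent hab hβ hZ hφ hbv hV hS
  refine ⟨?_, -∑ j, roughValue a b κ (fun x => φ x j) X (fun t => Y t j) (fun i r t => Z r t i j),
    fun α hα => ⟨roughIntegralConverges (hadm α hα) hab h, ?_⟩, ?_⟩
  · filter_upwards [ae_all_iff.2 fun j => (h j).ae_values hκ.s_pos] with t ht i j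
      using (ht j i).1
  · rw [roughIntegralExpr_eq (hadm α hα) hab h]
    simp only [fun j => (h j).roughValue_eq (hadm α hα) hκ hab]
  · rw [enorm_neg]
    calc _ ≤ ∑ j, (C * (firstWeight a b s ε (K j) A (fun x => φ x j) X₀ * N j) +
          C * ∑ i, secondWeight a b s A (fun x => φ x j) X₀ i * N₂ j i) := by
          refine (enorm_sum_le _ _).trans (Finset.sum_le_sum fun j _ => ?_)
          simp only [← firstWeight_congr hX, ← secondWeight_congr hX]
          exact hC (K j) A (N j) (N₂ j) _ X _ _ (h j).func (h j).path (h j).seg (h j).var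
            (h j).integrator (h j).rough
      _ = _ := by
          simp only [Finset.sum_add_distrib, ← Finset.mul_sum, firstWeight, secondWeight, hA, hK,
            hN, hN₂]
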